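/- **Setting.** Fix a finite set $\mathsf{Tid}$ of threads, a set $\mathsf{Loc}$ of locations and a set $\mathsf{Val}$ of values with a distinguished value $0$. Event labels are $\mathtt R(x,v)$, $\mathtt W(x,v)$ and $\mathtt{RMW}(x,v_R,v_W)$. A sequential program is a labeled transition system (LTS) whose labels are event labels; a program $P$ assigns one to each thread and runs by interleaving, with labels in $\mathsf{Tid}\times\mathsf{ELab}$. A memory system $\mathcal M$ is an LTS with observable labels in $\mathsf{Tid}\times\mathsf{ELab}$ and further silent labels. A behavior maps each thread to a finite or infinite sequence of event labels; the behavior of a run is obtained by projecting its observable labels to each thread. $\mathrm{Beh}(P)$ is the set of behaviors of runs of $P$; $\mathrm{Beh}^{\mathsf{tf}}(P)$ is the set of those of thread-fair runs (finite, or every thread enabled from index $k$ on steps at some index $\ge k$); $\mathrm{Beh}^{\mathsf{mf}}(\mathcal M)$ is the set of behaviors of memory-fair runs of $\mathcal M$ (finite, or every silent label enabled from index $k$ on is taken at some index $\ge k$). The memory-fair (thread&memory-fair) behaviors of $P$ under $\mathcal M$ are $\mathrm{Beh}(P)\cap\mathrm{Beh}^{\mathsf{mf}}(\mathcal M)$ (respectively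 $\mathrm{Beh}^{\mathsf{tf}}(P)\cap\mathrm{Beh}^{\mathsf{mf}}(\mathcal M)$). **Memory systems.** $\mathcal M_{\mathsf{SC}}$ is the interleaving memory $\mathsf{Loc}\to\mathsf{Val}$, initially $0$, without silent labels. $\mathcal M_{\mathsf{TSO}}$ adds a FIFO store buffer for each thread, with silent labels $\mathtt{prop}(\tau)$ that flush the oldest entry of the buffer of $\tau$; a thread reads the newest entry for the location in its own buffer, and otherwise the memory; RMWs require an empty buffer and act on the memory. $\mathcal M_{\mathsf{RA}}$ has a set of messages $\langle x,v,t,V\rangle$ with timestamps $t\in\mathbb N$ and views $V:\mathsf{Loc}\to\mathbb N$, and a view for each thread: a write picks a timestamp that is fresh for $x$ and above the thread's view of $x$; a read picks a message with timestamp at least the thread's view of $x$ and joins $V$ into the thread's view; an RMW is a read followed by a write at the next timestamp; the silent label $\mathtt{prop}(\tau,m)$ raises the view of $\tau$ at the location of $m$ to the timestamp of $m$ if it was smaller. $\mathcal M_{\mathsf{StrongCOH}}$ differs in that a read only sets the thread's view of $x$ to $t$. **Execution graphs.** An execution graph $G$ consists of a well-formed set $E$ of events (an initialization write of $0$ to each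 location, and events $\langle k,\tau,l\rangle$ whose serial numbers $k$ in each thread are distinct and form an initial segment of $\mathbb N$), a reads-from relation $\mathtt{rf}$ linking each read to exactly one write of the same location and value, and a modification order $\mathtt{mo}$, the union of a strict total order on the writes to each location; RMWs are both reads and writes. Program order $\mathtt{po}$ orders each thread by serial number and puts initialization before everything else; $\mathtt{fr}=(\mathtt{rf}^{-1};\mathtt{mo})\setminus\mathrm{id}$. $G$ is *fair* if in $\mathtt{mo}$ and in $\mathtt{fr}$ every event has finitely many predecessors. Write $R|_{\mathtt{loc}}$ for the restriction of $R$ to pairs of events on the same location, and let $\mathtt{hb}_{\mathsf{RA}}=(\mathtt{po}\cup\mathtt{rf})^+$ and $\mathtt{sc}_{\mathtt{loc}}=(\mathtt{po}|_{\mathtt{loc}}\cup\mathtt{rf}\cup\mathtt{mo}\cup\mathtt{fr})^+$. Then - $G\in\mathcal G_{\mathsf{SC}}$ iff $\mathtt{po}\cup\mathtt{rf}\cup\mathtt{mo}\cup\mathtt{fr}$ is acyclic; - $G\in\mathcal G_{\mathsf{TSO}}$ iff $\mathtt{sc}_{\mathtt{loc}}$ is irreflexive and $\mathtt{ppo}\cup(\mathtt{rf}\setminus\mathtt{po})\cup\mathtt{mo}\cup\mathtt{fr}$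 is acyclic, where $\mathtt{ppo}$ is $\mathtt{po}$ without the pairs from a non-RMW write to a non-RMW read; - $G\in\mathcal G_{\mathsf{RA}}$ iff $\mathtt{hb}_{\mathsf{RA}}|_{\mathtt{loc}}\cup\mathtt{rf}\cup\mathtt{mo}\cup\mathtt{fr}$ is acyclic; - $G\in\mathcal G_{\mathsf{StrongCOH}}$ iff $\mathtt{hb}_{\mathsf{RA}}$ and $\mathtt{sc}_{\mathtt{loc}}$ are irreflexive. For $\mathsf{RC11}$, labels carry C11 access modes $\mathsf{na}\sqsubset\mathsf{rlx}\sqsubset\mathsf{acq},\mathsf{rel}\sqsubset\mathsf{acqrel}\sqsubset\mathsf{sc}$ and fences are added (under $\mathsf{SC}$, modes and fences have no effect). $\mathcal G_{\mathsf{RC11}}$ is the RC11 consistency predicate of Lahav et al. (PLDI 2017) for single-event RMWs: $\mathtt{hb};\mathtt{eco}^?$ and $\mathtt{eco}$ are irreflexive, and $\mathtt{psc}$ and $\mathtt{po}\cup\mathtt{rf}$ are acyclic, where - $\mathtt{eco}=(\mathtt{rf}\cup\mathtt{mo}\cup\mathtt{fr})^+$ and $\mathtt{hb}=(\mathtt{po}\cup\mathtt{sw})^+$;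 - $\mathtt{rs}=[\mathtt W];\mathtt{po}|_{\mathtt{loc}}^?;[\mathtt W^{\sqsupseteq\mathsf{rlx}}];(\mathtt{rf};[\mathtt{RMW}])^*$; - $\mathtt{sw}=[\mathtt E^{\sqsupseteq\mathsf{rel}}];([\mathtt F];\mathtt{po})^?;\mathtt{rs};\mathtt{rf};[\mathtt R^{\sqsupseteq\mathsf{rlx}}];(\mathtt{po};[\mathtt F])^?;[\mathtt E^{\sqsupseteq\mathsf{acq}}]$; - $\mathtt{scb}=\mathtt{po}\cup\mathtt{po}|_{\neq\mathtt{loc}};\mathtt{hb};\mathtt{po}|_{\neq\mathtt{loc}}\cup\mathtt{hb}|_{\mathtt{loc}}\cup\mathtt{mo}\cup\mathtt{fr}$, where $\mathtt{po}|_{\neq\mathtt{loc}}=\mathtt{po}\setminus\mathtt{po}|_{\mathtt{loc}}$; - $\mathtt{psc}=([\mathtt E^{\mathsf{sc}}]\cup[\mathtt F^{\mathsf{sc}}];\mathtt{hb}^?);\mathtt{scb};([\mathtt E^{\mathsf{sc}}]\cup\mathtt{hb}^?;[\mathtt F^{\mathsf{sc}}])\ \cup\ [\mathtt F^{\mathsf{sc}}];(\mathtt{hb}\cup\mathtt{hb};\mathtt{eco};\mathtt{hb});[\mathtt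 F^{\mathsf{sc}}]$. As RC11 is a purely declarative model, "$\beta\in\mathrm{Beh}^{\mathsf{mf}}(\mathcal M_{\mathsf{RC11}})$" means that the events of $\beta$ together with the initialization events are the event set of some fair $G\in\mathcal G_{\mathsf{RC11}}$. **Robustness.** $P$ is *finitely execution-graph robust* against $\mathcal G$ if for every finite $\beta\in\mathrm{Beh}(P)$, every $G\in\mathcal G$ whose events are the events of $\beta$ together with the initialization events belongs to $\mathcal G_{\mathsf{SC}}$. **Corollary.** Let $X\in\{\mathsf{TSO},\mathsf{RA},\mathsf{StrongCOH},\mathsf{RC11}\}$ and let $P$ be a program that is finitely execution-graph robust against $\mathcal G_X$. Then the set of memory-fair behaviors of $P$ under $\mathcal M_X$ coincides with the set of memory-fair behaviors of $P$ under $\mathcal M_{\mathsf{SC}}$, and the set of thread&memory-fair behaviors of $P$ under $\mathcal M_X$ coincides with the set of thread&memory-fair behaviors of $P$ under $\mathcal M_{\mathsf{SC}}$. -/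

import Mathlib

namespace WeakMem

universe u v w

/-! ### Finite or infinite sequences

`Stream'.Seq α` is Mathlib's type of finite or infinite sequences over `α`; `s.get? k` is the
`k`-th entry, or `none` when `k` lies outside the domain; `s.Terminates` says that `s` is finite. -/

section Sequences

variable {α : Type u} {β : Type v}

/-- The `i`-th entry of `s` survives the partial map `f`. -/
def Kept (f : α → Option β) (s : Stream'.Seq α) (i : ℕ) : Prop :=
  ∃ b, (s.get? i).bind f = some b

open Classical in
/-- The `k`-th entry of the restriction of `s` along the partial map `f`: it comes from the position
`i` of `s` which survives and which has exactly `k` surviving positions before it. -/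
noncomputable def restrictFun (f : α → Option β) (s : Stream'.Seq α) (k : ℕ) : Option β :=
  if h : ∃ i, Kept f s i ∧ Nat.count (Kept f s) i = k then (s.get? h.choose).bind f else none

theorem restrictFun_isSeq (f : α → Option β) (s : Stream'.Seq α) :
    Stream'.IsSeq (restrictFun f s) := by
  classical
  intro n hn
  change restrictFun f s n = none at hn
  unfold restrictFun at hn ⊢
  rw [dif_neg]
  rintro ⟨i, hi, hc⟩
  have hex : ∃ j, Kept f s j ∧ Nat.count (Kept f s) j = n := by
    clear hn hi
    induction i with
    | zero => simp at hc
    | succ m ih =>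
      rw [Nat.count_succ] at hc
      by_cases hm : Kept f s m
      · rw [if_pos hm] at hc
        exact ⟨m, hm, by convert Nat.succ.inj hc⟩
      · rw [if_neg hm] at hc
        exact ih hc
  rw [dif_pos hex] at hn
  obtain ⟨b, hb⟩ := hex.choose_spec.1
  rw [hb] at hn
  exact absurd hn (by simp)

/-- The subsequence of the entries of `s` on which `f` is defined, with `f` applied to them. -/
noncomputable def restrict (f : α → Option β) (s : Stream'.Seq α) : Stream'.Seq β :=
  ⟨restrictFun f s, restrictFun_isSeq f s⟩

end Sequences

/-! ### Labeled transition systems -/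

/-- A labeled transition system with observable labels `S` and silent labels `T`. -/
structure LTS (S : Type u) (T : Type v) where
  Q : Type w
  init : Q
  step : Q → S ⊕ T → Q → Prop

namespace LTS

variable {S : Type u} {T : Type v}

/-- Triples (source, label, target). -/
abbrev Trans (A : LTS.{u, v, w} S T) := A.Q × (S ⊕ T) × A.Q

/-- The label `σ` is enabled in the state `q`. -/
def Enabled (A : LTS.{u, v, w} S T) (σ : S ⊕ T) (q : A.Q) : Prop := ∃ q', A.step q σ q'

/-- A run: a finite or infinite sequence of consecutive transitions from the initial state. -/
structure IsRun (A : LTS.{u, v, w} S T) (μ : Stream'.Seq A.Trans) : Prop where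
  trans : ∀ k t, μ.get? k = some t → A.step t.1 t.2.1 t.2.2
  start : ∀ t, μ.get? 0 = some t → t.1 = A.init
  consec : ∀ k t t', μ.get? k = some t → μ.get? (k + 1) = some t' → t.2.2 = t'.1

/-- The trace induced by a sequence of transitions. -/
def traceOf (A : LTS.{u, v, w} S T) (μ : Stream'.Seq A.Trans) : Stream'.Seq (S ⊕ T) :=
  μ.map (fun t => t.2.1)

/-- The observable trace induced by a sequence of transitions. -/
noncomputable def obsTraceOf (A : LTS.{u, v, w} S T) (μ : Stream'.Seq A.Trans) : Stream'.Seq S :=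
  restrict Sum.getLeft? (A.traceOf μ)

/-- The set of observable traces. -/
def OTraces (A : LTS.{u, v, w} S T) : Set (Stream'.Seq S) :=
  {ρ | ∃ μ, A.IsRun μ ∧ A.obsTraceOf μ = ρ}

/-- A run is memory-fair if it is finite, or every silent label that is continuously enabled from
some index `k` on is taken at some index `j ≥ k`. -/
def MemFairRun (A : LTS.{u, v, w} S T) (μ : Stream'.Seq A.Trans) : Prop :=
  A.IsRun μ ∧ (μ.Terminates ∨
    ∀ (θ : T) (k : ℕ),
      (∀ j ≥ k, ∀ t, μ.get? j = some t → A.Enabled (Sum.inr θ) t.1) →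
      ∃ j ≥ k, ∃ t, μ.get? j = some t ∧ t.2.1 = Sum.inr θ)

/-- The set of memory-fair observable traces. -/
def MemFairOTraces (A : LTS.{u, v, w} S T) : Set (Stream'.Seq S) :=
  {ρ | ∃ μ, A.MemFairRun μ ∧ A.obsTraceOf μ = ρ}

end LTS

/-! ### Event labels -/

/-- Event labels: reads, writes and read-modify-writes. -/
inductive ELab (Loc : Type u) (Val : Type v)
  | read (x : Loc) (vR : Val)
  | write (x : Loc) (vW : Val)
  | rmw (x : Loc) (vR vW : Val)

namespace ELab

variable {Loc : Type u} {Val : Type v}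

def loc : ELab Loc Val → Loc
  | read x _ => x
  | write x _ => x
  | rmw x _ _ => x

/-- The value read, for reads and read-modify-writes. -/
def valR : ELab Loc Val → Option Val
  | read _ v => some v
  | write _ _ => none
  | rmw _ v _ => some v

/-- The value written, for writes and read-modify-writes. -/
def valW : ELab Loc Val → Option Val
  | read _ _ => none
  | write _ v => some v
  | rmw _ _ v => some v

end ELab

/-- Access modes of RC11: non-atomic, relaxed, acquire, release, acquire-release, sequentially
consistent. -/
inductive Mode
  | na | rlx | acq | rel | acqrel | sc

/-- At least relaxed, in the order `na ⊏ rlx ⊏ acq, rel ⊏ acqrel ⊏ sc`. -/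
def Mode.AtLeastRlx (o : Mode) : Prop := o ≠ .na
/-- At least acquire. -/
def Mode.AtLeastAcq (o : Mode) : Prop := o = .acq ∨ o = .acqrel ∨ o = .sc
/-- At least release. -/
def Mode.AtLeastRel (o : Mode) : Prop := o = .rel ∨ o = .acqrel ∨ o = .sc

/-- Modes of reads. -/
inductive RMode
  | na | rlx | acq | sc
/-- Modes of writes. -/
inductive WMode
  | na | rlx | rel | sc
/-- Modes of read-modify-writes. -/
inductive UMode
  | rlx | acq | rel | acqrel | sc
/-- Modes of fences. -/
inductive FMode
  | acq | rel | acqrel | sc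

def RMode.mode : RMode → Mode
  | na => .na | rlx => .rlx | acq => .acq | sc => .sc
def WMode.mode : WMode → Mode
  | na => .na | rlx => .rlx | rel => .rel | sc => .sc
def UMode.mode : UMode → Mode
  | rlx => .rlx | acq => .acq | rel => .rel | acqrel => .acqrel | sc => .sc
def FMode.mode : FMode → Mode
  | acq => .acq | rel => .rel | acqrel => .acqrel | sc => .sc

/-- Event labels of RC11: accesses annotated with modes, and fences. -/
inductive CLab (Loc : Type u) (Val : Type v)
  | read (o : RMode) (x : Loc) (vR : Val)
  | write (o : WMode) (x : Loc) (vW : Val)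
  | rmw (o : UMode) (x : Loc) (vR vW : Val)
  | fence (o : FMode)

/-- The mode of an RC11 label. -/
def CLab.mode {Loc : Type u} {Val : Type v} : CLab Loc Val → Mode
  | read o _ _ => o.mode
  | write o _ _ => o.mode
  | rmw o _ _ _ => o.mode
  | fence o => o.mode

/-- The memory access performed by a label (`none` for fences). It allows treating the plain labels
`ELab` and the RC11 labels `CLab` uniformly. -/
class MemLabel (L : Type w) (Loc : outParam (Type u)) (Val : outParam (Type v)) where
  access : L → Option (ELab Loc Val)

instance instMemLabelELab {Loc : Type u} {Val : Type v} : MemLabel (ELab Loc Val) Loc Val :=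
  ⟨some⟩

instance instMemLabelCLab {Loc : Type u} {Val : Type v} : MemLabel (CLab Loc Val) Loc Val where
  access
    | .read _ x v => some (.read x v)
    | .write _ x v => some (.write x v)
    | .rmw _ x vR vW => some (.rmw x vR vW)
    | .fence _ => none

/-! ### Programs and behaviors -/

section Programs

variable {Tid : Type u} {L : Type v}

/-- A sequential program is an LTS over event labels without silent labels; a program assigns a
sequential program to every thread. -/
abbrev Program (Tid : Type u) (L : Type v) := Tid → LTS.{v, 0, w} L Empty

open Classical in
/-- The LTS induced by a program: interleaving semantics. -/
noncomputable def Program.lts (P : Program.{u, v, w} Tid L) :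
    LTS.{max u v, 0, max u w} (Tid × L) Empty where
  Q := ∀ τ, (P τ).Q
  init := fun τ => (P τ).init
  step p σ p' :=
    match σ with
    | Sum.inl (τ, l) => ∃ q, (P τ).step (p τ) (Sum.inl l) q ∧ p' = Function.update p τ q
    | Sum.inr e => e.elim

/-- A behavior assigns a sequential trace to every thread. -/
abbrev Behavior (Tid : Type u) (L : Type v) := Tid → Stream'.Seq L

open Classical in
/-- The behavior induced by a concurrent trace. -/
noncomputable def behOf (ρ : Stream'.Seq (Tid × L)) : Behavior Tid L :=
  fun τ => restrict (fun σ => if σ.1 = τ then some σ.2 else none) ρ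

/-- A behavior is finite if each of its sequential traces is (there are finitely many threads). -/
def Behavior.IsFinite (β : Behavior Tid L) : Prop := ∀ τ, (β τ).Terminates

/-- Behaviors of an LTS over `Tid × L`. -/
def LTS.Beh {T : Type*} (A : LTS (Tid × L) T) : Set (Behavior Tid L) := behOf '' A.OTraces

/-- Memory-fair behaviors of a memory system. -/
def LTS.BehMF {T : Type*} (A : LTS (Tid × L) T) : Set (Behavior Tid L) := behOf '' A.MemFairOTraces

/-- The thread `τ` is enabled in the program state `p`. -/
def Program.ThreadEnabled (P : Program.{u, v, w} Tid L) (τ : Tid) (p : P.lts.Q) : Prop :=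
  ∃ l : L, P.lts.Enabled (Sum.inl (τ, l)) p

/-- A run of a program is thread-fair if it is finite, or every thread that is continuously enabled
from some index `k` on makes a step at some index `j ≥ k`. -/
def Program.ThreadFairRun (P : Program.{u, v, w} Tid L) (μ : Stream'.Seq P.lts.Trans) : Prop :=
  P.lts.IsRun μ ∧ (μ.Terminates ∨
    ∀ (τ : Tid) (k : ℕ),
      (∀ j ≥ k, ∀ t, μ.get? j = some t → P.ThreadEnabled τ t.1) →
      ∃ j ≥ k, ∃ t, μ.get? j = some t ∧ ∃ l : L, t.2.1 = Sum.inl (τ, l))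

/-- Behaviors of a program. -/
def Program.Beh (P : Program.{u, v, w} Tid L) : Set (Behavior Tid L) := P.lts.Beh

/-- Thread-fair behaviors of a program. -/
def Program.BehTF (P : Program.{u, v, w} Tid L) : Set (Behavior Tid L) :=
  {β | ∃ μ, P.ThreadFairRun μ ∧ behOf (P.lts.obsTraceOf μ) = β}

/-- Memory-fair behaviors of `P` under the memory system `M`. -/
def Program.MemFairBehUnder (P : Program.{u, v, w} Tid L) {T : Type*} (M : LTS (Tid × L) T) :
    Set (Behavior Tid L) := P.Beh ∩ M.BehMF

/-- Thread&memory-fair behaviors of `P` under the memory system `M`. -/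
def Program.ThreadMemFairBehUnder (P : Program.{u, v, w} Tid L) {T : Type*}
    (M : LTS (Tid × L) T) : Set (Behavior Tid L) := P.BehTF ∩ M.BehMF

end Programs

/-! ### Operational memory systems -/

section Operational

variable (Tid : Type u) (Loc : Type v) (Val : Type w) [Zero Val]

open Classical in
/-- Sequential consistency. There are no silent transitions; fences, where the label type has them,
and access modes have no effect. -/
noncomputable def MSC (L : Type*) [MemLabel L Loc Val] : LTS (Tid × L) Empty where
  Q := Loc → Val
  init := fun _ => 0
  step M σ M' :=
    match σ with
    | Sum.inl (_, l) =>
      match MemLabel.access l with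
      | some (.read x v) => M x = v ∧ M' = M
      | some (.write x v) => M' = Function.update M x v
      | some (.rmw x vR vW) => M x = vR ∧ M' = Function.update M x vW
      | none => M' = M
    | Sum.inr e => e.elim

open Classical in
/-- Total store order: a memory and a FIFO store buffer for every thread, newest entry first. The
silent label `τ` propagates the oldest entry of the buffer of `τ` to the memory. -/
noncomputable def MTSO : LTS (Tid × ELab Loc Val) Tid where
  Q := (Loc → Val) × (Tid → List (Loc × Val))
  init := (fun _ => 0, fun _ => [])
  step q σ q' :=
    match σ with
    | Sum.inl (τ, .write x v) => q' = (q.1, Function.update q.2 τ ((x, v) :: q.2 τ))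
    | Sum.inl (τ, .read x v) =>
      (q.2 τ).foldr (fun p M => Function.update M p.1 p.2) q.1 x = v ∧ q' = q
    | Sum.inl (τ, .rmw x vR vW) =>
      q.2 τ = [] ∧ q.1 x = vR ∧ q' = (Function.update q.1 x vW, q.2)
    | Sum.inr τ => ∃ b x v, q.2 τ = b ++ [(x, v)] ∧
      q' = (Function.update q.1 x v, Function.update q.2 τ b)

/-- Views map locations to timestamps. -/
abbrev View (Loc : Type v) := Loc → ℕ

/-- Messages of the timestamp-based memory systems. -/
structure Msg (Loc : Type v) (Val : Type w) where
  loc : Loc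
  val : Val
  ts : ℕ
  view : View Loc

/-- States of the timestamp-based memory systems: a set of messages and a view for every thread. -/
abbrev ViewState := Set (Msg Loc Val) × (Tid → View Loc)

variable {Tid Loc Val}

open Classical in
/-- Write step of thread `τ`. -/
def viewWrite (τ : Tid) (x : Loc) (v : Val) (q q' : ViewState Tid Loc Val) : Prop :=
  ∃ t : ℕ, (¬ ∃ m ∈ q.1, m.loc = x ∧ m.ts = t) ∧ q.2 τ x < t ∧
    q'.2 = Function.update q.2 τ (Function.update (q.2 τ) x t) ∧
    q'.1 = q.1 ∪ {⟨x, v, t, q'.2 τ⟩}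

open Classical in
/-- Read step of thread `τ`, where `upd V m` is the new view of a thread with view `V` that reads
the message `m`. -/
def viewRead (upd : View Loc → Msg Loc Val → View Loc) (τ : Tid) (x : Loc) (v : Val)
    (q q' : ViewState Tid Loc Val) : Prop :=
  ∃ m ∈ q.1, m.loc = x ∧ m.val = v ∧ q.2 τ x ≤ m.ts ∧
    q' = (q.1, Function.update q.2 τ (upd (q.2 τ) m))

open Classical in
/-- The timestamp-based memory system with read update `upd`. The silent label `(τ, m)` propagates
the message `m` to the thread `τ`. -/
noncomputable def viewMem (upd : View Loc → Msg Loc Val → View Loc) :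
    LTS (Tid × ELab Loc Val) (Tid × Msg Loc Val) where
  Q := ViewState Tid Loc Val
  init := ({m | ∃ x, m = ⟨x, 0, 0, fun _ => 0⟩}, fun _ _ => 0)
  step q σ q' :=
    match σ with
    | Sum.inl (τ, .write x v) => viewWrite τ x v q q'
    | Sum.inl (τ, .read x v) => viewRead upd τ x v q q'
    | Sum.inl (τ, .rmw x vR vW) => ∃ q₁, viewRead upd τ x vR q q₁ ∧ viewWrite τ x vW q₁ q' ∧
      q'.2 τ x = q₁.2 τ x + 1
    | Sum.inr (τ, m) => m ∈ q.1 ∧ q.2 τ m.loc < m.ts ∧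
      q' = (q.1, Function.update q.2 τ (Function.update (q.2 τ) m.loc m.ts))

variable (Tid Loc Val)

/-- Release/acquire: a reader joins the view of the message into its own. -/
noncomputable def MRA : LTS (Tid × ELab Loc Val) (Tid × Msg Loc Val) :=
  viewMem (fun V m => V ⊔ m.view)

open Classical in
/-- Strong coherence: a reader only takes over the timestamp of the message. -/
noncomputable def MStrongCOH : LTS (Tid × ELab Loc Val) (Tid × Msg Loc Val) :=
  viewMem (fun V m => Function.update V m.loc m.ts)

end Operational

/-! ### Events and execution graphs -/

/-- Events: the initialization event of a location, or an event with a serial number, a thread and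
a label. -/
inductive Event (Tid : Type*) (Loc : Type*) (L : Type*)
  | init (x : Loc)
  | ev (k : ℕ) (τ : Tid) (l : L)

namespace Event

variable {Tid Loc Val L : Type*} [MemLabel L Loc Val] [Zero Val]

def IsInit : Event Tid Loc L → Prop
  | init _ => True
  | ev _ _ _ => False

/-- The memory access of an event; initialization events write `0`. -/
def access : Event Tid Loc L → Option (ELab Loc Val)
  | init x => some (.write x 0)
  | ev _ _ l => MemLabel.access l

/-- The location of an event (`none` for fences). -/
def loc (e : Event Tid Loc L) : Option Loc := (access e).map ELab.loc
/-- The value read by an event, if any. -/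
def valR (e : Event Tid Loc L) : Option Val := (access e).bind ELab.valR
/-- The value written by an event, if any. -/
def valW (e : Event Tid Loc L) : Option Val := (access e).bind ELab.valW

/-- Reads, including read-modify-writes. -/
def IsR (e : Event Tid Loc L) : Prop := (valR e).isSome
/-- Writes, including read-modify-writes. -/
def IsW (e : Event Tid Loc L) : Prop := (valW e).isSome
/-- Read-modify-writes. -/
def IsRMW (e : Event Tid Loc L) : Prop := IsR e ∧ IsW e

/-- Both events access a common location. -/
def SameLoc (a b : Event Tid Loc L) : Prop := ∃ x, loc a = some x ∧ loc b = some x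

/-- The sequenced-before order. -/
def Sb : Event Tid Loc L → Event Tid Loc L → Prop
  | init _, ev _ _ _ => True
  | ev k τ _, ev k' τ' _ => τ = τ' ∧ k < k'
  | _, init _ => False

end Event

section Graphs

variable {Tid Loc Val L : Type*}

/-- The set of events extracted from a behavior. -/
def eventsOf (Loc : Type*) (β : Behavior Tid L) : Set (Event Tid Loc L) :=
  {e | (∃ x, e = .init x) ∨ ∃ k τ l, (β τ).get? k = some l ∧ e = .ev k τ l}

/-- Well-formed sets of events. -/
structure WellFormed (E : Set (Event Tid Loc L)) : Prop where
  init_mem : ∀ x, Event.init x ∈ E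
  unique : ∀ k τ l l', Event.ev k τ l ∈ E → Event.ev k τ l' ∈ E → l = l'
  closed : ∀ k τ l, Event.ev k τ l ∈ E → ∀ j < k, ∃ l', Event.ev j τ l' ∈ E

variable [MemLabel L Loc Val] [Zero Val]

variable (Tid L) in
/-- Execution graphs: a well-formed set of events, a reads-from relation, and a modification order,
which is the union over the locations of strict total orders on the writes to that location. -/
structure EGraph where
  E : Set (Event Tid Loc L)
  rf : Event Tid Loc L → Event Tid Loc L → Prop
  mo : Event Tid Loc L → Event Tid Loc L → Prop
  wf : WellFormed E
  rf_mem : ∀ w r, rf w r → w ∈ E ∧ r ∈ E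
  rf_type : ∀ w r, rf w r → w.IsW ∧ r.IsR
  rf_loc : ∀ w r, rf w r → w.loc = r.loc
  rf_val : ∀ w r, rf w r → w.valW = r.valR
  rf_fun : ∀ w w' r, rf w r → rf w' r → w = w'
  rf_total : ∀ r ∈ E, r.IsR → ∃ w, rf w r
  mo_mem : ∀ a b, mo a b → a ∈ E ∧ b ∈ E
  mo_type : ∀ a b, mo a b → a.IsW ∧ b.IsW ∧ a.SameLoc b
  mo_irrefl : ∀ a, ¬ mo a a
  mo_trans : ∀ a b c, mo a b → mo b c → mo a c
  mo_total : ∀ a ∈ E, ∀ b ∈ E, a.IsW → b.IsW → a.SameLoc b → a ≠ b → mo a b ∨ mo b a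

/-- A declarative memory system is a set of execution graphs. -/
abbrev DeclMem (Tid L : Type*) {Loc Val : Type*} [MemLabel L Loc Val] [Zero Val] :=
  Set (EGraph Tid L)

/-- The behaviors allowed by a declarative memory system. -/
def DeclMem.Beh (𝒢 : DeclMem Tid L) : Set (Behavior Tid L) :=
  {β | ∃ G ∈ 𝒢, eventsOf Loc β = G.E}

/-- Every element has finitely many predecessors. -/
def PrefixFinite {α : Type*} (R : α → α → Prop) : Prop := ∀ b, {a | R a b}.Finite

/-- `R` is irreflexive. -/
def Irrefl {α : Type*} (R : α → α → Prop) : Prop := ∀ a, ¬ R a a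

/-- `R` has no cycles. -/
def Acyclic {α : Type*} (R : α → α → Prop) : Prop := Irrefl (Relation.TransGen R)

namespace EGraph

variable (G : EGraph Tid L)

/-- Program order. -/
def po (a b : Event Tid Loc L) : Prop := a ∈ G.E ∧ b ∈ G.E ∧ a.Sb b

/-- From-read. -/
def fr (a b : Event Tid Loc L) : Prop := (∃ w, G.rf w a ∧ G.mo w b) ∧ a ≠ b

/-- SC-happens-before. -/
def hbSC : Event Tid Loc L → Event Tid Loc L → Prop :=
  Relation.TransGen fun a b => G.po a b ∨ G.rf a b ∨ G.mo a b ∨ G.fr a b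

/-- External reads-from. -/
def rfe (a b : Event Tid Loc L) : Prop := G.rf a b ∧ ¬ G.po a b

/-- Preserved program order. -/
def ppo (a b : Event Tid Loc L) : Prop :=
  G.po a b ∧ ¬ ((a.IsW ∧ ¬ a.IsRMW) ∧ (b.IsR ∧ ¬ b.IsRMW))

/-- TSO-happens-before. -/
def hbTSO : Event Tid Loc L → Event Tid Loc L → Prop :=
  Relation.TransGen fun a b => G.ppo a b ∨ G.rfe a b ∨ G.mo a b ∨ G.fr a b

/-- SC-per-location order. -/
def scLoc : Event Tid Loc L → Event Tid Loc L → Prop :=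
  Relation.TransGen fun a b => (G.po a b ∧ a.SameLoc b) ∨ G.rf a b ∨ G.mo a b ∨ G.fr a b

/-- RA-happens-before. -/
def hbRA : Event Tid Loc L → Event Tid Loc L → Prop :=
  Relation.TransGen fun a b => G.po a b ∨ G.rf a b

/-- RA-per-location order. -/
def raLoc : Event Tid Loc L → Event Tid Loc L → Prop :=
  Relation.TransGen fun a b => (G.hbRA a b ∧ a.SameLoc b) ∨ G.rf a b ∨ G.mo a b ∨ G.fr a b

/-- Fair execution graphs. -/
def Fair : Prop := PrefixFinite G.mo ∧ PrefixFinite G.fr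

/-- Extended coherence order. -/
def eco : Event Tid Loc L → Event Tid Loc L → Prop :=
  Relation.TransGen fun a b => G.rf a b ∨ G.mo a b ∨ G.fr a b

end EGraph

variable (Tid L) in
/-- The set of fair execution graphs. -/
def GFair : DeclMem Tid L := {G | G.Fair}

variable (Tid L) in
/-- The declarative memory system for SC. -/
def GSC : DeclMem Tid L := {G | Irrefl G.hbSC}

variable (Tid L) in
/-- The declarative memory system for TSO. -/
def GTSO : DeclMem Tid L := {G | Irrefl G.hbTSO ∧ Irrefl G.scLoc}

variable (Tid L) in
/-- The declarative memory system for RA. -/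
def GRA : DeclMem Tid L := {G | Irrefl G.raLoc}

variable (Tid L) in
/-- The declarative memory system for StrongCOH. -/
def GStrongCOH : DeclMem Tid L := {G | Irrefl G.hbRA ∧ Irrefl G.scLoc}

/-- `P` is finitely execution-graph robust against `𝒢`. -/
def FinitelyRobust (P : Program Tid L) (𝒢 : DeclMem Tid L) : Prop :=
  ∀ β ∈ P.Beh, β.IsFinite → ∀ G ∈ 𝒢, eventsOf Loc β = G.E → G ∈ GSC Tid L

/-- Memory-fair behaviors of `P` under a declarative memory system: behaviors of `P` explained by a
fair consistent graph. -/
def Program.DeclFairBehUnder (P : Program Tid L) (𝒢 : DeclMem Tid L) : Set (Behavior Tid L) :=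
  P.Beh ∩ DeclMem.Beh (𝒢 ∩ GFair Tid L)

/-- Thread&memory-fair behaviors of `P` under a declarative memory system. -/
def Program.DeclThreadFairBehUnder (P : Program Tid L) (𝒢 : DeclMem Tid L) :
    Set (Behavior Tid L) :=
  P.BehTF ∩ DeclMem.Beh (𝒢 ∩ GFair Tid L)

end Graphs

/-! ### The declarative model RC11 -/

section RC11

variable {Tid Loc Val : Type*} [Zero Val]

/-- The mode of an event; initialization writes are non-atomic. -/
def Event.mode : Event Tid Loc (CLab Loc Val) → Mode
  | .init _ => .na
  | .ev _ _ l => l.mode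

/-- Fence events. -/
def Event.IsFence : Event Tid Loc (CLab Loc Val) → Prop
  | .ev _ _ (.fence _) => True
  | _ => False

namespace EGraph

variable (G : EGraph Tid (CLab Loc Val))

/-- Release sequences: `[W] ; po|loc? ; [W⊒rlx] ; (rf ; [RMW])*`. -/
def rs (a b : Event Tid Loc (CLab Loc Val)) : Prop :=
  a ∈ G.E ∧ a.IsW ∧ ∃ c, (a = c ∨ (G.po a c ∧ a.SameLoc c)) ∧ c.IsW ∧ c.mode.AtLeastRlx ∧
    Relation.ReflTransGen (fun d e => G.rf d e ∧ e.IsRMW) c b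

/-- Synchronizes-with:
`[E⊒rel] ; ([F] ; po)? ; rs ; rf ; [R⊒rlx] ; (po ; [F])? ; [E⊒acq]`. -/
def sw (a b : Event Tid Loc (CLab Loc Val)) : Prop :=
  a.mode.AtLeastRel ∧ b.mode.AtLeastAcq ∧
  ∃ w w' r, (a = w ∨ (a.IsFence ∧ G.po a w)) ∧ G.rs w w' ∧ G.rf w' r ∧ r.mode.AtLeastRlx ∧
    (r = b ∨ (G.po r b ∧ b.IsFence))

/-- RC11-happens-before. -/
def hbRC11 : Event Tid Loc (CLab Loc Val) → Event Tid Loc (CLab Loc Val) → Prop :=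
  Relation.TransGen fun a b => G.po a b ∨ G.sw a b

/-- `po` between events that do not access a common location. -/
def poNeqLoc (a b : Event Tid Loc (CLab Loc Val)) : Prop := G.po a b ∧ ¬ a.SameLoc b

/-- SC-before: `po ∪ po|≠loc ; hb ; po|≠loc ∪ hb|loc ∪ mo ∪ fr`. -/
def scb (a b : Event Tid Loc (CLab Loc Val)) : Prop :=
  G.po a b ∨ (∃ c d, G.poNeqLoc a c ∧ G.hbRC11 c d ∧ G.poNeqLoc d b) ∨
    (G.hbRC11 a b ∧ a.SameLoc b) ∨ G.mo a b ∨ G.fr a b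

/-- `([E^sc] ∪ [F^sc] ; hb?) ; scb ; ([E^sc] ∪ hb? ; [F^sc])`. -/
def pscBase (a b : Event Tid Loc (CLab Loc Val)) : Prop :=
  a.mode = .sc ∧ b.mode = .sc ∧
  ∃ c d, (a = c ∨ (a.IsFence ∧ G.hbRC11 a c)) ∧ G.scb c d ∧
    (d = b ∨ (G.hbRC11 d b ∧ b.IsFence))

/-- `[F^sc] ; (hb ∪ hb ; eco ; hb) ; [F^sc]`. -/
def pscF (a b : Event Tid Loc (CLab Loc Val)) : Prop :=
  a.mode = .sc ∧ a.IsFence ∧ b.mode = .sc ∧ b.IsFence ∧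
    (G.hbRC11 a b ∨ ∃ c d, G.hbRC11 a c ∧ G.eco c d ∧ G.hbRC11 d b)

end EGraph

variable (Tid Loc Val) in
/-- The declarative memory system RC11: coherence (`hb ; eco?` is irreflexive), atomicity,
acyclicity of `psc`, and acyclicity of `po ∪ rf`. Read-modify-writes are single events here, so that
atomicity (no write is modification-ordered between a read-modify-write and the write it reads from,
and the latter comes earlier) is irreflexivity of `eco`. -/
def GRC11 : DeclMem Tid (CLab Loc Val) :=
  {G | Irrefl G.hbRC11 ∧ (∀ a b, G.hbRC11 a b → ¬ G.eco b a) ∧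
    Irrefl G.eco ∧
    Acyclic (fun a b => G.pscBase a b ∨ G.pscF a b) ∧
    Acyclic (fun a b => G.po a b ∨ G.rf a b)}

end RC11

end WeakMem

/-!
Every memory-fair behavior of `M_SC` is one of each weaker model: writes can be propagated at once.
Conversely, a memory-fair run of a weaker model is described by a fair consistent execution graph,
and if a finitely robust program has such a graph, then the graph is sequentially consistent, even
if it is infinite: a cycle of `hbSC` involves finitely many events, which generate a finite prefix
of the graph because `po ∪ rf` is acyclic, and this prefix is the graph of a finite behavior of the
program. Finally, in a fair sequentially consistent graph every event has only finitely many
predecessors under `hbSC` besides initialization, so the graph can be linearized in order type at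
most `ω`, and the linearization is a run of `M_SC`.
-/

namespace WeakMem

/-! ### Sequences with gaps -/

section ReduceOption

variable {α β : Type*}

/-- The number of defined entries of `g` before position `n`. -/
def countSome (g : ℕ → Option α) (n : ℕ) : ℕ := Nat.count (fun i => (g i).isSome) n

variable {g : ℕ → Option α} {i j n : ℕ} {a b : α}

theorem countSome_mono (g : ℕ → Option α) : Monotone (countSome g) := Nat.count_monotone _

theorem countSome_succ_of_some (h : g n = some a) : countSome g (n + 1) = countSome g n + 1 := by
  simp [countSome, Nat.count_succ, h]

theorem countSome_succ_of_none (h : g n = none) : countSome g (n + 1) = countSome g n := by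
  simp [countSome, Nat.count_succ, h]

theorem countSome_lt_countSome (h : g i = some a) (hij : i < j) :
    countSome g i < countSome g j :=
  Nat.count_strict_mono (by simp [h]) hij

theorem countSome_inj (hi : g i = some a) (hj : g j = some b)
    (h : countSome g i = countSome g j) : i = j :=
  Nat.count_injective (by simp [hi]) (by simp [hj]) h

theorem lt_of_countSome_lt (h : countSome g i < countSome g j) : i < j :=
  (countSome_mono g).reflect_lt h

theorem countSome_map (g : ℕ → Option α) (f : ℕ → α → β) (n : ℕ) :
    countSome (fun n => (g n).map (f n)) n = countSome g n := by
  simp [countSome]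

theorem exists_some_of_lt_of_countSome_lt (h : countSome g i < countSome g j) :
    ∃ n, i ≤ n ∧ n < j ∧ ∃ a, g n = some a := by
  by_contra! hne
  have hg : ∀ m, i ≤ m → m ≤ j → countSome g m = countSome g i := fun m hm => by
    induction m, hm using Nat.le_induction with
    | base => exact fun _ => rfl
    | succ m hm ih =>
      intro hmj
      rw [countSome_succ_of_none (Option.eq_none_iff_forall_ne_some.2 (hne m hm hmj)),
        ih (Nat.le_of_succ_le hmj)]
  exact h.ne' (hg j (lt_of_countSome_lt h).le le_rfl)

theorem restrict_get?_eq_some {f : α → Option β} {s : Stream'.Seq α} {k : ℕ} {b : β} :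
    (restrict f s).get? k = some b ↔
      ∃ i, (s.get? i).bind f = some b ∧ countSome (fun i => (s.get? i).bind f) i = k := by
  classical
  have kept_iff : ∀ i, Kept f s i ↔ ((s.get? i).bind f).isSome := fun i =>
    Option.isSome_iff_exists.symm
  have count_kept : ∀ [DecidablePred (Kept f s)] i,
      Nat.count (Kept f s) i = countSome (fun i => (s.get? i).bind f) i := fun i => by
    simp only [countSome, Nat.count_eq_card_filter_range, kept_iff]
  change restrictFun f s k = some b ↔ _
  simp only [restrictFun, count_kept]
  constructor
  · intro h
    split_ifs at h with hex
    exact ⟨_, h, hex.choose_spec.2⟩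
  · rintro ⟨i, hi, hc⟩
    have hex : ∃ i, Kept f s i ∧ countSome (fun i => (s.get? i).bind f) i = k := ⟨i, ⟨b, hi⟩, hc⟩
    obtain ⟨⟨c, hchoose⟩, hcount⟩ := hex.choose_spec
    rw [dif_pos hex, countSome_inj hchoose hi (hcount.trans hc.symm), hi]

/-- The sequence of all defined entries of `g`, in order. -/
noncomputable def reduceOption (g : ℕ → Option α) : Stream'.Seq α :=
  restrict g ⟨fun n => some n, fun h => by simp at h⟩

theorem reduceOption_get?_eq_some :
    (reduceOption g).get? n = some a ↔ ∃ i, g i = some a ∧ countSome g i = n :=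
  restrict_get?_eq_some

theorem reduceOption_get?_countSome (h : g i = some a) :
    (reduceOption g).get? (countSome g i) = some a :=
  reduceOption_get?_eq_some.2 ⟨i, h, rfl⟩

theorem restrict_eq_reduceOption (f : α → Option β) (s : Stream'.Seq α) :
    restrict f s = reduceOption fun i => (s.get? i).bind f :=
  Stream'.Seq.ext fun _ => Option.ext fun _ =>
    restrict_get?_eq_some.trans reduceOption_get?_eq_some.symm

section Reindex

variable {g' : ℕ → Option α} {φ : ℕ → ℕ} (hφ : StrictMonoOn φ {i | (g i).isSome})
  (h : ∀ n a, g' n = some a ↔ ∃ i, g i = some a ∧ φ i = n)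

include hφ h

theorem countSome_reindex (hi : g i = some a) : countSome g' (φ i) = countSome g i := by
  have isSome_i : (g i).isSome := by simp [hi]
  have filter_eq : {n ∈ Finset.range (φ i) | (g' n).isSome} =
      {j ∈ Finset.range i | (g j).isSome}.image φ := by
    ext n
    simp only [Finset.mem_filter, Finset.mem_range, Finset.mem_image, Option.isSome_iff_exists, h]
    constructor
    · rintro ⟨hn, b, j, hj, rfl⟩
      exact ⟨j, ⟨(hφ.lt_iff_lt (by simp [hj]) isSome_i).1 hn, b, hj⟩, rfl⟩
    · rintro ⟨j, ⟨hji, b, hj⟩, rfl⟩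
      exact ⟨hφ (by simp [hj]) isSome_i hji, b, j, hj, rfl⟩
  simp only [countSome, Nat.count_eq_card_filter_range]
  rw [filter_eq, Finset.card_image_of_injOn]
  exact hφ.injOn.mono fun j hj => (Finset.mem_filter.1 hj).2

theorem reduceOption_reindex : reduceOption g' = reduceOption g := by
  refine Stream'.Seq.ext fun n => Option.ext fun a => ?_
  simp only [reduceOption_get?_eq_some, h]
  constructor
  · rintro ⟨-, ⟨i, hi, rfl⟩, rfl⟩
    exact ⟨i, hi, (countSome_reindex hφ h hi).symm⟩
  · rintro ⟨i, hi, rfl⟩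
    exact ⟨φ i, ⟨i, hi, rfl⟩, countSome_reindex hφ h hi⟩

end Reindex

theorem countSome_get? {s : Stream'.Seq α} (h : s.get? i = some a) : countSome s.get? i = i := by
  induction i generalizing a with
  | zero => rfl
  | succ n ih =>
    obtain ⟨b, hb⟩ := s.ge_stable (Nat.le_succ n) h
    rw [countSome_succ_of_some hb, ih hb]

theorem reduceOption_get? (s : Stream'.Seq α) : reduceOption s.get? = s := by
  refine Stream'.Seq.ext fun n => Option.ext fun a => ?_
  rw [reduceOption_get?_eq_some]
  constructor
  · rintro ⟨i, hi, rfl⟩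
    rwa [countSome_get? hi]
  · exact fun h => ⟨n, h, countSome_get? h⟩

theorem reduceOption_bind (g : ℕ → Option α) (f : α → Option β) :
    (reduceOption fun k => ((reduceOption g).get? k).bind f) =
      reduceOption fun i => (g i).bind f := by
  refine reduceOption_reindex (φ := countSome g) (fun i hi j _ hij => ?_) fun n a => ?_
  · obtain ⟨b, hb⟩ := Option.isSome_iff_exists.1 hi
    obtain ⟨c, hc, -⟩ := Option.bind_eq_some_iff.1 hb
    exact countSome_lt_countSome hc hij
  · simp only [Option.bind_eq_some_iff, reduceOption_get?_eq_some]
    grind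

theorem reduceOption_terminates {N : ℕ} (h : ∀ n ≥ N, g n = none) :
    (reduceOption g).Terminates := by
  refine ⟨countSome g N, Option.eq_none_iff_forall_ne_some.2 fun a ha => ?_⟩
  obtain ⟨i, hi, hc⟩ := reduceOption_get?_eq_some.1 ha
  have hiN : i < N := by
    by_contra! hiN
    simp [h i hiN] at hi
  exact (countSome_lt_countSome hi hiN).ne hc

theorem exists_ge_of_not_reduceOption_terminates (h : ¬ (reduceOption g).Terminates) (N : ℕ) :
    ∃ n ≥ N, ∃ a, g n = some a := by
  by_contra! hne
  exact h (reduceOption_terminates fun n hn => Option.eq_none_iff_forall_ne_some.2 (hne n hn))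

end ReduceOption

/-! ### Runs with idle steps -/

section Stutter

universe u v w x

variable {S : Type u} {T : Type v}

/-- A run that may idle: `q n` is the state at time `n`, and `l n` is the label of the step taken at
time `n`, or `none` if the run idles. -/
structure StutterRun (A : LTS.{u, v, w} S T) (q : ℕ → A.Q) (l : ℕ → Option (S ⊕ T)) : Prop where
  init : q 0 = A.init
  step : ∀ n σ, l n = some σ → A.step (q n) σ (q (n + 1))
  idle : ∀ n, l n = none → q (n + 1) = q n

/-- Memory fairness of a stuttering run. Unlike for runs, finiteness is no excuse: the run must
idle forever only if no silent label stays enabled. -/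
def StutterFair (A : LTS.{u, v, w} S T) (q : ℕ → A.Q) (l : ℕ → Option (S ⊕ T)) : Prop :=
  ∀ (θ : T) (k : ℕ), (∀ j ≥ k, A.Enabled (Sum.inr θ) (q j)) → ∃ j ≥ k, l j = some (Sum.inr θ)

variable {A : LTS.{u, v, w} S T} {q : ℕ → A.Q} {l : ℕ → Option (S ⊕ T)}

theorem StutterRun.state_eq (h : StutterRun A q l) {i j : ℕ} (hij : i ≤ j)
    (hl : countSome l j ≤ countSome l i) : q j = q i := by
  induction j, hij using Nat.le_induction with
  | base => rfl
  | succ j hij ih =>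
    have none_j : l j = none := by
      by_contra! hne
      obtain ⟨σ, hσ⟩ := Option.ne_none_iff_exists'.1 hne
      rw [countSome_succ_of_some hσ] at hl
      have := countSome_mono l hij
      omega
    rw [h.idle j none_j, ih (by rwa [countSome_succ_of_none none_j] at hl)]

/-- The sequence of transitions obtained from a stuttering run by dropping the idle steps. -/
noncomputable def reduceRun (q : ℕ → A.Q) (l : ℕ → Option (S ⊕ T)) : Stream'.Seq A.Trans :=
  reduceOption fun n => (l n).map fun σ => (q n, σ, q (n + 1))

theorem reduceRun_get?_eq_some {k : ℕ} {t : A.Trans} :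
    (reduceRun q l).get? k = some t ↔
      ∃ n σ, l n = some σ ∧ countSome l n = k ∧ t = (q n, σ, q (n + 1)) := by
  simp only [reduceRun, reduceOption_get?_eq_some, Option.map_eq_some_iff,
    countSome_map l fun n σ => (q n, σ, q (n + 1))]
  grind

theorem StutterRun.isRun (h : StutterRun A q l) : A.IsRun (reduceRun q l) where
  trans k t ht := by
    obtain ⟨n, σ, hσ, -, rfl⟩ := reduceRun_get?_eq_some.1 ht
    exact h.step n σ hσ
  start t ht := by
    obtain ⟨n, σ, -, hc, rfl⟩ := reduceRun_get?_eq_some.1 ht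
    exact (h.state_eq (Nat.zero_le n) (by simp [hc])).trans h.init
  consec k t t' ht ht' := by
    obtain ⟨n, σ, hσ, hc, rfl⟩ := reduceRun_get?_eq_some.1 ht
    obtain ⟨n', σ', -, hc', rfl⟩ := reduceRun_get?_eq_some.1 ht'
    have hlt : n < n' := lt_of_countSome_lt (g := l) (by omega)
    exact (h.state_eq hlt (by rw [hc', countSome_succ_of_some hσ, hc])).symm

theorem StutterRun.memFairRun (h : StutterRun A q l) (hf : StutterFair A q l) :
    A.MemFairRun (reduceRun q l) := by
  classical
  refine ⟨h.isRun, or_iff_not_imp_left.2 fun infinite θ k enabled => ?_⟩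
  obtain ⟨t, ht⟩ : ∃ t, (reduceRun q l).get? k = some t :=
    Option.ne_none_iff_exists'.1 fun hn => infinite ⟨k, hn⟩
  obtain ⟨n, -, -, hc, -⟩ := reduceRun_get?_eq_some.1 ht
  have next_step : ∀ N, ∃ m ≥ N, (l m).isSome := fun N => by
    obtain ⟨m, hm, a, ha⟩ := exists_ge_of_not_reduceOption_terminates infinite N
    obtain ⟨σ, hσ, -⟩ := Option.map_eq_some_iff.1 ha
    exact ⟨m, hm, by simp [hσ]⟩
  obtain ⟨j, hj, hlj⟩ := hf θ n fun j hj => by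
    set m := Nat.find (next_step j)
    obtain ⟨hm, isSome_m⟩ := Nat.find_spec (next_step j)
    obtain ⟨σ', hσ'⟩ := Option.isSome_iff_exists.1 isSome_m
    have state_m : q m = q j := h.state_eq hm <| by
      by_contra! hlt
      obtain ⟨i, hji, him, a, ha⟩ := exists_some_of_lt_of_countSome_lt hlt
      exact Nat.find_min (next_step j) him ⟨hji, by simp [ha]⟩
    rw [← state_m]
    exact enabled (countSome l m) (hc ▸ countSome_mono l (hj.trans hm)) _
      (reduceRun_get?_eq_some.2 ⟨m, σ', hσ', rfl, rfl⟩)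
  exact ⟨countSome l j, hc ▸ countSome_mono l hj, _,
    reduceRun_get?_eq_some.2 ⟨j, _, hlj, rfl, rfl⟩, rfl⟩

/-- The state before the `n`-th step of a run, or the last state if there are fewer steps. -/
def stateAt (A : LTS.{u, v, w} S T) (μ : Stream'.Seq A.Trans) : ℕ → A.Q
  | 0 => A.init
  | n + 1 => match μ.get? n with
    | some t => t.2.2
    | none => stateAt A μ n

variable {μ : Stream'.Seq A.Trans}

theorem stateAt_succ_of_some {n : ℕ} {t : A.Trans} (h : μ.get? n = some t) :
    stateAt A μ (n + 1) = t.2.2 := by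
  simp [stateAt, h]

theorem stateAt_succ_of_none {n : ℕ} (h : μ.get? n = none) :
    stateAt A μ (n + 1) = stateAt A μ n := by
  simp [stateAt, h]

theorem LTS.traceOf_get? (μ : Stream'.Seq A.Trans) (n : ℕ) :
    (A.traceOf μ).get? n = (μ.get? n).map fun t => t.2.1 :=
  Stream'.Seq.map_get? _ _ _

theorem LTS.IsRun.fst_eq_stateAt (h : A.IsRun μ) {n : ℕ} {t : A.Trans} (ht : μ.get? n = some t) :
    t.1 = stateAt A μ n := by
  cases n with
  | zero => exact h.start t ht
  | succ n =>
    obtain ⟨t', ht'⟩ := μ.ge_stable (Nat.le_succ n) ht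
    rw [stateAt_succ_of_some ht', ← h.consec n t' t ht' ht]

theorem LTS.IsRun.stutterRun (h : A.IsRun μ) :
    StutterRun A (stateAt A μ) (A.traceOf μ).get? where
  init := rfl
  step n σ hσ := by
    rw [LTS.traceOf_get?] at hσ
    obtain ⟨t, ht, rfl⟩ := Option.map_eq_some_iff.1 hσ
    rw [← h.fst_eq_stateAt ht, stateAt_succ_of_some ht]
    exact h.trans n t ht
  idle n hn := by
    rw [LTS.traceOf_get?] at hn
    exact stateAt_succ_of_none (Option.map_eq_none_iff.1 hn)

theorem LTS.MemFairRun.eventually_none_or_stutterFair (h : A.MemFairRun μ) :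
    (∃ N, ∀ n ≥ N, (A.traceOf μ).get? n = none) ∨
      StutterFair A (stateAt A μ) (A.traceOf μ).get? := by
  rcases h.2 with ⟨N, hN⟩ | fair
  · refine Or.inl ⟨N, fun n hn => ?_⟩
    rw [LTS.traceOf_get?, μ.le_stable hn hN, Option.map_none]
  · refine Or.inr fun θ k enabled => ?_
    obtain ⟨j, hj, t, ht, htθ⟩ := fair θ k fun j hj t ht => by
      rw [h.1.fst_eq_stateAt ht]
      exact enabled j hj
    exact ⟨j, hj, by rw [LTS.traceOf_get?, ht, Option.map_some, htθ]⟩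

section Extend

variable (q : ℕ → A.Q) (l : ℕ → Option (S ⊕ T)) (N : ℕ) (sched : ℕ → Option T)

open Classical in
/-- The states of the run that follows `q` up to time `N` and then takes the silent step `sched n`
at each time `n` at which it is enabled. -/
noncomputable def extendState : ℕ → A.Q
  | 0 => q 0
  | n + 1 => if n < N then q (n + 1) else
    if h : ∃ θ q', sched n = some θ ∧ A.step (extendState n) (Sum.inr θ) q' then
      h.choose_spec.choose else extendState n

open Classical in
/-- The labels of the run with states `extendState`. -/
noncomputable def extendLabel (n : ℕ) : Option (S ⊕ T) :=
  if n < N then l n else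
    if ∃ θ q', sched n = some θ ∧ A.step (extendState q N sched n) (Sum.inr θ) q' then
      (sched n).map Sum.inr else none

variable {q l N sched}

theorem extendState_of_le {n : ℕ} (h : n ≤ N) : extendState q N sched n = q n := by
  cases n with
  | zero => rfl
  | succ n => rw [extendState, if_pos (Nat.lt_of_succ_le h)]

theorem StutterRun.extend (h : StutterRun A q l) :
    StutterRun A (extendState q N sched) (extendLabel q l N sched) where
  init := h.init
  step n σ hσ := by
    unfold extendLabel at hσ
    by_cases hn : n < N
    · rw [extendState_of_le hn.le, extendState_of_le hn]
      exact h.step n σ (by rwa [if_pos hn] at hσ)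
    · rw [if_neg hn] at hσ
      split_ifs at hσ with enabled
      obtain ⟨hθ, step⟩ := enabled.choose_spec.choose_spec
      rw [hθ, Option.map_some, Option.some.injEq] at hσ
      rw [extendState, if_neg hn, dif_pos enabled, ← hσ]
      exact step
  idle n none_n := by
    unfold extendLabel at none_n
    by_cases hn : n < N
    · rw [extendState_of_le hn.le, extendState_of_le hn]
      exact h.idle n (by rwa [if_pos hn] at none_n)
    · rw [if_neg hn] at none_n
      split_ifs at none_n with enabled
      · obtain ⟨θ, _, hθ, _⟩ := enabled
        simp [hθ] at none_n
      · rw [extendState, if_neg hn, dif_neg enabled]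

theorem stutterFair_extend (hs : ∀ θ k, ∃ j ≥ k, sched j = some θ) :
    StutterFair A (extendState q N sched) (extendLabel q l N sched) := by
  intro θ k enabled
  obtain ⟨j, hj, hjθ⟩ := hs θ (max k N)
  have hkj : k ≤ j := (le_max_left _ _).trans hj
  have hNj : ¬ j < N := ((le_max_right _ _).trans hj).not_gt
  obtain ⟨q', hq'⟩ := enabled j hkj
  refine ⟨j, hkj, ?_⟩
  rw [extendLabel, if_neg hNj, if_pos ⟨θ, q', hjθ, hq'⟩, hjθ, Option.map_some]

theorem extendLabel_bind_getLeft? (hl : ∀ n ≥ N, l n = none) (n : ℕ) :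
    (extendLabel q l N sched n).bind Sum.getLeft? = (l n).bind Sum.getLeft? := by
  unfold extendLabel
  split_ifs with hn
  · rfl
  · rw [hl n (not_lt.1 hn)]
    cases sched n <;> rfl
  · rw [hl n (not_lt.1 hn)]

end Extend

theorem exists_recurrent_schedule (T : Type*) [Countable T] :
    ∃ sched : ℕ → Option T, ∀ θ k, ∃ j ≥ k, sched j = some θ := by
  obtain ⟨f, hf⟩ := exists_injective_nat T
  refine ⟨fun n => Function.partialInv f n.unpair.1, fun θ k =>
    ⟨Nat.pair (f θ) k, Nat.right_le_pair _ _, ?_⟩⟩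
  simp only [Nat.unpair_pair]
  exact Function.partialInv_left hf θ

section Behaviors

variable {Tid : Type u} {L : Type v} {T : Type x}

/-- The observable labels of a stuttering run, at the times of their steps. -/
def obsHist {S : Type*} (l : ℕ → Option (S ⊕ T)) (n : ℕ) : Option S := (l n).bind Sum.getLeft?

theorem obsHist_eq_some {S : Type*} {l : ℕ → Option (S ⊕ T)} {n : ℕ} {σ : S} :
    obsHist l n = some σ ↔ l n = some (Sum.inl σ) := by
  unfold obsHist
  rcases l n with _ | (σ' | θ) <;> simp

open Classical in
/-- The labels of the thread `τ` in a history, that is, in a sequence of observable labels with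
gaps. -/
noncomputable def threadHist (h : ℕ → Option (Tid × L)) (τ : Tid) (n : ℕ) : Option L :=
  (h n).bind fun σ => if σ.1 = τ then some σ.2 else none

theorem threadHist_eq_some {h : ℕ → Option (Tid × L)} {τ : Tid} {n : ℕ} {a : L} :
    threadHist h τ n = some a ↔ h n = some (τ, a) := by
  simp [threadHist, Option.bind_eq_some_iff]

/-- The behavior of a history. -/
noncomputable def histBeh (h : ℕ → Option (Tid × L)) : Behavior Tid L :=
  fun τ => reduceOption (threadHist h τ)

theorem behOf_obsTraceOf (A : LTS.{max u v, x, w} (Tid × L) T) (μ : Stream'.Seq A.Trans) :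
    behOf (A.obsTraceOf μ) = histBeh (obsHist (A.traceOf μ).get?) := by
  funext τ
  unfold behOf LTS.obsTraceOf histBeh
  rw [restrict_eq_reduceOption, restrict_eq_reduceOption, reduceOption_bind]
  rfl

variable {A : LTS.{max u v, x, w} (Tid × L) T} {q : ℕ → A.Q} {l : ℕ → Option ((Tid × L) ⊕ T)}
  {β : Behavior Tid L}

theorem behOf_obsTraceOf_reduceRun :
    behOf (A.obsTraceOf (reduceRun q l)) = histBeh (obsHist l) := by
  have trace : ∀ k, (A.traceOf (reduceRun q l)).get? k =
      ((reduceRun q l).get? k).bind fun t => some t.2.1 := fun k => by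
    rw [LTS.traceOf_get?, Option.map_eq_bind]
    rfl
  rw [behOf_obsTraceOf]
  funext τ
  unfold histBeh threadHist obsHist
  simp only [trace, Option.bind_assoc]
  unfold reduceRun
  rw [reduceOption_bind]
  congr 1
  funext n
  rcases l n with _ | σ <;> rfl

theorem LTS.mem_Beh_iff : β ∈ A.Beh ↔ ∃ q l, StutterRun A q l ∧ β = histBeh (obsHist l) := by
  constructor
  · rintro ⟨-, ⟨μ, hμ, rfl⟩, rfl⟩
    exact ⟨_, _, hμ.stutterRun, behOf_obsTraceOf A μ⟩
  · rintro ⟨q, l, h, rfl⟩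
    exact ⟨_, ⟨_, h.isRun, rfl⟩, behOf_obsTraceOf_reduceRun⟩

theorem StutterRun.mem_BehMF (h : StutterRun A q l) (hf : StutterFair A q l) :
    histBeh (obsHist l) ∈ A.BehMF :=
  ⟨_, ⟨_, h.memFairRun hf, rfl⟩, behOf_obsTraceOf_reduceRun⟩

theorem StutterRun.mem_BehMF_of_isEmpty [IsEmpty T] (h : StutterRun A q l) :
    histBeh (obsHist l) ∈ A.BehMF :=
  h.mem_BehMF fun θ => isEmptyElim θ

theorem LTS.exists_stutterRun_of_mem_BehMF (h : β ∈ A.BehMF) :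
    ∃ q l, StutterRun A q l ∧ β = histBeh (obsHist l) ∧
      ((∃ N, ∀ n ≥ N, l n = none) ∨ StutterFair A q l) := by
  obtain ⟨-, ⟨μ, hμ, rfl⟩, rfl⟩ := h
  exact ⟨_, _, hμ.1.stutterRun, behOf_obsTraceOf A μ, hμ.eventually_none_or_stutterFair⟩

theorem LTS.exists_stutterFair_of_mem_BehMF [Countable T] (h : β ∈ A.BehMF) :
    ∃ q l, StutterRun A q l ∧ StutterFair A q l ∧ β = histBeh (obsHist l) := by
  obtain ⟨q, l, run, rfl, ⟨N, hN⟩ | fair⟩ := LTS.exists_stutterRun_of_mem_BehMF h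
  · obtain ⟨sched, hs⟩ := exists_recurrent_schedule T
    refine ⟨_, _, run.extend (N := N) (sched := sched), stutterFair_extend hs, ?_⟩
    exact congrArg histBeh (funext fun n => (extendLabel_bind_getLeft? hN n).symm)
  · exact ⟨q, l, run, fair, rfl⟩

end Behaviors

end Stutter

/-! ### Events of histories -/

section Histories

variable {Tid Loc Val L : Type*}

theorem Event.not_sb_init (a : Event Tid Loc L) (x : Loc) : ¬ a.Sb (.init x) := by
  cases a <;> exact id

theorem init_mem_eventsOf (β : Behavior Tid L) (x : Loc) : Event.init x ∈ eventsOf Loc β :=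
  Or.inl ⟨x, rfl⟩

theorem ev_mem_eventsOf {β : Behavior Tid L} {k : ℕ} {τ : Tid} {a : L} :
    Event.ev k τ a ∈ eventsOf Loc β ↔ (β τ).get? k = some a := by
  simp [eventsOf]

theorem wellFormed_eventsOf (β : Behavior Tid L) : WellFormed (eventsOf Loc β) where
  init_mem := init_mem_eventsOf β
  unique k τ a a' h h' := by
    rw [ev_mem_eventsOf] at h h'
    exact Option.some.inj (h.symm.trans h')
  closed k τ a h j hj := by
    obtain ⟨b, hb⟩ := (β τ).ge_stable hj.le (ev_mem_eventsOf.1 h)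
    exact ⟨b, ev_mem_eventsOf.2 hb⟩

/-- The event `e` is issued at time `n` of the history `h`. -/
def OccursAt (h : ℕ → Option (Tid × L)) (n : ℕ) (e : Event Tid Loc L) : Prop :=
  ∃ τ a, h n = some (τ, a) ∧ e = .ev (countSome (threadHist h τ) n) τ a

variable {h : ℕ → Option (Tid × L)} {n m : ℕ} {e e' : Event Tid Loc L}

theorem OccursAt.time_unique (hn : OccursAt h n e) (hm : OccursAt h m e) : n = m := by
  obtain ⟨τ, a, hn, rfl⟩ := hn
  obtain ⟨τ', a', hm, he⟩ := hm
  injection he with hc hτ ha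
  subst hτ ha
  exact countSome_inj (threadHist_eq_some.2 hn) (threadHist_eq_some.2 hm) hc

theorem OccursAt.event_unique (he : OccursAt h n e) (he' : OccursAt h n e') : e = e' := by
  obtain ⟨τ, a, hn, rfl⟩ := he
  obtain ⟨τ', a', hn', rfl⟩ := he'
  cases hn.symm.trans hn'
  rfl

theorem mem_eventsOf_histBeh :
    e ∈ eventsOf Loc (histBeh h) ↔ (∃ x, e = .init x) ∨ ∃ n, OccursAt h n e := by
  refine or_congr_right ⟨?_, ?_⟩
  · rintro ⟨k, τ, a, hk, rfl⟩
    obtain ⟨n, hn, rfl⟩ := reduceOption_get?_eq_some.1 hk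
    exact ⟨n, τ, a, threadHist_eq_some.1 hn, rfl⟩
  · rintro ⟨n, τ, a, hn, rfl⟩
    exact ⟨_, τ, a, reduceOption_get?_countSome (threadHist_eq_some.2 hn), rfl⟩

theorem OccursAt.mem (he : OccursAt h n e) : e ∈ eventsOf Loc (histBeh h) :=
  mem_eventsOf_histBeh.2 (Or.inr ⟨n, he⟩)

open Classical in
/-- The position of an event in a history: `0` for initialization events, and `n + 1` for the event
issued at time `n`. -/
noncomputable def time (h : ℕ → Option (Tid × L)) (e : Event Tid Loc L) : ℕ :=
  if hn : ∃ n, OccursAt h n e then hn.choose + 1 else 0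

theorem OccursAt.time_eq (he : OccursAt h n e) : time h e = n + 1 := by
  have hex : ∃ n, OccursAt h n e := ⟨n, he⟩
  rw [time, dif_pos hex, hex.choose_spec.time_unique he]

@[simp]
theorem time_init (x : Loc) : time h (Event.init x : Event Tid Loc L) = 0 := by
  rw [time, dif_neg]
  rintro ⟨n, τ, a, -, he⟩
  cases he

theorem finite_of_occursAt_le {s : Set (Event Tid Loc L)} (N : ℕ)
    (hs : ∀ e ∈ s, ∃ n ≤ N, OccursAt h n e) : s.Finite := by
  refine Set.Finite.of_injOn (f := time h) (t := Set.Iic (N + 1)) ?_ ?_ (Set.finite_Iic _)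
  · intro e he
    obtain ⟨n, hn, hne⟩ := hs e he
    rw [hne.time_eq]
    exact Nat.succ_le_succ hn
  · intro e he e' he' heq
    obtain ⟨n, -, hne⟩ := hs e he
    obtain ⟨n', -, hne'⟩ := hs e' he'
    rw [hne.time_eq, hne'.time_eq] at heq
    cases heq
    exact hne.event_unique hne'

theorem sb_iff_of_occursAt {τ τ' : Tid} {a b : L} (hn : h n = some (τ, a))
    (hm : h m = some (τ', b)) :
    Event.Sb (.ev (countSome (threadHist h τ) n) τ a : Event Tid Loc L)
        (.ev (countSome (threadHist h τ') m) τ' b) ↔ τ = τ' ∧ n < m := by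
  refine and_congr_right ?_
  rintro rfl
  exact ⟨lt_of_countSome_lt, countSome_lt_countSome (threadHist_eq_some.2 hn)⟩

theorem sb_cases (he : e ∈ eventsOf Loc (histBeh h)) (he' : e' ∈ eventsOf Loc (histBeh h))
    (hsb : e.Sb e') :
    ((∃ x, e = .init x) ∧ ∃ n, OccursAt h n e') ∨
      ∃ n m τ a b, n < m ∧ h n = some (τ, a) ∧ h m = some (τ, b) ∧
        e = .ev (countSome (threadHist h τ) n) τ a ∧
        e' = .ev (countSome (threadHist h τ) m) τ b := by
  rcases mem_eventsOf_histBeh.1 he' with ⟨x, rfl⟩ | ⟨m, hm⟩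
  · cases e <;> exact hsb.elim
  · rcases mem_eventsOf_histBeh.1 he with ⟨x, rfl⟩ | ⟨n, τ, a, hn, rfl⟩
    · exact Or.inl ⟨⟨x, rfl⟩, m, hm⟩
    · obtain ⟨τ', b, hm, rfl⟩ := hm
      obtain ⟨rfl, hlt⟩ := (sb_iff_of_occursAt hn hm).1 hsb
      exact Or.inr ⟨n, m, τ, a, b, hlt, hn, hm, rfl, rfl⟩

theorem time_lt_of_sb (he : e ∈ eventsOf Loc (histBeh h)) (he' : e' ∈ eventsOf Loc (histBeh h))
    (hsb : e.Sb e') : time h e < time h e' := by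
  rcases sb_cases he he' hsb with ⟨⟨x, rfl⟩, n, hn⟩ | ⟨n, m, τ, a, b, hlt, hn, hm, rfl, rfl⟩
  · rw [time_init, hn.time_eq]
    exact Nat.succ_pos n
  · rw [OccursAt.time_eq ⟨τ, a, hn, rfl⟩, OccursAt.time_eq ⟨τ, b, hm, rfl⟩]
    exact Nat.succ_lt_succ hlt

end Histories

/-! ### Graphs from read sources and timestamps -/

section SourceGraphs

variable {Tid Loc Val L : Type*} [MemLabel L Loc Val] [Zero Val]

theorem Event.isW_init (x : Loc) : (Event.init x : Event Tid Loc L).IsW := rfl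

theorem Event.not_isR_init (x : Loc) : ¬ (Event.init x : Event Tid Loc L).IsR :=
  Bool.false_ne_true

theorem Event.exists_loc_of_isR {e : Event Tid Loc L} (h : e.IsR) : ∃ x, e.loc = some x := by
  obtain ⟨v, hv⟩ := Option.isSome_iff_exists.1 h
  obtain ⟨a, ha, -⟩ := Option.bind_eq_some_iff.1 hv
  exact ⟨a.loc, by rw [Event.loc, ha, Option.map_some]⟩

theorem Event.SameLoc.symm {a b : Event Tid Loc L} (h : a.SameLoc b) : b.SameLoc a :=
  h.imp fun _ => And.symm

theorem Event.SameLoc.trans {a b c : Event Tid Loc L} (h : a.SameLoc b) (h' : b.SameLoc c) :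
    a.SameLoc c := by
  obtain ⟨x, hx, hx'⟩ := h
  obtain ⟨y, hy, hy'⟩ := h'
  exact ⟨x, hx, hy'.trans (hy.symm.trans hx')⟩

/-- `src` gives every read a write to read from, and `ts` separates the writes to a location. -/
structure SourceData (E : Set (Event Tid Loc L)) (src : Event Tid Loc L → Event Tid Loc L)
    (ts : Event Tid Loc L → ℕ) : Prop where
  wf : WellFormed E
  src_mem : ∀ r ∈ E, r.IsR → src r ∈ E
  src_isW : ∀ r ∈ E, r.IsR → (src r).IsW
  src_loc : ∀ r ∈ E, r.IsR → (src r).loc = r.loc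
  src_val : ∀ r ∈ E, r.IsR → (src r).valW = r.valR
  ts_inj : ∀ a ∈ E, ∀ b ∈ E, a.IsW → b.IsW → a.SameLoc b → ts a = ts b → a = b

variable {E : Set (Event Tid Loc L)} {src : Event Tid Loc L → Event Tid Loc L}
  {ts : Event Tid Loc L → ℕ}

/-- The execution graph in which `r` reads from `src r` and writes are ordered by `ts`. -/
def SourceData.graph (d : SourceData E src ts) : EGraph Tid L where
  E := E
  rf w r := r ∈ E ∧ r.IsR ∧ w = src r
  mo a b := a ∈ E ∧ b ∈ E ∧ a.IsW ∧ b.IsW ∧ a.SameLoc b ∧ ts a < ts b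
  wf := d.wf
  rf_mem := by
    rintro w r ⟨hr, hR, rfl⟩
    exact ⟨d.src_mem r hr hR, hr⟩
  rf_type := by
    rintro w r ⟨hr, hR, rfl⟩
    exact ⟨d.src_isW r hr hR, hR⟩
  rf_loc := by
    rintro w r ⟨hr, hR, rfl⟩
    exact d.src_loc r hr hR
  rf_val := by
    rintro w r ⟨hr, hR, rfl⟩
    exact d.src_val r hr hR
  rf_fun := by
    rintro w w' r ⟨_, _, rfl⟩ ⟨_, _, rfl⟩
    rfl
  rf_total r hr hR := ⟨_, hr, hR, rfl⟩
  mo_mem a b h := ⟨h.1, h.2.1⟩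
  mo_type a b h := ⟨h.2.2.1, h.2.2.2.1, h.2.2.2.2.1⟩
  mo_irrefl a h := lt_irrefl _ h.2.2.2.2.2
  mo_trans := by
    rintro a b c ⟨ha, _, haW, _, hl, hab⟩ ⟨_, hc, _, hcW, hl', hbc⟩
    exact ⟨ha, hc, haW, hcW, hl.trans hl', hab.trans hbc⟩
  mo_total a ha b hb haW hbW hl hne := by
    rcases lt_trichotomy (ts a) (ts b) with h | h | h
    · exact Or.inl ⟨ha, hb, haW, hbW, hl, h⟩
    · exact absurd (d.ts_inj a ha b hb haW hbW hl h) hne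
    · exact Or.inr ⟨hb, ha, hbW, haW, hl.symm, h⟩

theorem SourceData.mo_prefixFinite (d : SourceData E src ts) : PrefixFinite d.graph.mo := by
  refine fun b => Set.Finite.of_injOn (f := ts) (t := Set.Iio (ts b)) ?_ ?_ (Set.finite_Iio _)
  · rintro a ⟨-, -, -, -, -, hlt⟩
    exact hlt
  · rintro a ⟨ha, -, haW, -, hl, -⟩ a' ⟨ha', -, haW', -, hl', -⟩ he
    exact d.ts_inj a ha a' ha' haW haW' (hl.trans hl'.symm) he

theorem EGraph.sameLoc_of_rf {G : EGraph Tid L} {w r : Event Tid Loc L} (h : G.rf w r) :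
    w.SameLoc r := by
  obtain ⟨x, hx⟩ := Event.exists_loc_of_isR (G.rf_type _ _ h).2
  exact ⟨x, (G.rf_loc _ _ h).trans hx, hx⟩

theorem EGraph.sameLoc_of_fr {G : EGraph Tid L} {a b : Event Tid Loc L} (h : G.fr a b) :
    a.SameLoc b := by
  obtain ⟨⟨w, hw, hm⟩, -⟩ := h
  exact (G.sameLoc_of_rf hw).symm.trans (G.mo_type _ _ hm).2.2

end SourceGraphs

/-! ### Acyclicity by measures -/

section Measure

variable {α ι : Type*} {R : α → α → Prop}

theorem acyclic_of_measure [Preorder ι] (f : α → ι) (h : ∀ a b, R a b → f a < f b) : Acyclic R :=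
  fun a ha => lt_irrefl (f a) (Relation.TransGen.trans_induction_on
    (motive := fun {a b} _ => f a < f b) ha (h _ _) fun _ _ => lt_trans)

theorem acyclic_of_lex (f g : α → ℕ)
    (h : ∀ a b, R a b → f a < f b ∨ (f a ≤ f b ∧ g a < g b)) : Acyclic R :=
  acyclic_of_measure (fun a => toLex (f a, g a)) fun a b hab => by
    rcases h a b hab with hlt | ⟨hle, hlt⟩
    · exact Prod.Lex.toLex_lt_toLex.2 (Or.inl hlt)
    · rcases hle.lt_or_eq with hlt' | heq
      · exact Prod.Lex.toLex_lt_toLex.2 (Or.inl hlt')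
      · exact Prod.Lex.toLex_lt_toLex.2 (Or.inr ⟨heq, hlt⟩)

end Measure

/-! ### Finite prefixes of program behaviors -/

section Truncate

variable {α : Type*} {g : ℕ → Option α} {N : ℕ}

/-- The history `g` with only its first `N` defined entries. -/
def truncate (g : ℕ → Option α) (N n : ℕ) : Option α := if countSome g n < N then g n else none

theorem truncate_eq_some {n : ℕ} {a : α} :
    truncate g N n = some a ↔ countSome g n < N ∧ g n = some a := by
  simp [truncate]

theorem countSome_truncate (g : ℕ → Option α) (N n : ℕ) :
    countSome (truncate g N) n = min (countSome g n) N := by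
  induction n with
  | zero => simp [countSome]
  | succ n ih =>
    rcases hn : g n with _ | a
    · have trunc_n : truncate g N n = none := by simp [truncate, hn]
      rw [countSome_succ_of_none hn, countSome_succ_of_none trunc_n, ih]
    · rw [countSome_succ_of_some hn]
      by_cases hlt : countSome g n < N
      · rw [countSome_succ_of_some (truncate_eq_some.2 ⟨hlt, hn⟩), ih]
        omega
      · have trunc_n : truncate g N n = none := if_neg hlt
        rw [countSome_succ_of_none trunc_n, ih]
        omega

theorem reduceOption_truncate_get?_eq_some {k : ℕ} {a : α} :
    (reduceOption (truncate g N)).get? k = some a ↔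
      k < N ∧ (reduceOption g).get? k = some a := by
  simp only [reduceOption_get?_eq_some, truncate_eq_some, countSome_truncate]
  grind

variable {S T : Type*} {A : LTS S T}

/-- The states of the run that follows `q` for its first `N` steps and then idles. -/
def truncateState (q : ℕ → A.Q) (l : ℕ → Option (S ⊕ T)) (N : ℕ) : ℕ → A.Q
  | 0 => q 0
  | n + 1 => if countSome l (n + 1) ≤ N then q (n + 1) else truncateState q l N n

variable {q : ℕ → A.Q} {l : ℕ → Option (S ⊕ T)}

theorem truncateState_of_le {n : ℕ} (h : countSome l n ≤ N) : truncateState q l N n = q n := by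
  cases n with
  | zero => rfl
  | succ n => rw [truncateState, if_pos h]

theorem StutterRun.truncate (h : StutterRun A q l) (N : ℕ) :
    StutterRun A (truncateState q l N) (truncate l N) where
  init := h.init
  step n σ hσ := by
    obtain ⟨hlt, hn⟩ := truncate_eq_some.1 hσ
    rw [truncateState_of_le hlt.le, truncateState_of_le (by rwa [countSome_succ_of_some hn])]
    exact h.step n σ hn
  idle n none_n := by
    by_cases hle : countSome l (n + 1) ≤ N
    · have hn : l n = none := by
        by_contra! hne
        obtain ⟨σ, hσ⟩ := Option.ne_none_iff_exists'.1 hne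
        rw [countSome_succ_of_some hσ] at hle
        rw [truncate_eq_some.2 ⟨hle, hσ⟩] at none_n
        cases none_n
      rw [truncateState_of_le hle, h.idle n hn,
        truncateState_of_le (by rwa [countSome_succ_of_none hn] at hle)]
    · rw [truncateState, if_neg hle]

end Truncate

section ProgramPrefix

universe u v w

variable {Tid : Type u} {L : Type v}

theorem obsHist_map_inl {S T : Type*} (h : ℕ → Option S) :
    obsHist (fun n => (h n).map (Sum.inl : S → S ⊕ T)) = h := by
  funext n
  rcases hn : h n with _ | σ <;> simp [obsHist, hn]

theorem eq_map_inl_obsHist {S T : Type*} [IsEmpty T] (l : ℕ → Option (S ⊕ T)) :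
    l = fun n => (obsHist l n).map Sum.inl := by
  funext n
  rcases hn : l n with _ | (σ | e)
  · simp [obsHist, hn]
  · simp [obsHist, hn]
  · exact isEmptyElim e

theorem exists_threadHist_eq_truncate (h : ℕ → Option (Tid × L)) (N : Tid → ℕ) :
    ∃ h', ∀ τ, threadHist h' τ = truncate (threadHist h τ) (N τ) := by
  refine ⟨fun n => (h n).bind fun σ => (truncate (threadHist h σ.1) (N σ.1) n).map (σ.1, ·),
    fun τ => funext fun n => Option.ext fun a => ?_⟩
  simp only [threadHist_eq_some, truncate_eq_some, Option.bind_eq_some_iff, Option.map_eq_some_iff,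
    Prod.mk.injEq]
  constructor
  · rintro ⟨⟨τ', b⟩, -, a', ⟨hlt, ha⟩, rfl, rfl⟩
    exact ⟨hlt, ha⟩
  · rintro ⟨hlt, ha⟩
    exact ⟨_, ha, a, ⟨hlt, ha⟩, rfl, rfl⟩

theorem Program.stutterRun_iff {P : Program.{u, v, w} Tid L} {q : ℕ → ∀ τ, (P τ).Q}
    {h : ℕ → Option (Tid × L)} :
    StutterRun P.lts q (fun n => (h n).map Sum.inl) ↔
      ∀ τ, StutterRun (P τ) (fun n => q n τ) fun n => (threadHist h τ n).map Sum.inl := by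
  classical
  constructor
  · refine fun run τ => ⟨congrFun run.init τ, ?_, ?_⟩
    · intro n σ hσ
      obtain ⟨a, ha, rfl⟩ := Option.map_eq_some_iff.1 hσ
      obtain ⟨s, hs, update⟩ := run.step n (Sum.inl (τ, a)) (by rw [threadHist_eq_some.1 ha]; rfl)
      simpa only [update, Function.update_self] using hs
    · intro n none_n
      rcases hn : h n with _ | ⟨τ', a⟩
      · exact congrFun (run.idle n (by rw [hn]; rfl)) τ
      · obtain ⟨s, -, update⟩ := run.step n (Sum.inl (τ', a)) (by rw [hn]; rfl)
        have hne : τ ≠ τ' := by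
          rintro rfl
          rw [threadHist_eq_some.2 hn] at none_n
          cases none_n
        simp only [update, Function.update_of_ne hne]
  · refine fun run => ⟨funext fun τ => (run τ).init, ?_, ?_⟩
    · intro n σ hσ
      obtain ⟨⟨τ, a⟩, ha, rfl⟩ := Option.map_eq_some_iff.1 hσ
      refine ⟨q (n + 1) τ, (run τ).step n _ (by rw [threadHist_eq_some.2 ha]; rfl), ?_⟩
      refine Function.eq_update_iff.2 ⟨rfl, fun τ' hne => (run τ').idle n ?_⟩
      simp [threadHist, ha, hne.symm]
    · intro n none_n
      rw [Option.map_eq_none_iff] at none_n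
      exact funext fun τ => (run τ).idle n (by simp [threadHist, none_n])

theorem Program.exists_prefix_mem_Beh {P : Program.{u, v, w} Tid L} {β : Behavior Tid L}
    (hβ : β ∈ P.Beh) (N : Tid → ℕ) :
    ∃ β' ∈ P.Beh, ∀ τ k a, (β' τ).get? k = some a ↔ k < N τ ∧ (β τ).get? k = some a := by
  obtain ⟨q, l, run, rfl⟩ := LTS.mem_Beh_iff.1 hβ
  rw [eq_map_inl_obsHist l] at run
  obtain ⟨h', thread_h'⟩ := exists_threadHist_eq_truncate (obsHist l) N
  let thread_label (τ : Tid) (n : ℕ) : Option (L ⊕ Empty) :=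
    (threadHist (obsHist l) τ n).map Sum.inl
  let q' (n : ℕ) (τ : Tid) : (P τ).Q := truncateState (fun n => q n τ) (thread_label τ) (N τ) n
  have run' : StutterRun P.lts q' fun n => (h' n).map Sum.inl := by
    refine Program.stutterRun_iff.2 fun τ => ?_
    convert (Program.stutterRun_iff.1 run τ).truncate (N τ) using 2 with n
    rw [thread_h', truncate, truncate, countSome_map _ fun _ => Sum.inl]
    split_ifs <;> rfl
  refine ⟨histBeh h', LTS.mem_Beh_iff.2 ⟨_, _, run', by rw [obsHist_map_inl]⟩, fun τ k a => ?_⟩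
  rw [histBeh, thread_h', reduceOption_truncate_get?_eq_some]
  rfl

end ProgramPrefix

/-! ### Prefix finiteness -/

section PrefixFinite

theorem finite_reflTransGen_of_wellFounded {α : Type*} {R : α → α → Prop} (hR : WellFounded R)
    (hfin : PrefixFinite R) (b : α) : {a | Relation.ReflTransGen R a b}.Finite := by
  induction b using hR.induction with
  | _ b ih =>
    refine (((hfin b).biUnion ih).union (Set.finite_singleton b)).subset fun a ha => ?_
    rcases ha.cases_tail with rfl | ⟨c, hac, hcb⟩
    · exact Or.inr rfl
    · exact Or.inl (Set.mem_biUnion hcb hac)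

variable {Tid Loc L : Type*}

/-- The serial number of an event, and the junk value `0` for initialization events. -/
def Event.serial : Event Tid Loc L → ℕ
  | init _ => 0
  | ev k _ _ => k

/-- The non-initialization events of the thread `τ` in `E`. -/
def threadEvents (E : Set (Event Tid Loc L)) (τ : Tid) : Set (Event Tid Loc L) :=
  {e | e ∈ E ∧ ∃ k l, e = .ev k τ l}

variable {E : Set (Event Tid Loc L)} {a b : Event Tid Loc L}

theorem mem_iUnion_threadEvents : a ∈ ⋃ τ, threadEvents E τ ↔ a ∈ E ∧ ¬ a.IsInit := by
  rcases a with x | ⟨k, τ, l⟩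
  · simp [threadEvents, Event.IsInit]
  · simp [threadEvents, Event.IsInit]

theorem WellFormed.sb_trichotomy (wf : WellFormed E) {τ : Tid} (ha : a ∈ threadEvents E τ)
    (hb : b ∈ threadEvents E τ) : a.Sb b ∨ a = b ∨ b.Sb a := by
  obtain ⟨ha, k, l, rfl⟩ := ha
  obtain ⟨hb, k', l', rfl⟩ := hb
  rcases lt_trichotomy k k' with hlt | rfl | hlt
  · exact Or.inl ⟨rfl, hlt⟩
  · exact Or.inr (Or.inl (by rw [wf.unique _ _ _ _ ha hb]))
  · exact Or.inr (Or.inr ⟨rfl, hlt⟩)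

theorem WellFormed.finite_sb (wf : WellFormed E) (b : Event Tid Loc L) :
    {a | a ∈ E ∧ a.Sb b ∧ ¬ a.IsInit}.Finite := by
  rcases b with x | ⟨k, τ, l⟩
  · refine Set.finite_empty.subset ?_
    rintro a ⟨-, hsb, -⟩
    exact a.not_sb_init x hsb
  · refine Set.Finite.of_injOn (f := Event.serial) (t := Set.Iio k) ?_ ?_ (Set.finite_Iio k)
    · rintro (x | ⟨j, τ', l'⟩) ⟨-, hsb, hi⟩
      · exact absurd trivial hi
      · exact hsb.2
    · rintro (x | ⟨j, τ', a⟩) ⟨ha, hsb, hi⟩ (y | ⟨j', τ'', a'⟩) ⟨ha', hsb', hi'⟩ heq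
      · exact absurd trivial hi
      · exact absurd trivial hi
      · exact absurd trivial hi'
      · obtain ⟨rfl, -⟩ := hsb
        obtain ⟨rfl, -⟩ := hsb'
        obtain rfl : j = j' := heq
        rw [wf.unique _ _ _ _ ha ha']

/-- `R` between non-initialization events. -/
def NonInit (R : Event Tid Loc L → Event Tid Loc L → Prop) (a b : Event Tid Loc L) : Prop :=
  R a b ∧ ¬ a.IsInit ∧ ¬ b.IsInit

variable {R : Event Tid Loc L → Event Tid Loc L → Prop}

theorem NonInit.wellFounded [Finite Tid] (wf : WellFormed E) (hE : ∀ a b, R a b → a ∈ E ∧ b ∈ E)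
    (hsb : ∀ a ∈ E, ∀ b ∈ E, a.Sb b → R a b) (hac : Acyclic R) : WellFounded (NonInit R) := by
  have := Fintype.ofFinite Tid
  let r := Relation.TransGen (NonInit R)
  have r_le : ∀ a b, r a b → Relation.TransGen R a b :=
    Relation.TransGen.mono fun _ _ => And.left
  have : IsStrictOrder (Event Tid Loc L) r :=
    { irrefl := fun a h => hac a (r_le a a h)
      trans := fun _ _ _ => Relation.TransGen.trans }
  have thread_wf : ∀ τ, (threadEvents E τ).WellFoundedOn r := fun τ => by
    refine Set.wellFoundedOn_iff.2 (Subrelation.wf (r := InvImage (· < ·) Event.serial) ?_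
      (InvImage.wf _ wellFounded_lt))
    rintro a b ⟨hab, ha, hb⟩
    rcases wf.sb_trichotomy ha hb with hlt | rfl | hgt
    · obtain ⟨-, k, l, rfl⟩ := ha
      obtain ⟨-, k', l', rfl⟩ := hb
      exact hlt.2
    · exact absurd hab (irrefl a)
    · exact absurd ((r_le a b hab).tail (hsb b hb.1 a ha.1 hgt)) (hac a)
  have union_wf : (⋃ τ, threadEvents E τ).WellFoundedOn r := by
    simpa using (Finset.wellFoundedOn_bUnion Finset.univ).2 fun τ _ => thread_wf τ
  refine Subrelation.wf ?_ (Set.wellFoundedOn_iff.1 union_wf)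
  rintro a b hab
  exact ⟨.single hab, mem_iUnion_threadEvents.2 ⟨(hE a b hab.1).1, hab.2.1⟩,
    mem_iUnion_threadEvents.2 ⟨(hE a b hab.1).2, hab.2.2⟩⟩

theorem finite_prefix_of_acyclic [Finite Tid] (wf : WellFormed E)
    (hE : ∀ a b, R a b → a ∈ E ∧ b ∈ E) (hsb : ∀ a ∈ E, ∀ b ∈ E, a.Sb b → R a b) (hac : Acyclic R)
    (hfin : ∀ b, ¬ b.IsInit → {a | R a b ∧ ¬ a.IsInit}.Finite) (b : Event Tid Loc L) :
    {a | Relation.ReflTransGen (NonInit R) a b}.Finite := by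
  refine finite_reflTransGen_of_wellFounded (NonInit.wellFounded wf hE hsb hac) (fun b => ?_) b
  by_cases hb : b.IsInit
  · exact Set.finite_empty.subset fun a ha => ha.2.2 hb
  · exact (hfin b hb).subset fun a ha => ⟨ha.1, ha.2.1⟩

end PrefixFinite

/-! ### Restriction of execution graphs -/

section Restrict

variable {Tid Loc Val L : Type*} [MemLabel L Loc Val] [Zero Val]

namespace EGraph

/-- Sets of events of `G` that contain initialization and are closed under `po` and `rf`. -/
structure IsPrefix (G : EGraph Tid L) (D : Set (Event Tid Loc L)) : Prop where
  sub : D ⊆ G.E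
  init_mem : ∀ x, Event.init x ∈ D
  po_closed : ∀ a b, G.po a b → b ∈ D → a ∈ D
  rf_closed : ∀ a b, G.rf a b → b ∈ D → a ∈ D

/-- The restriction of an execution graph to a prefix. -/
def restrictTo (G : EGraph Tid L) (D : Set (Event Tid Loc L)) (hD : G.IsPrefix D) :
    EGraph Tid L where
  E := D
  rf a b := G.rf a b ∧ a ∈ D ∧ b ∈ D
  mo a b := G.mo a b ∧ a ∈ D ∧ b ∈ D
  wf :=
    { init_mem := hD.init_mem
      unique := fun k τ l l' h h' => G.wf.unique k τ l l' (hD.sub h) (hD.sub h')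
      closed := fun k τ l h j hj => by
        obtain ⟨l', hl'⟩ := G.wf.closed k τ l (hD.sub h) j hj
        exact ⟨l', hD.po_closed _ _ ⟨hl', hD.sub h, rfl, hj⟩ h⟩ }
  rf_mem _ _ h := h.2
  rf_type w r h := G.rf_type w r h.1
  rf_loc w r h := G.rf_loc w r h.1
  rf_val w r h := G.rf_val w r h.1
  rf_fun w w' r h h' := G.rf_fun w w' r h.1 h'.1
  rf_total r hr hR := by
    obtain ⟨w, hw⟩ := G.rf_total r (hD.sub hr) hR
    exact ⟨w, hw, hD.rf_closed _ _ hw hr, hr⟩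
  mo_mem _ _ h := h.2
  mo_type a b h := G.mo_type a b h.1
  mo_irrefl a h := G.mo_irrefl a h.1
  mo_trans a b c h h' := ⟨G.mo_trans a b c h.1 h'.1, h.2.1, h'.2.2⟩
  mo_total a ha b hb haW hbW hl hne :=
    (G.mo_total a (hD.sub ha) b (hD.sub hb) haW hbW hl hne).imp (⟨·, ha, hb⟩) (⟨·, hb, ha⟩)

variable {G : EGraph Tid L} {D : Set (Event Tid Loc L)} {hD : G.IsPrefix D}
  {a b : Event Tid Loc L}

theorem restrictTo_po : (G.restrictTo D hD).po a b ↔ G.po a b ∧ a ∈ D ∧ b ∈ D :=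
  ⟨fun h => ⟨⟨hD.sub h.1, hD.sub h.2.1, h.2.2⟩, h.1, h.2.1⟩, fun h => ⟨h.2.1, h.2.2, h.1.2.2⟩⟩

theorem restrictTo_fr : (G.restrictTo D hD).fr a b ↔ G.fr a b ∧ a ∈ D ∧ b ∈ D := by
  constructor
  · rintro ⟨⟨w, hw, hm⟩, hne⟩
    exact ⟨⟨⟨w, hw.1, hm.1⟩, hne⟩, hw.2.2, hm.2.2⟩
  · rintro ⟨⟨⟨w, hw, hm⟩, hne⟩, ha, hb⟩
    have hwD := hD.rf_closed _ _ hw ha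
    exact ⟨⟨w, ⟨hw, hwD, ha⟩, hm, hwD, hb⟩, hne⟩

theorem po_of_restrictTo (h : (G.restrictTo D hD).po a b) : G.po a b := (restrictTo_po.1 h).1

theorem fr_of_restrictTo (h : (G.restrictTo D hD).fr a b) : G.fr a b := (restrictTo_fr.1 h).1

theorem rfe_of_restrictTo (h : (G.restrictTo D hD).rfe a b) : G.rfe a b :=
  ⟨h.1.1, fun hpo => h.2 (restrictTo_po.2 ⟨hpo, h.1.2⟩)⟩

theorem hbRA_of_restrictTo : (G.restrictTo D hD).hbRA a b → G.hbRA a b :=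
  Relation.TransGen.mono (fun _ _ => .imp po_of_restrictTo And.left) _ _

theorem scLoc_of_restrictTo : (G.restrictTo D hD).scLoc a b → G.scLoc a b :=
  Relation.TransGen.mono (fun _ _ => .imp (.imp_left po_of_restrictTo) <|
    .imp And.left <| .imp And.left fr_of_restrictTo) _ _

theorem raLoc_of_restrictTo : (G.restrictTo D hD).raLoc a b → G.raLoc a b :=
  Relation.TransGen.mono (fun _ _ => .imp (.imp_left hbRA_of_restrictTo) <|
    .imp And.left <| .imp And.left fr_of_restrictTo) _ _

theorem hbTSO_of_restrictTo : (G.restrictTo D hD).hbTSO a b → G.hbTSO a b :=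
  Relation.TransGen.mono (fun _ _ => .imp (.imp_left po_of_restrictTo) <|
    .imp rfe_of_restrictTo <| .imp And.left fr_of_restrictTo) _ _

theorem eco_of_restrictTo : (G.restrictTo D hD).eco a b → G.eco a b :=
  Relation.TransGen.mono (fun _ _ => .imp And.left <| .imp And.left fr_of_restrictTo) _ _

end EGraph

/-- `𝒢` is closed under restriction to `po ∪ rf`-prefixes. -/
def PrefixClosed (𝒢 : DeclMem Tid L) : Prop :=
  ∀ G ∈ 𝒢, ∀ D (hD : G.IsPrefix D), G.restrictTo D hD ∈ 𝒢

theorem prefixClosed_GTSO : PrefixClosed (GTSO Tid L) := fun _ hG _ _ =>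
  ⟨fun a h => hG.1 a (EGraph.hbTSO_of_restrictTo h),
    fun a h => hG.2 a (EGraph.scLoc_of_restrictTo h)⟩

theorem prefixClosed_GRA : PrefixClosed (GRA Tid L) := fun _ hG _ _ a h =>
  hG a (EGraph.raLoc_of_restrictTo h)

theorem prefixClosed_GStrongCOH : PrefixClosed (GStrongCOH Tid L) := fun _ hG _ _ =>
  ⟨fun a h => hG.1 a (EGraph.hbRA_of_restrictTo h),
    fun a h => hG.2 a (EGraph.scLoc_of_restrictTo h)⟩

end Restrict

section RestrictRC11

variable {Tid Loc Val : Type*} [Zero Val]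

namespace EGraph

variable {G : EGraph Tid (CLab Loc Val)} {D : Set (Event Tid Loc (CLab Loc Val))}
  {hD : G.IsPrefix D} {a b : Event Tid Loc (CLab Loc Val)}

theorem rs_of_restrictTo (h : (G.restrictTo D hD).rs a b) : G.rs a b := by
  obtain ⟨ha, haW, c, hac, hcW, hc, hcb⟩ := h
  exact ⟨hD.sub ha, haW, c, hac.imp_right (.imp_left po_of_restrictTo), hcW, hc,
    Relation.ReflTransGen.mono (fun _ _ => .imp_left And.left) _ _ hcb⟩

theorem sw_of_restrictTo (h : (G.restrictTo D hD).sw a b) : G.sw a b := by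
  obtain ⟨ha, hb, w, w', r, haw, hrs, hrf, hr, hrb⟩ := h
  exact ⟨ha, hb, w, w', r, haw.imp_right (.imp_right po_of_restrictTo), rs_of_restrictTo hrs,
    hrf.1, hr, hrb.imp_right (.imp_left po_of_restrictTo)⟩

theorem hbRC11_of_restrictTo : (G.restrictTo D hD).hbRC11 a b → G.hbRC11 a b :=
  Relation.TransGen.mono (fun _ _ => .imp po_of_restrictTo sw_of_restrictTo) _ _

theorem scb_of_restrictTo : (G.restrictTo D hD).scb a b → G.scb a b :=
  .imp po_of_restrictTo <| .imp (fun ⟨c, d, hac, hcd, hdb⟩ =>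
      ⟨c, d, ⟨po_of_restrictTo hac.1, hac.2⟩, hbRC11_of_restrictTo hcd,
        ⟨po_of_restrictTo hdb.1, hdb.2⟩⟩) <|
    .imp (.imp_left hbRC11_of_restrictTo) <| .imp And.left fr_of_restrictTo

theorem pscBase_of_restrictTo (h : (G.restrictTo D hD).pscBase a b) : G.pscBase a b := by
  obtain ⟨ha, hb, c, d, hac, hcd, hdb⟩ := h
  exact ⟨ha, hb, c, d, hac.imp_right (.imp_right hbRC11_of_restrictTo), scb_of_restrictTo hcd,
    hdb.imp_right (.imp_left hbRC11_of_restrictTo)⟩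

theorem pscF_of_restrictTo (h : (G.restrictTo D hD).pscF a b) : G.pscF a b := by
  obtain ⟨ha, haF, hb, hbF, h⟩ := h
  exact ⟨ha, haF, hb, hbF, h.imp hbRC11_of_restrictTo fun ⟨c, d, hac, hcd, hdb⟩ =>
    ⟨c, d, hbRC11_of_restrictTo hac, eco_of_restrictTo hcd, hbRC11_of_restrictTo hdb⟩⟩

end EGraph

theorem prefixClosed_GRC11 : PrefixClosed (GRC11 Tid Loc Val) := by
  rintro G ⟨irrefl_hb, coherent, atomic, acyclic_psc, acyclic_hbRA⟩ D hD
  exact ⟨fun a h => irrefl_hb a (EGraph.hbRC11_of_restrictTo h),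
    fun a b h h' => coherent a b (EGraph.hbRC11_of_restrictTo h) (EGraph.eco_of_restrictTo h'),
    fun a h => atomic a (EGraph.eco_of_restrictTo h),
    fun a h => acyclic_psc a <| Relation.TransGen.mono (fun _ _ =>
      .imp EGraph.pscBase_of_restrictTo EGraph.pscF_of_restrictTo) _ _ h,
    fun a h => acyclic_hbRA a (EGraph.hbRA_of_restrictTo h)⟩

end RestrictRC11

/-! ### Robustness of infinite executions -/

section Limit

variable {Tid Loc Val L : Type*} [MemLabel L Loc Val] [Zero Val]

theorem exists_finite_support_of_transGen {α : Type*} {R : α → α → Prop} {a b : α}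
    (h : Relation.TransGen R a b) :
    ∃ s : Set α, s.Finite ∧ Relation.TransGen (fun x y => R x y ∧ x ∈ s ∧ y ∈ s) a b := by
  induction h with
  | @single b h =>
    exact ⟨{a, b}, by simp, Relation.TransGen.single ⟨h, by simp, by simp⟩⟩
  | @tail b c _ h ih =>
    obtain ⟨s, hs, hab⟩ := ih
    exact ⟨s ∪ {b, c}, hs.union (by simp), Relation.TransGen.tail
      (Relation.TransGen.mono (fun _ _ h => ⟨h.1, Or.inl h.2.1, Or.inl h.2.2⟩) _ _ hab)
      ⟨h, by simp, by simp⟩⟩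

namespace EGraph

variable {G : EGraph Tid L}

theorem rf_prefixFinite (G : EGraph Tid L) : PrefixFinite G.rf := fun _ =>
  Set.Subsingleton.finite fun _ h₁ _ h₂ => G.rf_fun _ _ _ h₁ h₂

theorem fr_mem {a b : Event Tid Loc L} (h : G.fr a b) : a ∈ G.E ∧ b ∈ G.E := by
  obtain ⟨⟨w, hw, hm⟩, -⟩ := h
  exact ⟨(G.rf_mem _ _ hw).2, (G.mo_mem _ _ hm).2⟩

theorem not_isInit_of_po_or_rf {a b : Event Tid Loc L} (h : G.po a b ∨ G.rf a b) :
    ¬ b.IsInit := by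
  rcases b with x | ⟨k, τ, l⟩
  · rcases h with h | h
    · exact absurd h.2.2 (Event.not_sb_init _ _)
    · exact absurd (G.rf_type _ _ h).2 (Event.not_isR_init x)
  · exact id

theorem exists_finite_isPrefix [Finite Tid] (hac : Irrefl G.hbRA) {s : Set (Event Tid Loc L)}
    (hs : s.Finite) (hsE : s ⊆ G.E) :
    ∃ D, G.IsPrefix D ∧ s ⊆ D ∧ {a | a ∈ D ∧ ¬ a.IsInit}.Finite := by
  let R (a b : Event Tid Loc L) : Prop := G.po a b ∨ G.rf a b
  have R_mem : ∀ a b, R a b → a ∈ G.E ∧ b ∈ G.E := fun a b h =>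
    h.elim (fun h => ⟨h.1, h.2.1⟩) (G.rf_mem a b)
  have finite_below : ∀ b, {a | Relation.ReflTransGen (NonInit R) a b}.Finite :=
    finite_prefix_of_acyclic G.wf R_mem (fun a ha b hb h => Or.inl ⟨ha, hb, h⟩) hac fun b _ =>
      ((G.wf.finite_sb b).union (G.rf_prefixFinite b)).subset fun a ha =>
        ha.1.imp (fun h => ⟨h.1, h.2.2, ha.2⟩) id
  let D₀ : Set (Event Tid Loc L) :=
    {a | a ∈ G.E ∧ ∃ b ∈ s, Relation.ReflTransGen (NonInit R) a b}
  have closed : ∀ a b, R a b → b.IsInit ∨ b ∈ D₀ → a.IsInit ∨ a ∈ D₀ := by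
    intro a b hab hb
    have hbi : ¬ b.IsInit := not_isInit_of_po_or_rf hab
    obtain ⟨-, c, hc, hbc⟩ := hb.resolve_left hbi
    exact or_iff_not_imp_left.2 fun ha =>
      ⟨(R_mem a b hab).1, c, hc, Relation.ReflTransGen.head ⟨hab, ha, hbi⟩ hbc⟩
  refine ⟨{a | a.IsInit ∨ a ∈ D₀}, ⟨?_, fun x => Or.inl trivial, fun a b h => closed a b (Or.inl h),
    fun a b h => closed a b (Or.inr h)⟩, fun a ha => Or.inr ⟨hsE ha, a, ha, .refl⟩, ?_⟩
  · rintro (x | ⟨k, τ, l⟩) ha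
    · exact G.wf.init_mem x
    · exact (ha.resolve_left id).1
  · refine (hs.biUnion fun b _ => finite_below b).subset ?_
    rintro a ⟨ha, hai⟩
    obtain ⟨-, b, hb, hab⟩ := ha.resolve_left hai
    exact Set.mem_biUnion hb hab

theorem IsPrefix.exists_isFinite_behavior {P : Program Tid L} {β : Behavior Tid L}
    (hβ : β ∈ P.Beh) (hE : eventsOf Loc β = G.E) {D : Set (Event Tid Loc L)} (hD : G.IsPrefix D)
    (hfin : {a | a ∈ D ∧ ¬ a.IsInit}.Finite) :
    ∃ β' ∈ P.Beh, β'.IsFinite ∧ eventsOf Loc β' = D := by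
  classical
  have exists_free : ∀ τ, ∃ k, ∀ l, Event.ev k τ l ∉ D := by
    intro τ
    obtain ⟨k, hk⟩ := (hfin.image Event.serial).infinite_compl.nonempty
    exact ⟨k, fun l hl => hk ⟨_, ⟨hl, id⟩, rfl⟩⟩
  let N (τ : Tid) : ℕ := Nat.find (exists_free τ)
  have mem_D_iff : ∀ k τ l, Event.ev k τ l ∈ D ↔ k < N τ ∧ Event.ev k τ l ∈ G.E := by
    refine fun k τ l => ⟨fun h => ⟨?_, hD.sub h⟩, fun ⟨hk, h⟩ => ?_⟩
    · by_contra! hk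
      rcases hk.lt_or_eq with hlt | heq
      · obtain ⟨l', hl'⟩ := G.wf.closed _ _ _ (hD.sub h) _ hlt
        exact Nat.find_spec (exists_free τ) l' (hD.po_closed _ _ ⟨hl', hD.sub h, rfl, hlt⟩ h)
      · exact Nat.find_spec (exists_free τ) l (by rwa [show Nat.find _ = k from heq])
    · have taken := Nat.find_min (exists_free τ) hk
      push Not at taken
      obtain ⟨l', hl'⟩ := taken
      rwa [G.wf.unique _ _ _ _ h (hD.sub hl')]
  obtain ⟨β', hβ', hget⟩ := Program.exists_prefix_mem_Beh hβ N
  refine ⟨β', hβ', fun τ => ⟨N τ, ?_⟩, ?_⟩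
  · by_contra hne
    obtain ⟨a, ha⟩ := Option.ne_none_iff_exists'.1 hne
    exact lt_irrefl _ ((hget _ _ _).1 ha).1
  · ext (x | ⟨k, τ, l⟩)
    · exact iff_of_true (init_mem_eventsOf β' x) (hD.init_mem x)
    · rw [ev_mem_eventsOf, hget, ← ev_mem_eventsOf (Loc := Loc), hE, mem_D_iff]

end EGraph

theorem FinitelyRobust.mem_GSC [Finite Tid] {P : Program Tid L} {𝒢 : DeclMem Tid L}
    (hP : FinitelyRobust P 𝒢) (h𝒢 : PrefixClosed 𝒢) {β : Behavior Tid L} (hβ : β ∈ P.Beh)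
    {G : EGraph Tid L} (hG : G ∈ 𝒢) (hE : eventsOf Loc β = G.E) (hac : Irrefl G.hbRA) :
    G ∈ GSC Tid L := by
  intro e he
  obtain ⟨s, hs, cycle⟩ := exists_finite_support_of_transGen he
  obtain ⟨D, hD, hsD, hfin⟩ := EGraph.exists_finite_isPrefix hac
    (hs.inter_of_left G.E) Set.inter_subset_right
  obtain ⟨β', hβ', finite_β', hE'⟩ := hD.exists_isFinite_behavior hβ hE hfin
  refine hP β' hβ' finite_β' _ (h𝒢 G hG D hD) hE' e (Relation.TransGen.mono ?_ _ _ cycle)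
  rintro a b ⟨hab, has, hbs⟩
  have mem_D : a ∈ G.E ∧ b ∈ G.E → a ∈ D ∧ b ∈ D := fun h =>
    ⟨hsD ⟨has, h.1⟩, hsD ⟨hbs, h.2⟩⟩
  exact hab.imp (fun h => EGraph.restrictTo_po.2 ⟨h, mem_D ⟨h.1, h.2.1⟩⟩) <|
    .imp (fun h => ⟨h, mem_D (G.rf_mem _ _ h)⟩) <|
    .imp (fun h => ⟨h, mem_D (G.mo_mem _ _ h)⟩) fun h =>
      EGraph.restrictTo_fr.2 ⟨h, mem_D (EGraph.fr_mem h)⟩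

end Limit

/-! ### Sequentially consistent histories -/

section SCHistory

variable {Tid Loc Val L : Type*} [MemLabel L Loc Val] [Zero Val]

theorem eq_of_time_eq {h : ℕ → Option (Tid × L)} {a b : Event Tid Loc L}
    (ha : a ∈ eventsOf Loc (histBeh h)) (hb : b ∈ eventsOf Loc (histBeh h)) (hl : a.SameLoc b)
    (hab : time h a = time h b) : a = b := by
  rcases mem_eventsOf_histBeh.1 ha with ⟨x, rfl⟩ | ⟨n, hn⟩ <;>
    rcases mem_eventsOf_histBeh.1 hb with ⟨y, rfl⟩ | ⟨m, hm⟩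
  · obtain ⟨z, ⟨⟩, ⟨⟩⟩ := hl
    rfl
  · simp [hm.time_eq] at hab
  · simp [hn.time_eq] at hab
  · rw [hn.time_eq, hm.time_eq] at hab
    cases hab
    exact hn.event_unique hm

theorem exists_occursAt_of_isR {h : ℕ → Option (Tid × L)} {r : Event Tid Loc L}
    (hr : r ∈ eventsOf Loc (histBeh h)) (hR : r.IsR) : ∃ n, OccursAt h n r := by
  rcases mem_eventsOf_histBeh.1 hr with ⟨x, rfl⟩ | hn
  · exact absurd hR (Event.not_isR_init x)
  · exact hn

theorem exists_occursAt {h : ℕ → Option (Tid × L)} {n : ℕ} {σ : Tid × L} (hn : h n = some σ) :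
    ∃ e : Event Tid Loc L, OccursAt h n e :=
  ⟨_, σ.1, σ.2, hn, rfl⟩

open Classical in
/-- The write to `x` that comes last among the initialization events and the events issued before
time `n`. -/
noncomputable def lastWrite (h : ℕ → Option (Tid × L)) : ℕ → Loc → Event Tid Loc L
  | 0, x => .init x
  | n + 1, x =>
    if he : ∃ e : Event Tid Loc L, OccursAt h n e ∧ e.IsW ∧ e.loc = some x then he.choose
    else lastWrite h n x

variable {h : ℕ → Option (Tid × L)} {n : ℕ} {x : Loc} {e : Event Tid Loc L}

theorem lastWrite_succ_of_write (he : OccursAt h n e) (hW : e.IsW) (hx : e.loc = some x) :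
    lastWrite h (n + 1) x = e := by
  have hex : ∃ e : Event Tid Loc L, OccursAt h n e ∧ e.IsW ∧ e.loc = some x := ⟨e, he, hW, hx⟩
  rw [lastWrite, dif_pos hex]
  exact hex.choose_spec.1.event_unique he

theorem lastWrite_succ_of_forall_not
    (hne : ∀ e : Event Tid Loc L, OccursAt h n e → ¬ (e.IsW ∧ e.loc = some x)) :
    lastWrite h (n + 1) x = lastWrite h n x := by
  rw [lastWrite, dif_neg]
  rintro ⟨e, he, hex⟩
  exact hne e he hex

theorem lastWrite_spec (h : ℕ → Option (Tid × L)) (n : ℕ) (x : Loc) :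
    lastWrite h n x ∈ eventsOf Loc (histBeh h) ∧ (lastWrite h n x).IsW ∧
      (lastWrite h n x).loc = some x ∧ time h (lastWrite h n x) ≤ n := by
  induction n with
  | zero => exact ⟨init_mem_eventsOf _ x, Event.isW_init x, rfl, (time_init x).le⟩
  | succ n ih =>
    by_cases hex : ∃ e : Event Tid Loc L, OccursAt h n e ∧ e.IsW ∧ e.loc = some x
    · obtain ⟨e, he, hW, hx⟩ := hex
      rw [lastWrite_succ_of_write he hW hx]
      exact ⟨he.mem, hW, hx, he.time_eq.le⟩
    · rw [lastWrite_succ_of_forall_not fun e he hWx => hex ⟨e, he, hWx⟩]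
      exact ⟨ih.1, ih.2.1, ih.2.2.1, ih.2.2.2.trans n.le_succ⟩

theorem time_le_time_lastWrite {w : Event Tid Loc L} (hw : w ∈ eventsOf Loc (histBeh h))
    (hW : w.IsW) (hx : w.loc = some x) (hn : time h w ≤ n) :
    time h w ≤ time h (lastWrite h n x) := by
  induction n with
  | zero => exact hn.trans (Nat.zero_le _)
  | succ n ih =>
    by_cases hex : ∃ e : Event Tid Loc L, OccursAt h n e ∧ e.IsW ∧ e.loc = some x
    · obtain ⟨e, he, heW, hex⟩ := hex
      rwa [lastWrite_succ_of_write he heW hex, he.time_eq]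
    · rw [lastWrite_succ_of_forall_not fun e he hWx => hex ⟨e, he, hWx⟩]
      refine ih (Nat.le_of_lt_succ (hn.lt_of_ne fun heq => ?_))
      rcases mem_eventsOf_histBeh.1 hw with ⟨y, rfl⟩ | ⟨m, hm⟩
      · simp at heq
      · rw [hm.time_eq, Nat.succ_inj] at heq
        exact hex ⟨w, heq ▸ hm, hW, hx⟩

/-- Histories in which every read returns the value of the last write to its location. -/
def ReadsLastWrites (h : ℕ → Option (Tid × L)) : Prop :=
  ∀ n (r : Event Tid Loc L) x, OccursAt h n r → r.IsR → r.loc = some x →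
    (lastWrite h n x).valW = r.valR

theorem OccursAt.MSC_step_iff {σ : Tid × L} {M M' : Loc → Val} (he : OccursAt h n e)
    (hσ : h n = some σ) :
    (MSC Tid Loc Val L).step M (Sum.inl σ) M' ↔
      (∀ x, e.loc = some x → ∀ v, e.valR = some v → M x = v) ∧
      (∀ x, e.loc = some x → ∀ v, e.valW = some v → M' x = v) ∧
      ∀ x, ¬ (e.IsW ∧ e.loc = some x) → M' x = M x := by
  classical
  obtain ⟨τ, a, hn, rfl⟩ := he
  obtain rfl : (τ, a) = σ := Option.some_inj.1 (hn.symm.trans hσ)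
  unfold Event.IsW Event.loc Event.valR Event.valW Event.access
  simp only [MSC]
  rcases (MemLabel.access a : Option (ELab Loc Val)) with _ | (⟨y, u⟩ | ⟨y, u⟩ | ⟨y, u, u'⟩) <;>
    simp [ELab.loc, ELab.valR, ELab.valW, funext_iff, Function.update_apply] <;> grind

theorem StutterRun.valW_lastWrite {q : ℕ → Loc → Val} {l : ℕ → Option ((Tid × L) ⊕ Empty)}
    (run : StutterRun (MSC Tid Loc Val L) q l) (n : ℕ) (x : Loc) :
    (lastWrite (obsHist l) n x).valW = some (q n x) := by
  induction n with
  | zero =>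
    rw [run.init]
    rfl
  | succ n ih =>
    rcases hn : l n with _ | (σ | ⟨⟨⟩⟩)
    · rw [run.idle n hn, lastWrite_succ_of_forall_not, ih]
      rintro e ⟨τ, a, hna, -⟩
      cases hn.symm.trans (obsHist_eq_some.1 hna)
    · obtain ⟨e, he⟩ := exists_occursAt (Loc := Loc) (obsHist_eq_some.2 hn)
      obtain ⟨-, write, keep⟩ := (he.MSC_step_iff (obsHist_eq_some.2 hn)).1 (run.step n _ hn)
      by_cases hex : e.IsW ∧ e.loc = some x
      · rw [lastWrite_succ_of_write he hex.1 hex.2]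
        obtain ⟨v, hv⟩ := Option.isSome_iff_exists.1 hex.1
        rw [hv, write x hex.2 v hv]
      · rw [lastWrite_succ_of_forall_not fun e' he' => he'.event_unique he ▸ hex, ih, keep x hex]

theorem stutterRun_of_readsLastWrites (hh : ReadsLastWrites (Loc := Loc) h) :
    StutterRun (MSC Tid Loc Val L) (fun n x => (lastWrite h n x).valW.getD 0)
      fun n => (h n).map Sum.inl where
  init := rfl
  step := by
    intro n σ hσ
    obtain ⟨σ, hn, rfl⟩ := Option.map_eq_some_iff.1 hσ
    obtain ⟨e, he⟩ := exists_occursAt (Loc := Loc) hn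
    refine (he.MSC_step_iff hn).2 ⟨fun x hx v hv => ?_, fun x hx v hv => ?_, fun x hx => ?_⟩
    · rw [hh n e x he (Option.isSome_of_eq_some hv) hx, hv, Option.getD_some]
    · rw [lastWrite_succ_of_write he (Option.isSome_of_eq_some hv) hx, hv, Option.getD_some]
    · rw [lastWrite_succ_of_forall_not fun e' he' => he'.event_unique he ▸ hx]
  idle := by
    intro n hn
    funext x
    rw [lastWrite_succ_of_forall_not]
    rintro e ⟨τ, a, hna, -⟩
    simp [hna] at hn

theorem mem_BehMF_MSC_iff {β : Behavior Tid L} :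
    β ∈ (MSC Tid Loc Val L).BehMF ↔ ∃ h, histBeh h = β ∧ ReadsLastWrites (Loc := Loc) h := by
  constructor
  · intro hβ
    obtain ⟨q, l, run, rfl, -⟩ := LTS.exists_stutterRun_of_mem_BehMF hβ
    refine ⟨_, rfl, fun n r x he hR hx => ?_⟩
    obtain ⟨v, hv⟩ := Option.isSome_iff_exists.1 hR
    obtain ⟨τ, a, hn, -⟩ := id he
    have read := ((he.MSC_step_iff hn).1 (run.step n _ (obsHist_eq_some.1 hn))).1 x hx v hv
    rw [run.valW_lastWrite n x, hv, read]
  · rintro ⟨h, rfl, hh⟩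
    have mem := (stutterRun_of_readsLastWrites hh).mem_BehMF_of_isEmpty
    rwa [obsHist_map_inl] at mem

/-- The write that `r` reads from in a history whose reads read from the last write. -/
noncomputable def lastSource (h : ℕ → Option (Tid × L)) (r : Event Tid Loc L) : Event Tid Loc L :=
  match r.loc with
  | some x => lastWrite h (time h r - 1) x
  | none => r

theorem OccursAt.lastSource_eq (he : OccursAt h n e) (hx : e.loc = some x) :
    lastSource h e = lastWrite h n x := by
  simp [lastSource, hx, he.time_eq]

theorem ReadsLastWrites.sourceData (hh : ReadsLastWrites (Loc := Loc) h) :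
    SourceData (eventsOf Loc (histBeh h)) (lastSource h) (time h) := by
  have src : ∀ r ∈ eventsOf Loc (histBeh h), r.IsR →
      ∃ n x, OccursAt h n r ∧ r.loc = some x ∧ lastSource h r = lastWrite h n x := fun r hr hR => by
    obtain ⟨n, hn⟩ := exists_occursAt_of_isR hr hR
    obtain ⟨x, hx⟩ := Event.exists_loc_of_isR hR
    exact ⟨n, x, hn, hx, hn.lastSource_eq hx⟩
  refine ⟨wellFormed_eventsOf _, fun r hr hR => ?_, fun r hr hR => ?_, fun r hr hR => ?_,
    fun r hr hR => ?_, fun a ha b hb _ _ => eq_of_time_eq ha hb⟩ <;>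
    obtain ⟨n, x, hn, hx, heq⟩ := src r hr hR <;> rw [heq]
  · exact (lastWrite_spec h n x).1
  · exact (lastWrite_spec h n x).2.1
  · rw [hx, (lastWrite_spec h n x).2.2.1]
  · exact hh n r x hn hR hx

theorem ReadsLastWrites.time_lt_of_rf (hh : ReadsLastWrites h) {w r : Event Tid Loc L}
    (hrf : hh.sourceData.graph.rf w r) : time h w < time h r := by
  obtain ⟨hr, hR, rfl⟩ := hrf
  obtain ⟨n, hn⟩ := exists_occursAt_of_isR hr hR
  obtain ⟨x, hx⟩ := Event.exists_loc_of_isR hR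
  rw [hn.lastSource_eq hx, hn.time_eq]
  exact Nat.lt_succ_of_le (lastWrite_spec h n x).2.2.2

theorem ReadsLastWrites.time_lt_of_fr (hh : ReadsLastWrites h) {a b : Event Tid Loc L}
    (hfr : hh.sourceData.graph.fr a b) : time h a < time h b := by
  have sameLoc := hh.sourceData.graph.sameLoc_of_fr hfr
  obtain ⟨⟨-, ⟨ha, hR, rfl⟩, -, hb, -, hbW, -, hlt⟩, hne⟩ := hfr
  by_contra! hle
  obtain ⟨n, hn⟩ := exists_occursAt_of_isR ha hR
  obtain ⟨x, hx, hbx⟩ := sameLoc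
  rw [hn.lastSource_eq hx] at hlt
  have before : time h b < time h a := hle.lt_of_ne fun heq =>
    hne (eq_of_time_eq ha hb ⟨x, hx, hbx⟩ heq.symm)
  rw [hn.time_eq] at before
  exact hlt.not_ge (time_le_time_lastWrite hb hbW hbx (Nat.le_of_lt_succ before))

theorem BehMF_MSC_subset_Beh_GSC :
    (MSC Tid Loc Val L).BehMF ⊆ DeclMem.Beh (GSC Tid L ∩ GFair Tid L) := by
  intro β hβ
  obtain ⟨h, rfl, hh⟩ := mem_BehMF_MSC_iff.1 hβ
  refine ⟨hh.sourceData.graph, ⟨acyclic_of_measure (time h) ?_,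
    hh.sourceData.mo_prefixFinite, fun b => ?_⟩, rfl⟩
  · rintro a b (hpo | hrf | hmo | hfr)
    · exact time_lt_of_sb hpo.1 hpo.2.1 hpo.2.2
    · exact hh.time_lt_of_rf hrf
    · exact hmo.2.2.2.2.2
    · exact hh.time_lt_of_fr hfr
  · refine finite_of_occursAt_le (h := h) (time h b) fun a ha => ?_
    have hlt := hh.time_lt_of_fr ha
    obtain ⟨⟨-, ⟨haE, haR, -⟩, -⟩, -⟩ := ha
    obtain ⟨n, hn⟩ := exists_occursAt_of_isR haE haR
    rw [hn.time_eq] at hlt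
    exact ⟨n, n.le_succ.trans hlt.le, hn⟩

end SCHistory

/-! ### Linearization of sequentially consistent graphs -/

section Linearization

theorem exists_rank {α : Type*} {s : Set α} {R : α → α → Prop} (hs : s.Countable)
    (hR : ∀ a b, R a b → a ∈ s ∧ b ∈ s) (hac : Acyclic R)
    (hfin : ∀ b, {a | Relation.ReflTransGen R a b}.Finite) :
    ∃ rank : α → ℕ, s.InjOn rank ∧ ∀ a b, R a b → rank a < rank b := by
  classical
  obtain ⟨code, hcode⟩ := Set.countable_iff_exists_injOn.1 hs
  let D : α → Finset ℕ := fun b => (hfin b).toFinset.image code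
  have mem_D : ∀ {a b}, Relation.ReflTransGen R a b → code a ∈ D b := fun h =>
    Finset.mem_image_of_mem code ((hfin _).mem_toFinset.2 h)
  have of_mem_D : ∀ {a b}, a ∈ s → b ∈ s → code a ∈ D b → Relation.ReflTransGen R a b := by
    intro a b ha hb h
    obtain ⟨c, hc, hca⟩ := Finset.mem_image.1 h
    have hcb : Relation.ReflTransGen R c b := (hfin b).mem_toFinset.1 hc
    have hcs : c ∈ s := by
      rcases hcb.cases_head with rfl | ⟨d, hcd, -⟩
      · exact hb
      · exact (hR c d hcd).1
    rwa [← hcode hcs ha hca]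
  -- The rank of `b` is the number whose binary digits list the codes of the predecessors of `b`.
  refine ⟨fun b => ∑ i ∈ D b, 2 ^ i, fun a ha b hb hab => ?_, fun a b hab => ?_⟩
  · have hD : D a = D b := Finset.geomSum_injective le_rfl hab
    have hab' := of_mem_D ha hb (hD ▸ mem_D .refl)
    have hba' := of_mem_D hb ha (hD ▸ mem_D .refl)
    rcases Relation.reflTransGen_iff_eq_or_transGen.1 hab' with heq | hlt
    · exact heq.symm
    · exact absurd (hlt.trans_left hba') (hac a)
  · obtain ⟨ha, hb⟩ := hR a b hab
    refine Finset.sum_lt_sum_of_subset (i := code b) (Finset.image_subset_image fun c hc => ?_)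
      (mem_D .refl) (fun h => hac b (.tail' (of_mem_D hb ha h) hab)) (by positivity)
      fun _ _ _ => Nat.zero_le _
    rw [Set.Finite.mem_toFinset] at hc ⊢
    exact Relation.ReflTransGen.tail hc hab

variable {Tid Loc Val L : Type*}

theorem WellFormed.countable_nonInit [Countable Tid] {E : Set (Event Tid Loc L)}
    (wf : WellFormed E) : {e | e ∈ E ∧ ¬ e.IsInit}.Countable := by
  let position : Event Tid Loc L → Option (ℕ × Tid)
    | .init _ => none
    | .ev k τ _ => some (k, τ)
  refine Set.MapsTo.countable_of_injOn (f := position) (Set.mapsTo_univ _ _) ?_ Set.countable_univ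
  rintro (x | ⟨k, τ, l⟩) ⟨ha, hai⟩ (y | ⟨k', τ', l'⟩) ⟨hb, hbi⟩ hab
  · exact absurd trivial hai
  · exact absurd trivial hai
  · exact absurd trivial hbi
  · cases hab
    rw [wf.unique _ _ _ _ ha hb]

section RankHist

open Classical in
/-- The history in which the events of `β` occur at the times given by `rank`. -/
noncomputable def rankHist (β : Behavior Tid L) (rank : Event Tid Loc L → ℕ) (n : ℕ) :
    Option (Tid × L) :=
  if h : ∃ σ : Tid × L, ∃ k, (β σ.1).get? k = some σ.2 ∧ rank (.ev k σ.1 σ.2) = n then some h.choose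
  else none

variable {β : Behavior Tid L} {rank : Event Tid Loc L → ℕ}
  (hinj : {e | e ∈ eventsOf Loc β ∧ ¬ e.IsInit}.InjOn rank)
include hinj

theorem rankHist_eq_some {n : ℕ} {τ : Tid} {a : L} :
    rankHist β rank n = some (τ, a) ↔ ∃ k, (β τ).get? k = some a ∧ rank (.ev k τ a) = n := by
  unfold rankHist
  constructor
  · intro h
    split_ifs at h with hex
    have spec := hex.choose_spec
    rwa [Option.some.inj h] at spec
  · rintro ⟨k, hk, hn⟩
    have hex : ∃ σ : Tid × L, ∃ k, (β σ.1).get? k = some σ.2 ∧ rank (.ev k σ.1 σ.2) = n :=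
      ⟨(τ, a), k, hk, hn⟩
    rw [dif_pos hex]
    obtain ⟨k', hk', hn'⟩ := hex.choose_spec
    have heq := hinj ⟨ev_mem_eventsOf.2 hk', id⟩ ⟨ev_mem_eventsOf.2 hk, id⟩ (hn'.trans hn.symm)
    injection heq with _ hτ ha
    exact congrArg some (Prod.ext hτ ha)

variable (hsb : ∀ a b, a ∈ eventsOf Loc β → b ∈ eventsOf Loc β → ¬ a.IsInit → a.Sb b →
  rank a < rank b)
include hsb

theorem exists_strictMonoOn_threadHist_rankHist (τ : Tid) :
    ∃ φ : ℕ → ℕ, (∀ k a, (β τ).get? k = some a → φ k = rank (.ev k τ a)) ∧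
      StrictMonoOn φ {k | ((β τ).get? k).isSome} ∧
      ∀ n a, threadHist (rankHist β rank) τ n = some a ↔ ∃ k, (β τ).get? k = some a ∧ φ k = n := by
  let φ (k : ℕ) : ℕ := ((β τ).get? k).elim 0 fun a => rank (.ev k τ a)
  have eq_rank : ∀ k a, (β τ).get? k = some a → φ k = rank (.ev k τ a) := fun k a hk =>
    congrArg (Option.elim · 0 _) hk
  refine ⟨φ, eq_rank, fun i hi j hj hij => ?_, fun n a => ?_⟩
  · obtain ⟨a, ha⟩ := Option.isSome_iff_exists.1 hi
    obtain ⟨b, hb⟩ := Option.isSome_iff_exists.1 hj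
    rw [eq_rank i a ha, eq_rank j b hb]
    exact hsb _ _ (ev_mem_eventsOf.2 ha) (ev_mem_eventsOf.2 hb) id ⟨rfl, hij⟩
  · rw [threadHist_eq_some, rankHist_eq_some hinj]
    exact exists_congr fun k => and_congr_right fun hk => by rw [eq_rank k a hk]

theorem histBeh_rankHist : histBeh (rankHist β rank) = β := by
  funext τ
  obtain ⟨φ, -, mono, hist⟩ := exists_strictMonoOn_threadHist_rankHist hinj hsb τ
  exact (reduceOption_reindex mono hist).trans (reduceOption_get? _)

theorem occursAt_rankHist {e : Event Tid Loc L} (he : e ∈ eventsOf Loc β) (hi : ¬ e.IsInit) :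
    OccursAt (rankHist β rank) (rank e) e := by
  rcases he with ⟨x, rfl⟩ | ⟨k, τ, a, hk, rfl⟩
  · exact absurd trivial hi
  obtain ⟨φ, eq_rank, mono, hist⟩ := exists_strictMonoOn_threadHist_rankHist hinj hsb τ
  refine ⟨τ, a, (rankHist_eq_some hinj).2 ⟨k, hk, rfl⟩, ?_⟩
  rw [← eq_rank k a hk, countSome_reindex mono hist hk, countSome_get? hk]

end RankHist

variable [MemLabel L Loc Val] [Zero Val] {G : EGraph Tid L}

/-- One step of SC-happens-before. -/
def EGraph.scStep (G : EGraph Tid L) (a b : Event Tid Loc L) : Prop :=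
  G.po a b ∨ G.rf a b ∨ G.mo a b ∨ G.fr a b

theorem EGraph.scStep_mem {a b : Event Tid Loc L} (h : G.scStep a b) : a ∈ G.E ∧ b ∈ G.E := by
  rcases h with h | h | h | h
  · exact ⟨h.1, h.2.1⟩
  · exact G.rf_mem a b h
  · exact G.mo_mem a b h
  · exact G.fr_mem h

theorem EGraph.not_isInit_of_scStep (hG : G ∈ GSC Tid L) {a b : Event Tid Loc L}
    (h : G.scStep a b) : ¬ b.IsInit := by
  rcases b with x | ⟨k, τ, l⟩
  · rcases a with y | ⟨k, τ, l⟩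
    · rcases h with h | h | h | h
      · exact absurd h.2.2 (Event.not_sb_init _ x)
      · exact absurd (G.rf_type _ _ h).2 (Event.not_isR_init x)
      · obtain ⟨z, ⟨⟩, ⟨⟩⟩ := (G.mo_type _ _ h).2.2
        exact absurd h (G.mo_irrefl _)
      · obtain ⟨w, hw, -⟩ := h.1
        exact absurd (G.rf_type _ _ hw).2 (Event.not_isR_init y)
    · have hpo : G.po (.init x) (.ev k τ l) := ⟨G.wf.init_mem x, (G.scStep_mem h).1, trivial⟩
      exact absurd (.tail (.single (Or.inl hpo)) h) (hG _)
  · exact id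

theorem EGraph.exists_linearization [Finite Tid] (hG : G ∈ GSC Tid L) (hf : G.Fair)
    {β : Behavior Tid L} (hE : eventsOf Loc β = G.E) :
    ∃ h, histBeh h = β ∧ ∀ a b, G.scStep a b → time h a < time h b := by
  have finite_pred : ∀ b, {a | Relation.ReflTransGen (NonInit G.scStep) a b}.Finite :=
    finite_prefix_of_acyclic G.wf (fun _ _ => G.scStep_mem) (fun a ha b hb h => Or.inl ⟨ha, hb, h⟩)
      hG fun b _ => (((G.wf.finite_sb b).union (G.rf_prefixFinite b)).union
        ((hf.1 b).union (hf.2 b))).subset fun a ha => by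
          rcases ha with ⟨h | h | h | h, hi⟩
          · exact Or.inl (Or.inl ⟨h.1, h.2.2, hi⟩)
          · exact Or.inl (Or.inr h)
          · exact Or.inr (Or.inl h)
          · exact Or.inr (Or.inr h)
  have acyclic : Acyclic (NonInit G.scStep) := fun a ha =>
    hG a (Relation.TransGen.mono (fun _ _ h => h.1) _ _ ha)
  obtain ⟨rank, inj, mono⟩ := exists_rank G.wf.countable_nonInit
    (fun a b h => ⟨⟨(G.scStep_mem h.1).1, h.2.1⟩, (G.scStep_mem h.1).2, h.2.2⟩) acyclic finite_pred
  have mono_sb : ∀ a b, a ∈ G.E → b ∈ G.E → ¬ a.IsInit → a.Sb b → rank a < rank b :=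
    fun a b ha hb hai hsb =>
      have hab : G.scStep a b := Or.inl ⟨ha, hb, hsb⟩
      mono a b ⟨hab, hai, not_isInit_of_scStep hG hab⟩
  rw [← hE] at inj mono_sb
  refine ⟨rankHist β rank, histBeh_rankHist inj mono_sb, fun a b hab => ?_⟩
  have hbi := not_isInit_of_scStep hG hab
  obtain ⟨ha, hb⟩ := hE ▸ G.scStep_mem hab
  rw [(occursAt_rankHist inj mono_sb hb hbi).time_eq]
  by_cases hai : a.IsInit
  · cases a with
    | init x => simp
    | ev => exact hai.elim
  · rw [(occursAt_rankHist inj mono_sb ha hai).time_eq]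
    exact Nat.succ_lt_succ (mono a b ⟨hab, hai, hbi⟩)

theorem readsLastWrites_of_linearization {h : ℕ → Option (Tid × L)}
    (hE : eventsOf Loc (histBeh h) = G.E) (hlin : ∀ a b, G.scStep a b → time h a < time h b) :
    ReadsLastWrites (Loc := Loc) h := by
  intro n r x hr hR hx
  obtain ⟨w, hrf⟩ := G.rf_total r (hE ▸ hr.mem) hR
  obtain ⟨last_mem, last_isW, last_loc, last_time⟩ := lastWrite_spec h n x
  have time_r : time h r = n + 1 := hr.time_eq
  have time_w : time h w ≤ n := by
    have := hlin w r (Or.inr (Or.inl hrf))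
    lia
  have hwx : w.loc = some x := (G.rf_loc w r hrf).trans hx
  have hw := (G.rf_mem w r hrf).1
  have hwW := (G.rf_type w r hrf).1
  suffices w = lastWrite h n x from this ▸ G.rf_val w r hrf
  by_contra hne
  rcases G.mo_total w hw _ (hE ▸ last_mem) hwW last_isW ⟨x, hwx, last_loc⟩ hne with hmo | hmo
  · have hfr : G.fr r (lastWrite h n x) := ⟨⟨w, hrf, hmo⟩, fun heq => by rw [heq] at time_r; lia⟩
    have := hlin _ _ (Or.inr (Or.inr (Or.inr hfr)))
    lia
  · exact (hlin _ _ (Or.inr (Or.inr (Or.inl hmo)))).not_ge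
      (time_le_time_lastWrite (hE ▸ hw) hwW hwx time_w)

theorem mem_BehMF_MSC_of_mem_GSC [Finite Tid] {β : Behavior Tid L} (hG : G ∈ GSC Tid L)
    (hf : G.Fair) (hE : eventsOf Loc β = G.E) : β ∈ (MSC Tid Loc Val L).BehMF := by
  obtain ⟨h, rfl, hlin⟩ := EGraph.exists_linearization hG hf hE
  exact mem_BehMF_MSC_iff.2 ⟨h, rfl, readsLastWrites_of_linearization hE hlin⟩

end Linearization

/-! ### Sequential consistency implies RC11 consistency -/

namespace EGraph

variable {Tid Loc Val : Type*} [Zero Val] {G : EGraph Tid (CLab Loc Val)}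
  {a b : Event Tid Loc (CLab Loc Val)}

theorem hbSC_of_transGen {R : Event Tid Loc (CLab Loc Val) → Event Tid Loc (CLab Loc Val) → Prop}
    (hR : ∀ a b, R a b → G.hbSC a b) (h : Relation.TransGen R a b) : G.hbSC a b := by
  induction h with
  | single h => exact hR _ _ h
  | tail _ h ih => exact ih.trans (hR _ _ h)

theorem hbSC_of_po (h : G.po a b) : G.hbSC a b := .single (Or.inl h)
theorem hbSC_of_rf (h : G.rf a b) : G.hbSC a b := .single (Or.inr (Or.inl h))
theorem hbSC_of_mo (h : G.mo a b) : G.hbSC a b := .single (Or.inr (Or.inr (Or.inl h)))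
theorem hbSC_of_fr (h : G.fr a b) : G.hbSC a b := .single (Or.inr (Or.inr (Or.inr h)))

theorem hbSC_of_eco (h : G.eco a b) : G.hbSC a b :=
  hbSC_of_transGen (fun _ _ h => .single (Or.inr h)) h

theorem reflTransGen_scStep_of_rs (h : G.rs a b) : Relation.ReflTransGen G.scStep a b := by
  obtain ⟨-, -, c, hac, -, -, hcb⟩ := h
  have hcb' : Relation.ReflTransGen G.scStep c b :=
    Relation.ReflTransGen.mono (fun _ _ h => Or.inr (Or.inl h.1)) _ _ hcb
  rcases hac with rfl | hac
  · exact hcb'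
  · exact hcb'.head (Or.inl hac.1)

theorem hbSC_of_sw (h : G.sw a b) : G.hbSC a b := by
  obtain ⟨-, -, w, w', r, haw, hrs, hrf, -, hrb⟩ := h
  have from_a : Relation.ReflTransGen G.scStep a w' := by
    rcases haw with rfl | haw
    · exact reflTransGen_scStep_of_rs hrs
    · exact (reflTransGen_scStep_of_rs hrs).head (Or.inl haw.2)
  have to_r : G.hbSC a r := .tail' from_a (Or.inr (Or.inl hrf))
  rcases hrb with rfl | hrb
  · exact to_r
  · exact to_r.tail (Or.inl hrb.1)

theorem hbSC_of_hbRC11 (h : G.hbRC11 a b) : G.hbSC a b :=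
  hbSC_of_transGen (fun _ _ h => h.elim hbSC_of_po hbSC_of_sw) h

theorem hbSC_of_scb (h : G.scb a b) : G.hbSC a b := by
  rcases h with h | ⟨c, d, hac, hcd, hdb⟩ | h | h | h
  · exact hbSC_of_po h
  · exact ((hbSC_of_po hac.1).trans (hbSC_of_hbRC11 hcd)).trans (hbSC_of_po hdb.1)
  · exact hbSC_of_hbRC11 h.1
  · exact hbSC_of_mo h
  · exact hbSC_of_fr h

theorem hbSC_of_pscBase (h : G.pscBase a b) : G.hbSC a b := by
  obtain ⟨-, -, c, d, hac, hcd, hdb⟩ := h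
  have to_b : G.hbSC c b := by
    rcases hdb with rfl | hdb
    · exact hbSC_of_scb hcd
    · exact (hbSC_of_scb hcd).trans (hbSC_of_hbRC11 hdb.1)
  rcases hac with rfl | hac
  · exact to_b
  · exact (hbSC_of_hbRC11 hac.2).trans to_b

theorem hbSC_of_pscF (h : G.pscF a b) : G.hbSC a b := by
  obtain ⟨-, -, -, -, h | ⟨c, d, hac, hcd, hdb⟩⟩ := h
  · exact hbSC_of_hbRC11 h
  · exact ((hbSC_of_hbRC11 hac).trans (hbSC_of_eco hcd)).trans (hbSC_of_hbRC11 hdb)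

end EGraph

open EGraph in
theorem GSC_subset_GRC11 {Tid Loc Val : Type*} [Zero Val] :
    GSC Tid (CLab Loc Val) ⊆ GRC11 Tid Loc Val := by
  intro G hG
  refine ⟨fun a h => hG a (hbSC_of_hbRC11 h),
    fun a b h h' => hG a ((hbSC_of_hbRC11 h).trans (hbSC_of_eco h')),
    fun a h => hG a (hbSC_of_eco h),
    fun a h => hG a (hbSC_of_transGen (fun _ _ h => h.elim hbSC_of_pscBase hbSC_of_pscF) h),
    fun a h => hG a (hbSC_of_transGen (fun _ _ h => h.elim hbSC_of_po hbSC_of_rf) h)⟩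

/-! ### Simulating sequential consistency -/

section Blocks

universe u v w w' x

/-- The concatenation of blocks of length `d`: position `i` of block `n` comes at index
`d * n + i`. -/
def concatBlocks {α : Type*} (d : ℕ) (f : ℕ → ℕ → α) (k : ℕ) : α := f (k / d) (k % d)

theorem concatBlocks_mul {α : Type*} {d : ℕ} (hd : 0 < d) (f : ℕ → ℕ → α) (n : ℕ) :
    concatBlocks d f (d * n) = f n 0 := by
  rw [concatBlocks, Nat.mul_div_cancel_left n hd, Nat.mul_mod_right]

theorem concatBlocks_succ {α : Type*} {d : ℕ} (hd : 0 < d) {f : ℕ → ℕ → α}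
    (hf : ∀ n, f (n + 1) 0 = f n d) (k : ℕ) :
    concatBlocks d f (k + 1) = f (k / d) (k % d + 1) := by
  have mod_lt := Nat.mod_lt k hd
  have div_add_mod := Nat.div_add_mod k d
  unfold concatBlocks
  rcases Nat.lt_or_ge (k % d + 1) d with hlt | hge
  · obtain ⟨hdiv, hmod⟩ := (Nat.div_mod_unique hd).2 ⟨show k % d + 1 + d * (k / d) = k + 1 by omega,
      hlt⟩
    rw [hdiv, hmod]
  · obtain ⟨hdiv, hmod⟩ := (Nat.div_mod_unique hd).2
      ⟨show 0 + d * (k / d + 1) = k + 1 by rw [Nat.mul_add]; omega, hd⟩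
    rw [hdiv, hmod, hf, show k % d + 1 = d by omega]

variable {Tid : Type u} {L : Type v} {T : Type x}

theorem histBeh_concatBlocks {d : ℕ} (hd : 0 < d) {h : ℕ → ℕ → Option (Tid × L)}
    (hh : ∀ n i, h n (i + 1) = none) :
    histBeh (concatBlocks d h) = histBeh fun n => h n 0 := by
  funext τ
  refine reduceOption_reindex (φ := fun n => d * n)
    (fun _ _ _ _ hij => Nat.mul_lt_mul_of_pos_left hij hd) fun k a => ?_
  simp only [threadHist_eq_some]
  constructor
  · intro hk
    unfold concatBlocks at hk
    rcases hmod : k % d with _ | i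
    · exact ⟨k / d, by rwa [hmod] at hk, Nat.mul_div_cancel' (Nat.dvd_of_mod_eq_zero hmod)⟩
    · simp [hmod, hh] at hk
  · rintro ⟨n, hn, rfl⟩
    rwa [concatBlocks_mul hd]

/-- `t'` is `t` or results from `t` by a silent step. -/
def LTS.IdleOrSilent {S : Type*} (B : LTS.{_, x, w'} S T) (t t' : B.Q) : Prop :=
  t' = t ∨ ∃ θ, B.step t (Sum.inr θ) t'

/-- A piece of a stuttering run with states `p` and labels `a`: the observation `o` (possibly
`none`), followed by `c` silent or idle steps. -/
structure IsBlock (B : LTS.{max u v, x, w'} (Tid × L) T) (c : ℕ) (o : Option (Tid × L))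
    (p : ℕ → B.Q) (a : ℕ → Option ((Tid × L) ⊕ T)) : Prop where
  step : ∀ i < c + 1, ∀ σ, a i = some σ → B.step (p i) σ (p (i + 1))
  idle : ∀ i < c + 1, a i = none → p (i + 1) = p i
  obs_zero : obsHist a 0 = o
  obs_succ : ∀ i, obsHist a (i + 1) = none

variable {A : LTS.{max u v, 0, w} (Tid × L) Empty} {B : LTS.{max u v, x, w'} (Tid × L) T} {c : ℕ}

theorem exists_isBlock_none (t : B.Q) :
    ∃ p a, p 0 = t ∧ p (c + 1) = t ∧ IsBlock B c none p a :=
  ⟨fun _ => t, fun _ => none, rfl, rfl, fun _ _ _ h => by simp at h, fun _ _ _ => rfl, rfl,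
    fun _ => rfl⟩

theorem exists_isBlock_some {σ : Tid × L} {t : B.Q} {p : ℕ → B.Q} (h : B.step t (Sum.inl σ) (p 0))
    (hp : ∀ i < c, B.IdleOrSilent (p i) (p (i + 1))) :
    ∃ p' a, p' 0 = t ∧ p' (c + 1) = p c ∧ IsBlock B c (some σ) p' a := by
  have labels : ∀ i, ∃ m : Option T, i < c →
      (∀ θ, m = some θ → B.step (p i) (Sum.inr θ) (p (i + 1)))
      ∧ (m = none → p (i + 1) = p i) := fun i => by
    by_cases hi : i < c
    · rcases hp i hi with heq | ⟨θ, hθ⟩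
      · exact ⟨none, fun _ => ⟨by simp, fun _ => heq⟩⟩
      · exact ⟨some θ, fun _ => ⟨by simpa using hθ, by simp⟩⟩
    · exact ⟨none, fun h => absurd h hi⟩
  choose m hm using labels
  refine ⟨fun i => i.casesOn t p, fun i => i.casesOn (some (Sum.inl σ)) fun j => (m j).map Sum.inr,
    rfl, rfl, ?_, ?_, rfl, fun i => ?_⟩
  · rintro (_ | i) hi σ' hσ'
    · cases hσ'
      exact h
    · obtain ⟨θ, hθ, rfl⟩ := Option.map_eq_some_iff.1 hσ'
      exact (hm i (by omega)).1 θ hθ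
  · rintro (_ | i) hi hn
    · simp at hn
    · exact (hm i (by omega)).2 (Option.map_eq_none_iff.1 hn)
  · change ((m i).map Sum.inr).bind Sum.getLeft? = none
    cases m i <;> rfl

theorem stutterRun_concatBlocks {o : ℕ → Option (Tid × L)} {path : ℕ → ℕ → B.Q}
    {act : ℕ → ℕ → Option ((Tid × L) ⊕ T)} (hinit : path 0 0 = B.init)
    (hpath : ∀ n, path (n + 1) 0 = path n (c + 1))
    (hblock : ∀ n, IsBlock B c (o n) (path n) (act n)) :
    StutterRun B (concatBlocks (c + 1) path) (concatBlocks (c + 1) act) where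
  init := by simpa [concatBlocks] using hinit
  step k σ hσ := by
    rw [concatBlocks_succ c.succ_pos hpath]
    exact (hblock _).step _ (Nat.mod_lt _ c.succ_pos) σ hσ
  idle k hk := by
    rw [concatBlocks_succ c.succ_pos hpath]
    exact (hblock _).idle _ (Nat.mod_lt _ c.succ_pos) hk

/-- A simulation relation between a memory system without silent steps and `B`: a step is simulated
by a step with the same label followed by at most `c` silent steps, after which no silent step is
enabled. -/
structure QuietSimulation (A : LTS.{max u v, 0, w} (Tid × L) Empty)
    (B : LTS.{max u v, x, w'} (Tid × L) T) (I : A.Q → B.Q → Prop) (c : ℕ) : Prop where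
  init : I A.init B.init
  quiet : ∀ s t, I s t → ∀ θ, ¬ B.Enabled (Sum.inr θ) t
  step : ∀ s t σ s', I s t → A.step s (Sum.inl σ) s' → ∃ p : ℕ → B.Q,
    B.step t (Sum.inl σ) (p 0) ∧ (∀ i < c, B.IdleOrSilent (p i) (p (i + 1))) ∧ I s' (p c)

theorem QuietSimulation.BehMF_subset {I : A.Q → B.Q → Prop} (h : QuietSimulation A B I c) :
    A.BehMF ⊆ B.BehMF := by
  intro β hβ
  obtain ⟨q, l, run, rfl, -⟩ := LTS.exists_stutterRun_of_mem_BehMF hβ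
  have blocks : ∀ n (t : {t // I (q n) t}), ∃ p a, p 0 = t.1 ∧ I (q (n + 1)) (p (c + 1)) ∧
      IsBlock B c (obsHist l n) p a := by
    rintro n ⟨t, ht⟩
    rcases hl : l n with _ | (σ | e)
    · obtain ⟨p, a, hp, hpc, hpa⟩ := exists_isBlock_none (c := c) t
      exact ⟨p, a, hp, by rwa [run.idle n hl, hpc], by rwa [obsHist, hl]⟩
    · obtain ⟨p, h_obs, h_silent, hI⟩ := h.step _ t σ _ ht (run.step n _ hl)
      obtain ⟨p', a, hp, hpc, hpa⟩ := exists_isBlock_some h_obs h_silent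
      exact ⟨p', a, hp, by rwa [hpc], by rwa [obsHist, hl]⟩
    · exact e.elim
  choose p a hp0 hpI hpa using blocks
  let t : ∀ n, {t // I (q n) t} := fun n =>
    Nat.rec ⟨B.init, by rw [run.init]; exact h.init⟩ (fun n t => ⟨p n t (c + 1), hpI n t⟩) n
  have run' := stutterRun_concatBlocks (path := fun n => p n (t n)) (act := fun n => a n (t n))
    (hp0 0 (t 0)) (fun n => hp0 (n + 1) (t (n + 1))) fun n => hpa n (t n)
  have fair : StutterFair B (concatBlocks (c + 1) fun n => p n (t n))
      (concatBlocks (c + 1) fun n => a n (t n)) := fun θ k enabled => by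
    have := enabled ((c + 1) * k) (Nat.le_mul_of_pos_left k c.succ_pos)
    rw [concatBlocks_mul c.succ_pos, hp0] at this
    exact absurd this (h.quiet _ _ (t k).2 θ)
  have obs_eq : histBeh (obsHist (concatBlocks (c + 1) fun n => a n (t n))) = histBeh (obsHist l) :=
    (histBeh_concatBlocks c.succ_pos fun n i => (hpa n (t n)).obs_succ i).trans
      (congrArg histBeh (funext fun n => (hpa n (t n)).obs_zero))
  exact obs_eq ▸ run'.mem_BehMF fair

end Blocks

section Simulations

variable {Tid Loc Val : Type*}

theorem BehMF_MSC_subset_MTSO [Zero Val] :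
    (MSC Tid Loc Val (ELab Loc Val)).BehMF ⊆ (MTSO Tid Loc Val).BehMF := by
  classical
  refine QuietSimulation.BehMF_subset (A := MSC Tid Loc Val (ELab Loc Val)) (B := MTSO Tid Loc Val)
    (I := fun s t => t = (s, fun _ => [])) (c := 1) ⟨rfl, ?_, ?_⟩
  · rintro s t rfl τ ⟨-, b, x, v, hb, -⟩
    simp at hb
  · rintro s t ⟨τ, ⟨x, v⟩ | ⟨x, v⟩ | ⟨x, v, v'⟩⟩ s' rfl step
    · obtain ⟨hv, rfl⟩ := step
      exact ⟨fun _ => (s', fun _ => []), ⟨hv, rfl⟩, fun _ _ => Or.inl rfl, rfl⟩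
    · obtain rfl : s' = Function.update s x v := step
      refine ⟨fun i => if i = 0 then (s, Function.update (fun _ => []) τ [(x, v)]) else
        (Function.update s x v, fun _ => []), rfl, fun i hi => Or.inr ⟨τ, [], x, v, ?_⟩, rfl⟩
      obtain rfl : i = 0 := by omega
      simp
    · obtain ⟨hv, rfl⟩ := step
      exact ⟨fun _ => (Function.update s x v', fun _ => []), ⟨rfl, hv, rfl⟩, fun _ _ => Or.inl rfl,
        rfl⟩

/-- All threads have the view `V`, which is an upper bound of the messages, and the memory `s`
holds the values of the newest messages. -/
structure ViewSynced (s : Loc → Val) (V : View Loc) (t : ViewState Tid Loc Val) : Prop where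
  view_eq : ∀ τ, t.2 τ = V
  le : ∀ m ∈ t.1, m.ts ≤ V m.loc ∧ m.view ≤ V
  newest : ∀ x, ∃ m ∈ t.1, m.loc = x ∧ m.val = s x ∧ m.ts = V x

variable {upd : View Loc → Msg Loc Val → View Loc} {s : Loc → Val} {V : View Loc}
  {t : ViewState Tid Loc Val}

section Write

open Classical in
/-- The view `V` after a write to `x` with the next timestamp. -/
noncomputable def nextView (V : View Loc) (x : Loc) : View Loc := Function.update V x (V x + 1)

/-- The message of a write to `x` with the next timestamp. -/
noncomputable def nextMsg (V : View Loc) (x : Loc) (v : Val) : Msg Loc Val :=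
  ⟨x, v, V x + 1, nextView V x⟩

open Classical in
/-- The state after a write by a thread with view `V` in which exactly the threads in `S` know of
it. -/
noncomputable def writtenState (ms : Set (Msg Loc Val)) (V : View Loc) (x : Loc) (v : Val)
    (S : Set Tid) : ViewState Tid Loc Val :=
  (ms ∪ {nextMsg V x v}, S.piecewise (fun _ => nextView V x) fun _ => V)

theorem le_nextView (V : View Loc) (x : Loc) : V ≤ nextView V x := by
  classical
  exact le_update_iff.2 ⟨Nat.le_succ _, fun _ _ => le_rfl⟩

theorem ViewSynced.viewWrite (ht : ViewSynced s V t) (τ : Tid) (x : Loc) (v : Val) :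
    viewWrite τ x v t (writtenState t.1 V x v {τ}) := by
  classical
  refine ⟨V x + 1, ?_, ?_, ?_, ?_⟩
  · rintro ⟨m, hm, rfl, hts⟩
    have := (ht.le m hm).1
    omega
  · rw [ht.view_eq]
    exact Nat.lt_succ_self _
  · rw [funext ht.view_eq]
    exact (Set.piecewise_singleton _ _ _).trans (by congr)
  · simp [writtenState, nextMsg]

theorem idleOrSilent_writtenState [Zero Val] (ms : Set (Msg Loc Val)) (V : View Loc) (x : Loc)
    (v : Val) (S : Set Tid) (τ : Tid) :
    (viewMem upd).IdleOrSilent (writtenState ms V x v S) (writtenState ms V x v (insert τ S)) := by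
  classical
  by_cases hτ : τ ∈ S
  · rw [Set.insert_eq_of_mem hτ]
    exact Or.inl rfl
  · refine Or.inr ⟨(τ, nextMsg V x v), Or.inr rfl, ?_, Prod.ext rfl ?_⟩
    · simp [writtenState, hτ, nextMsg]
    · simp only [writtenState, Set.piecewise_insert, Set.piecewise_eq_of_notMem _ _ _ hτ]
      congr

theorem ViewSynced.writtenState_univ (ht : ViewSynced s V t) (x : Loc) (v : Val) [DecidableEq Loc] :
    ViewSynced (Tid := Tid) (Function.update s x v) (nextView V x)
      (writtenState t.1 V x v Set.univ) where
  view_eq τ := by simp [writtenState]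
  le := by
    rintro m (hm | rfl)
    · exact ⟨(ht.le m hm).1.trans (le_nextView V x _), (ht.le m hm).2.trans (le_nextView V x)⟩
    · exact ⟨by simp [nextMsg, nextView], le_rfl⟩
  newest y := by
    by_cases hy : y = x
    · subst hy
      exact ⟨nextMsg V y v, Or.inr rfl, rfl, by simp [nextMsg], by simp [nextMsg, nextView]⟩
    · obtain ⟨m, hm, hloc, hval, hts⟩ := ht.newest y
      exact ⟨m, Or.inl hm, hloc, by simp [hy, hval], by simp [nextView, hy, hts]⟩

theorem exists_writtenState_path [Finite Tid] [Zero Val] (ms : Set (Msg Loc Val)) (V : View Loc)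
    (x : Loc) (v : Val) (τ : Tid) :
    ∃ p : ℕ → ViewState Tid Loc Val, p 0 = writtenState ms V x v {τ} ∧
      (∀ i < Nat.card Tid, (viewMem upd).IdleOrSilent (p i) (p (i + 1))) ∧
      p (Nat.card Tid) = writtenState ms V x v Set.univ := by
  let e := Finite.equivFin Tid
  refine ⟨fun i => writtenState ms V x v (insert τ {τ' | (e τ' : ℕ) < i}), by simp, fun i hi => ?_,
    by simp⟩
  have insert_eq : insert τ {τ' | (e τ' : ℕ) < i + 1} =
      insert (e.symm ⟨i, hi⟩) (insert τ {τ' | (e τ' : ℕ) < i}) := by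
    ext τ'
    simp only [Set.mem_insert_iff, Set.mem_ofPred_eq, Equiv.eq_symm_apply, Fin.ext_iff,
      Nat.lt_succ_iff_lt_or_eq]
    tauto
  simp only [insert_eq]
  exact idleOrSilent_writtenState ms V x v _ _

end Write

theorem ViewSynced.viewRead (hupd : ∀ V m, m.ts = V m.loc → m.view ≤ V → upd V m = V)
    (ht : ViewSynced s V t) (τ : Tid) (x : Loc) : viewRead upd τ x (s x) t t := by
  classical
  obtain ⟨m, hm, rfl, hval, hts⟩ := ht.newest x
  refine ⟨m, hm, rfl, hval, by rw [ht.view_eq, hts], Prod.ext rfl ?_⟩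
  rw [ht.view_eq, hupd V m hts (ht.le m hm).2, Function.update_eq_self_iff.2 (ht.view_eq τ).symm]

theorem BehMF_MSC_subset_viewMem [Finite Tid] [Zero Val]
    (hupd : ∀ V m, m.ts = V m.loc → m.view ≤ V → upd V m = V) :
    (MSC Tid Loc Val (ELab Loc Val)).BehMF ⊆
      (viewMem upd : LTS (Tid × ELab Loc Val) _).BehMF := by
  classical
  refine QuietSimulation.BehMF_subset (A := MSC Tid Loc Val (ELab Loc Val)) (B := viewMem upd)
    (I := fun s t => ∃ V, ViewSynced s V t) (c := Nat.card Tid) ⟨⟨fun _ => 0, fun _ => rfl, ?_,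
      fun x => ⟨_, ⟨x, rfl⟩, rfl, rfl, rfl⟩⟩, ?_, ?_⟩
  · rintro m ⟨x, rfl⟩
    exact ⟨le_rfl, le_rfl⟩
  · rintro s t ⟨V, ht⟩ ⟨τ, m⟩ ⟨-, hm, hlt, -⟩
    rw [ht.view_eq] at hlt
    exact absurd (ht.le m hm).1 hlt.not_ge
  · rintro s t ⟨τ, ⟨x, v⟩ | ⟨x, v⟩ | ⟨x, v, v'⟩⟩ s' ⟨V, ht⟩ step
    · obtain ⟨rfl, rfl⟩ := step
      exact ⟨fun _ => t, ht.viewRead hupd τ x, fun _ _ => Or.inl rfl, V, ht⟩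
    · obtain rfl : s' = Function.update s x v := step
      obtain ⟨p, hp0, hp, hpc⟩ := exists_writtenState_path (upd := upd) t.1 V x v τ
      exact ⟨p, hp0 ▸ ht.viewWrite τ x v, hp, _, hpc ▸ ht.writtenState_univ x v⟩
    · obtain ⟨rfl, rfl⟩ := step
      obtain ⟨p, hp0, hp, hpc⟩ := exists_writtenState_path (upd := upd) t.1 V x v' τ
      refine ⟨p, hp0 ▸ ⟨t, ht.viewRead hupd τ x, ht.viewWrite τ x v', ?_⟩, hp, _,
        hpc ▸ ht.writtenState_univ x v'⟩
      simp [writtenState, nextView, ht.view_eq]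

theorem BehMF_MSC_subset_MRA [Finite Tid] [Zero Val] :
    (MSC Tid Loc Val (ELab Loc Val)).BehMF ⊆ (MRA Tid Loc Val).BehMF :=
  BehMF_MSC_subset_viewMem fun _ _ _ h => sup_eq_left.2 h

theorem BehMF_MSC_subset_MStrongCOH [Finite Tid] [Zero Val] :
    (MSC Tid Loc Val (ELab Loc Val)).BehMF ⊆ (MStrongCOH Tid Loc Val).BehMF :=
  BehMF_MSC_subset_viewMem fun V m h _ => by simp [h]

end Simulations

/-! ### Graphs of runs of the timestamp-based memory systems -/

section ViewSteps

variable {Tid Loc Val : Type*} {upd : View Loc → Msg Loc Val → View Loc}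

/-- The properties of the update of a view by the message read that hold of both `MRA` and
`MStrongCOH`. -/
structure IsViewUpdate (upd : View Loc → Msg Loc Val → View Loc) : Prop where
  le : ∀ V m, V m.loc ≤ m.ts → V ≤ upd V m
  at_loc : ∀ V m, m.view m.loc = m.ts → V m.loc ≤ m.ts → upd V m m.loc = m.ts

theorem isViewUpdate_sup :
    IsViewUpdate fun (V : View Loc) (m : Msg Loc Val) => V ⊔ m.view where
  le _ _ _ := le_sup_left
  at_loc V m h h' := by rw [Pi.sup_apply, h, sup_eq_right.2 h']

open Classical in
theorem isViewUpdate_update :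
    IsViewUpdate fun (V : View Loc) (m : Msg Loc Val) => Function.update V m.loc m.ts where
  le _ _ h := le_update_self_iff.2 h
  at_loc _ _ _ _ := Function.update_self ..

/-- The message for `x` with value `v` that carries the view of `τ`, as left by a write of `τ`. -/
def ownMsg (q : ViewState Tid Loc Val) (τ : Tid) (x : Loc) (v : Val) : Msg Loc Val :=
  ⟨x, v, q.2 τ x, q.2 τ⟩

variable {q q' : ViewState Tid Loc Val} {τ : Tid} {x : Loc} {v : Val}

theorem viewWrite.msgs_eq (h : viewWrite τ x v q q') : q'.1 = q.1 ∪ {ownMsg q' τ x v} := by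
  obtain ⟨t, -, -, h_view, h_msgs⟩ := h
  have : q'.2 τ x = t := by simp [h_view]
  rw [h_msgs, ownMsg, this]

theorem viewWrite.le (h : viewWrite τ x v q q') : q ≤ q' := by
  classical
  refine ⟨h.msgs_eq ▸ Set.subset_union_left, ?_⟩
  obtain ⟨t, -, hlt, h_view, -⟩ := h
  rw [h_view]
  exact le_update_self_iff.2 (le_update_self_iff.2 hlt.le)

theorem viewWrite.fresh (h : viewWrite τ x v q q') {m : Msg Loc Val} (hm : m ∈ q.1)
    (hx : m.loc = x) : m.ts ≠ q'.2 τ x := by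
  obtain ⟨t, hfresh, -, h_view, -⟩ := h
  have : q'.2 τ x = t := by simp [h_view]
  exact fun hts => hfresh ⟨m, hm, hx, hts.trans this⟩

theorem viewRead.msgs_eq (h : viewRead upd τ x v q q') : q'.1 = q.1 := by
  obtain ⟨m, -, -, -, -, rfl⟩ := h
  rfl

theorem viewRead.le (hu : IsViewUpdate upd) (h : viewRead upd τ x v q q') : q ≤ q' := by
  classical
  obtain ⟨m, -, rfl, -, hle, rfl⟩ := h
  exact ⟨le_rfl, le_update_self_iff.2 (hu.le _ _ hle)⟩

theorem viewRead.exists_msg (hu : IsViewUpdate upd) (hq : ∀ m ∈ q.1, m.view m.loc = m.ts)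
    (h : viewRead upd τ x v q q') :
    ∃ m ∈ q.1, m.loc = x ∧ m.val = v ∧ q'.2 τ x = m.ts ∧ upd (q.2 τ) m ≤ q'.2 τ := by
  obtain ⟨m, hm, rfl, rfl, hle, rfl⟩ := h
  refine ⟨m, hm, rfl, rfl, ?_, ?_⟩
  · simpa using hu.at_loc _ _ (hq m hm) hle
  · simp

variable [Zero Val]

theorem viewMem_step_le (hu : IsViewUpdate upd)
    {σ : (Tid × ELab Loc Val) ⊕ (Tid × Msg Loc Val)} (h : (viewMem upd).step q σ q') :
    q ≤ q' := by
  classical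
  rcases σ with ⟨τ, ⟨x, v⟩ | ⟨x, v⟩ | ⟨x, v, v'⟩⟩ | ⟨τ, m⟩
  · exact viewRead.le hu h
  · exact viewWrite.le h
  · obtain ⟨q₁, hr, hw, -⟩ := h
    exact (hr.le hu).trans hw.le
  · obtain ⟨-, hlt, rfl⟩ := h
    exact ⟨le_rfl, le_update_self_iff.2 (le_update_self_iff.2 hlt.le)⟩

theorem viewMem_step_write {a : ELab Loc Val} (h : (viewMem upd).step q (Sum.inl (τ, a)) q')
    (hv : a.valW = some v) : ∃ q₁, q₁.1 = q.1 ∧ viewWrite τ a.loc v q₁ q' := by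
  rcases a with ⟨x, w⟩ | ⟨x, w⟩ | ⟨x, w, w'⟩ <;> cases hv
  · exact ⟨q, rfl, h⟩
  · obtain ⟨q₁, hr, hw, -⟩ := h
    exact ⟨q₁, hr.msgs_eq, hw⟩

theorem viewMem_step_msgs {σ : (Tid × ELab Loc Val) ⊕ (Tid × Msg Loc Val)}
    (h : (viewMem upd).step q σ q') {m : Msg Loc Val} (hm : m ∈ q'.1) :
    m ∈ q.1 ∨ ∃ τ a v, σ = Sum.inl (τ, a) ∧ a.valW = some v ∧ m = ownMsg q' τ a.loc v := by
  rcases σ with ⟨τ, a⟩ | ⟨τ, p⟩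
  · rcases hv : a.valW with _ | v
    · obtain ⟨x, w, rfl⟩ : ∃ x w, a = .read x w := by
        rcases a with ⟨x, w⟩ | ⟨x, w⟩ | ⟨x, w, w'⟩ <;> cases hv
        exact ⟨x, w, rfl⟩
      exact Or.inl (viewRead.msgs_eq h ▸ hm)
    · obtain ⟨q₁, hq₁, hw⟩ := viewMem_step_write h hv
      rw [hw.msgs_eq, hq₁] at hm
      exact hm.imp_right fun hm => ⟨τ, a, v, rfl, hv, hm⟩
  · obtain ⟨-, -, rfl⟩ := h
    exact Or.inl hm

theorem viewMem_step_read (hu : IsViewUpdate upd) (hq : ∀ m ∈ q.1, m.view m.loc = m.ts)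
    {a : ELab Loc Val} (h : (viewMem upd).step q (Sum.inl (τ, a)) q') (hv : a.valR = some v) :
    ∃ m ∈ q.1, m.loc = a.loc ∧ m.val = v ∧
      (q'.2 τ a.loc = m.ts ∨ (a.valW.isSome ∧ q'.2 τ a.loc = m.ts + 1)) ∧
      upd (q.2 τ) m ≤ q'.2 τ := by
  rcases a with ⟨x, w⟩ | ⟨x, w⟩ | ⟨x, w, w'⟩ <;> cases hv
  · obtain ⟨m, hm, hloc, hval, hts, hle⟩ := viewRead.exists_msg hu hq h
    exact ⟨m, hm, hloc, hval, Or.inl hts, hle⟩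
  · obtain ⟨q₁, hr, hw, hnext⟩ := h
    obtain ⟨m, hm, hloc, hval, hts, hle⟩ := viewRead.exists_msg hu hq hr
    exact ⟨m, hm, hloc, hval, Or.inr ⟨rfl, hts ▸ hnext⟩, hle.trans (hw.le.2 τ)⟩

end ViewSteps

section ViewRuns

variable {Tid Loc Val : Type*} {upd : View Loc → Msg Loc Val → View Loc}
  {q : ℕ → ViewState Tid Loc Val} {h : ℕ → Option (Tid × ELab Loc Val)}
  {l : ℕ → Option ((Tid × ELab Loc Val) ⊕ (Tid × Msg Loc Val))}
  {a b e w : Event Tid Loc (ELab Loc Val)} {τ : Tid} {c : ELab Loc Val} {n : ℕ}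

/-- The view of the thread of an event right after the event. -/
noncomputable def viewAfter (q : ℕ → ViewState Tid Loc Val) (h : ℕ → Option (Tid × ELab Loc Val)) :
    Event Tid Loc (ELab Loc Val) → View Loc
  | .init _ => 0
  | .ev k τ a => (q (time h (.ev k τ a : Event Tid Loc (ELab Loc Val)))).2 τ

/-- The timestamp written by an event or, if it only reads, read by it. -/
noncomputable def stamp (q : ℕ → ViewState Tid Loc Val) (h : ℕ → Option (Tid × ELab Loc Val)) :
    Event Tid Loc (ELab Loc Val) → ℕ
  | .init _ => 0
  | .ev k τ a => viewAfter q h (.ev k τ a) a.loc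

theorem viewAfter_ev (hn : h n = some (τ, c)) :
    viewAfter q h (.ev (countSome (threadHist h τ) n) τ c) = (q (n + 1)).2 τ := by
  rw [viewAfter, OccursAt.time_eq ⟨τ, c, hn, rfl⟩]

theorem stamp_ev (hn : h n = some (τ, c)) :
    stamp q h (.ev (countSome (threadHist h τ) n) τ c) = (q (n + 1)).2 τ c.loc := by
  rw [stamp, viewAfter_ev hn]

variable [Zero Val]

theorem viewAfter_loc {x : Loc} (hx : e.loc = some x) : viewAfter q h e x = stamp q h e := by
  cases e <;> cases hx <;> rfl

theorem StutterRun.msg_view (run : StutterRun (viewMem upd) q l) (n : ℕ) :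
    ∀ m ∈ (q n).1, m.view m.loc = m.ts := by
  induction n with
  | zero =>
    rw [run.init]
    rintro m ⟨x, rfl⟩
    rfl
  | succ n ih =>
    intro m hm
    rcases hl : l n with _ | σ
    · exact ih m (run.idle n hl ▸ hm)
    · rcases viewMem_step_msgs (run.step n σ hl) hm with hm | ⟨τ, a, v, -, -, rfl⟩
      · exact ih m hm
      · rfl

theorem StutterRun.exists_event_of_msg (run : StutterRun (viewMem upd) q l) (n : ℕ) :
    ∀ m ∈ (q n).1, ∃ w ∈ eventsOf Loc (histBeh (obsHist l)), w.IsW ∧ w.loc = some m.loc ∧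
      w.valW = some m.val ∧ stamp q (obsHist l) w = m.ts ∧ viewAfter q (obsHist l) w = m.view ∧
      time (obsHist l) w ≤ n := by
  induction n with
  | zero =>
    rw [run.init]
    rintro m ⟨x, rfl⟩
    exact ⟨.init x, init_mem_eventsOf _ x, Event.isW_init x, rfl, rfl, rfl, rfl, (time_init x).le⟩
  | succ n ih =>
    intro m hm
    have old_or_new : m ∈ (q n).1 ∨ ∃ τ a v, l n = some (Sum.inl (τ, a)) ∧ a.valW = some v ∧
        m = ownMsg (q (n + 1)) τ a.loc v := by
      rcases hl : l n with _ | σ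
      · exact Or.inl (run.idle n hl ▸ hm)
      · simpa only [Option.some.injEq] using viewMem_step_msgs (run.step n σ hl) hm
    rcases old_or_new with hm | ⟨τ, a, v, hl, hv, rfl⟩
    · obtain ⟨w, hw, hW, hloc, hval, hts, hview, htime⟩ := ih m hm
      exact ⟨w, hw, hW, hloc, hval, hts, hview, htime.trans n.le_succ⟩
    · have hn := obsHist_eq_some.2 hl
      have occ : OccursAt (Loc := Loc) (obsHist l) n (.ev _ τ a) := ⟨τ, a, hn, rfl⟩
      exact ⟨_, occ.mem, Option.isSome_iff_exists.2 ⟨v, hv⟩, rfl, hv, stamp_ev hn, viewAfter_ev hn,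
        occ.time_eq.le⟩

namespace IsViewUpdate

variable (hu : IsViewUpdate upd) (run : StutterRun (viewMem upd) q l)
include hu run

theorem monotone : Monotone q := by
  refine monotone_nat_of_le_succ fun n => ?_
  rcases hl : l n with _ | σ
  · rw [show q (n + 1) = q n from run.idle n hl]
  · exact viewMem_step_le hu (run.step n σ hl)

theorem exists_msg (hw : w ∈ eventsOf Loc (histBeh (obsHist l))) (hW : w.IsW)
    (hn : time (obsHist l) w ≤ n) :
    ∃ m ∈ (q n).1, w.loc = some m.loc ∧ m.ts = stamp q (obsHist l) w := by
  rcases mem_eventsOf_histBeh.1 hw with ⟨x, rfl⟩ | ⟨i, hi⟩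
  · refine ⟨⟨x, 0, 0, fun _ => 0⟩, (hu.monotone run (Nat.zero_le n)).1 ?_, rfl, rfl⟩
    rw [run.init]
    exact ⟨x, rfl⟩
  · rw [hi.time_eq] at hn
    obtain ⟨τ, a, hi, rfl⟩ := hi
    obtain ⟨v, hv⟩ := Option.isSome_iff_exists.1 hW
    obtain ⟨q₁, -, write⟩ := viewMem_step_write (run.step i _ (obsHist_eq_some.1 hi)) hv
    refine ⟨ownMsg (q (i + 1)) τ a.loc v, (hu.monotone run hn).1 ?_, rfl, (stamp_ev hi).symm⟩
    rw [write.msgs_eq]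
    exact Or.inr rfl

theorem stamp_ne_of_time_lt (ha : a ∈ eventsOf Loc (histBeh (obsHist l)))
    (hb : b ∈ eventsOf Loc (histBeh (obsHist l))) (haW : a.IsW) (hbW : b.IsW) (hl : a.SameLoc b)
    (hlt : time (obsHist l) a < time (obsHist l) b) :
    stamp q (obsHist l) a ≠ stamp q (obsHist l) b := by
  rcases mem_eventsOf_histBeh.1 hb with ⟨x, rfl⟩ | ⟨n, hn⟩
  · simp at hlt
  · rw [hn.time_eq] at hlt
    obtain ⟨m, hm, hx, hts⟩ := hu.exists_msg run ha haW (Nat.lt_succ_iff.1 hlt)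
    obtain ⟨τ, c, hn, rfl⟩ := hn
    obtain ⟨v, hv⟩ := Option.isSome_iff_exists.1 hbW
    obtain ⟨q₁, hq₁, write⟩ := viewMem_step_write (run.step n _ (obsHist_eq_some.1 hn)) hv
    obtain ⟨y, hy, hby⟩ := hl
    rw [← hts, stamp_ev hn]
    exact write.fresh (hq₁ ▸ hm) (Option.some.inj (hx.symm.trans (hy.trans hby.symm)))

theorem stamp_inj : ∀ a ∈ eventsOf Loc (histBeh (obsHist l)),
    ∀ b ∈ eventsOf Loc (histBeh (obsHist l)), a.IsW → b.IsW → a.SameLoc b →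
    stamp q (obsHist l) a = stamp q (obsHist l) b → a = b := by
  intro a ha b hb haW hbW hl hts
  rcases lt_trichotomy (time (obsHist l) a) (time (obsHist l) b) with hlt | heq | hlt
  · exact absurd hts (hu.stamp_ne_of_time_lt run ha hb haW hbW hl hlt)
  · exact eq_of_time_eq ha hb hl heq
  · exact absurd hts.symm (hu.stamp_ne_of_time_lt run hb ha hbW haW hl.symm hlt)

theorem eventually_ts_le_view (fair : StutterFair (viewMem upd) q l) {m : Msg Loc Val}
    (hm : m ∈ (q n).1) (τ : Tid) : ∃ N, ∀ i ≥ N, m.ts ≤ (q i).2 τ m.loc := by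
  classical
  by_contra! hne
  have lt : ∀ i, (q i).2 τ m.loc < m.ts := fun i => by
    obtain ⟨j, hij, hlt⟩ := hne i
    exact ((hu.monotone run hij).2 τ m.loc).trans_lt hlt
  obtain ⟨i, -, hi⟩ := fair (τ, m) n fun i hi => ⟨_, (hu.monotone run hi).1 hm, lt i, rfl⟩
  obtain ⟨-, -, hq⟩ := run.step i _ hi
  have := lt (i + 1)
  simp [hq] at this

theorem exists_time_bound_of_stamp_lt [Finite Tid]
    (fair : (∃ N, ∀ n ≥ N, l n = none) ∨ StutterFair (viewMem upd) q l)
    (hb : b ∈ eventsOf Loc (histBeh (obsHist l))) (hbW : b.IsW) :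
    ∃ N, ∀ a n, OccursAt (obsHist l) n a → a.SameLoc b →
      stamp q (obsHist l) a < stamp q (obsHist l) b → n ≤ N := by
  rcases fair with ⟨N, hN⟩ | fair
  · refine ⟨N, fun a n ⟨τ, c, hn, _⟩ _ _ => ?_⟩
    by_contra! hlt
    exact Option.some_ne_none _ ((obsHist_eq_some.1 hn).symm.trans (hN n hlt.le))
  · obtain ⟨m, hm, hloc, hts⟩ := hu.exists_msg run hb hbW le_rfl
    choose N hN using hu.eventually_ts_le_view run fair hm
    obtain ⟨B, hB⟩ := (Set.finite_range N).bddAbove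
    refine ⟨B, fun a n hn hl hlt => ?_⟩
    obtain ⟨τ, c, hn, rfl⟩ := hn
    obtain ⟨y, hy, hby⟩ := hl
    have hc : c.loc = m.loc := Option.some.inj (hy.trans (hby.symm.trans hloc))
    rw [stamp_ev hn, ← hts, hc] at hlt
    by_contra! hBn
    exact hlt.not_ge (hN τ (n + 1) ((hB ⟨τ, rfl⟩).trans (hBn.le.trans n.le_succ)))

end IsViewUpdate

/-- The read `r` may read from the write `w`: the message of `w` takes its thread to a view below
the one of `r` after the read. -/
structure ViewSource (upd : View Loc → Msg Loc Val → View Loc) (q : ℕ → ViewState Tid Loc Val)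
    (h : ℕ → Option (Tid × ELab Loc Val)) (w r : Event Tid Loc (ELab Loc Val)) : Prop where
  mem : w ∈ eventsOf Loc (histBeh h)
  isW : w.IsW
  loc_eq : w.loc = r.loc
  val_eq : w.valW = r.valR
  time_lt : time h w < time h r
  stamp_eq : stamp q h r = stamp q h w ∨ (r.IsW ∧ stamp q h r = stamp q h w + 1)
  upd_le : ∃ V m, m.view = viewAfter q h w ∧ upd V m ≤ viewAfter q h r

theorem IsViewUpdate.exists_viewSource (hu : IsViewUpdate upd)
    (run : StutterRun (viewMem upd) q l) (he : e ∈ eventsOf Loc (histBeh (obsHist l)))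
    (hR : e.IsR) : ∃ w, ViewSource upd q (obsHist l) w e := by
  obtain ⟨n, τ, a, hn, rfl⟩ := exists_occursAt_of_isR he hR
  obtain ⟨v, hv⟩ := Option.isSome_iff_exists.1 hR
  obtain ⟨m, hm, hloc, hval, hts, hle⟩ :=
    viewMem_step_read hu (run.msg_view n) (run.step n _ (obsHist_eq_some.1 hn)) hv
  obtain ⟨w, hw, hW, hwloc, hwval, hwts, hview, htime⟩ := run.exists_event_of_msg n m hm
  exact ⟨w, {
    mem := hw
    isW := hW
    loc_eq := hwloc.trans (congrArg some hloc)
    val_eq := by rw [hwval, hval, hv]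
    time_lt := OccursAt.time_eq ⟨τ, a, hn, rfl⟩ ▸ Nat.lt_succ_of_le htime
    stamp_eq := by
      rw [stamp_ev hn, hwts]
      exact hts
    upd_le := ⟨(q n).2 τ, m, hview.symm, (viewAfter_ev hn).symm ▸ hle⟩ }⟩

end ViewRuns

section ViewGraphs

variable {Tid Loc Val : Type*} [Zero Val] {upd : View Loc → Msg Loc Val → View Loc}

/-- Times, timestamps and views of the events of `G` as in a run of the timestamp-based memory
system with read update `upd`. -/
structure TimestampedGraph (upd : View Loc → Msg Loc Val → View Loc)
    (G : EGraph Tid (ELab Loc Val)) (tm ts : Event Tid Loc (ELab Loc Val) → ℕ)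
    (V : Event Tid Loc (ELab Loc Val) → View Loc) : Prop where
  time_lt_of_po : ∀ a b, G.po a b → tm a < tm b
  time_lt_of_rf : ∀ a b, G.rf a b → tm a < tm b
  view_le_of_po : ∀ a b, G.po a b → V a ≤ V b
  view_loc : ∀ a x, a.loc = some x → V a x = ts a
  ts_le_of_rf : ∀ a b, G.rf a b → ts a ≤ ts b
  ts_lt_of_mo : ∀ a b, G.mo a b → ts a < ts b
  ts_lt_of_fr : ∀ a b, G.fr a b → ts a < ts b
  upd_le_of_rf : ∀ a b, G.rf a b → ∃ V₀ m, m.view = V a ∧ upd V₀ m ≤ V b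

theorem stamp_lt_of_fr {q : ℕ → ViewState Tid Loc Val} {h : ℕ → Option (Tid × ELab Loc Val)}
    {src : Event Tid Loc (ELab Loc Val) → Event Tid Loc (ELab Loc Val)}
    (hsrc : ∀ r ∈ eventsOf Loc (histBeh h), r.IsR → ViewSource upd q h (src r) r)
    (d : SourceData (eventsOf Loc (histBeh h)) src (stamp q h))
    {a b : Event Tid Loc (ELab Loc Val)} (hab : d.graph.fr a b) : stamp q h a < stamp q h b := by
  have hl := EGraph.sameLoc_of_fr hab
  obtain ⟨⟨w, ⟨ha, hR, rfl⟩, -, hb, -, hbW, -, hlt⟩, hne⟩ := hab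
  rcases (hsrc a ha hR).stamp_eq with heq | ⟨haW, heq⟩
  · exact heq ▸ hlt
  · exact lt_of_le_of_ne (heq ▸ hlt) fun he => hne (d.ts_inj a ha b hb haW hbW hl he)

theorem timestampedGraph_of_stutterRun (hu : IsViewUpdate upd) {q : ℕ → ViewState Tid Loc Val}
    {l : ℕ → Option ((Tid × ELab Loc Val) ⊕ (Tid × Msg Loc Val))}
    (run : StutterRun (viewMem upd) q l)
    {src : Event Tid Loc (ELab Loc Val) → Event Tid Loc (ELab Loc Val)}
    (hsrc : ∀ r ∈ eventsOf Loc (histBeh (obsHist l)), r.IsR →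
      ViewSource upd q (obsHist l) (src r) r)
    (d : SourceData (eventsOf Loc (histBeh (obsHist l))) src (stamp q (obsHist l))) :
    TimestampedGraph upd d.graph (time (obsHist l)) (stamp q (obsHist l))
      (viewAfter q (obsHist l)) where
  time_lt_of_po _ _ h := time_lt_of_sb h.1 h.2.1 h.2.2
  time_lt_of_rf := by
    rintro a b ⟨hb, hR, rfl⟩
    exact (hsrc b hb hR).time_lt
  view_le_of_po a b h := by
    rcases sb_cases h.1 h.2.1 h.2.2 with ⟨⟨x, rfl⟩, -⟩ | ⟨n, m, τ, c, d, hlt, hn, hm, rfl, rfl⟩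
    · exact fun _ => Nat.zero_le _
    · rw [viewAfter_ev hn, viewAfter_ev hm]
      exact (hu.monotone run (Nat.succ_le_succ hlt.le)).2 τ
  view_loc _ _ := viewAfter_loc
  ts_le_of_rf := by
    rintro a b ⟨hb, hR, rfl⟩
    rcases (hsrc b hb hR).stamp_eq with h | ⟨-, h⟩ <;> omega
  ts_lt_of_mo _ _ h := h.2.2.2.2.2
  ts_lt_of_fr _ _ := stamp_lt_of_fr hsrc d
  upd_le_of_rf := by
    rintro a b ⟨hb, hR, rfl⟩
    exact (hsrc b hb hR).upd_le

theorem exists_timestampedGraph_of_mem_BehMF [Finite Tid] (hu : IsViewUpdate upd)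
    {β : Behavior Tid (ELab Loc Val)}
    (hβ : β ∈ (viewMem upd : LTS (Tid × ELab Loc Val) _).BehMF) :
    ∃ (G : EGraph Tid (ELab Loc Val)) (tm ts : Event Tid Loc (ELab Loc Val) → ℕ)
      (V : Event Tid Loc (ELab Loc Val) → View Loc),
      TimestampedGraph upd G tm ts V ∧ G.Fair ∧ eventsOf Loc β = G.E := by
  obtain ⟨(q : ℕ → ViewState Tid Loc Val), l, run, rfl, fair⟩ :=
    LTS.exists_stutterRun_of_mem_BehMF hβ
  choose! src hsrc using fun r hr => hu.exists_viewSource (e := r) run hr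
  have d : SourceData (eventsOf Loc (histBeh (obsHist l))) src (stamp q (obsHist l)) :=
    { wf := wellFormed_eventsOf _
      src_mem := fun r hr hR => (hsrc r hr hR).mem
      src_isW := fun r hr hR => (hsrc r hr hR).isW
      src_loc := fun r hr hR => (hsrc r hr hR).loc_eq
      src_val := fun r hr hR => (hsrc r hr hR).val_eq
      ts_inj := hu.stamp_inj run }
  refine ⟨d.graph, _, _, _, timestampedGraph_of_stutterRun hu run hsrc d,
    ⟨d.mo_prefixFinite, fun b => ?_⟩, rfl⟩
  rcases Set.eq_empty_or_nonempty {a | d.graph.fr a b} with hempty | ⟨-, ⟨w, -, hwb⟩, -⟩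
  · exact hempty ▸ Set.finite_empty
  · obtain ⟨N, hN⟩ := hu.exists_time_bound_of_stamp_lt run fair hwb.2.1 hwb.2.2.2.1
    refine finite_of_occursAt_le (h := obsHist l) N fun a hab => ?_
    obtain ⟨n, hn⟩ : ∃ n, OccursAt (obsHist l) n a := by
      obtain ⟨⟨w, ⟨ha, hR, -⟩, -⟩, -⟩ := hab
      exact exists_occursAt_of_isR ha hR
    exact ⟨n, hN a n hn (EGraph.sameLoc_of_fr hab) (stamp_lt_of_fr hsrc d hab), hn⟩

variable {G : EGraph Tid (ELab Loc Val)} {tm ts : Event Tid Loc (ELab Loc Val) → ℕ}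
  {V : Event Tid Loc (ELab Loc Val) → View Loc}

theorem TimestampedGraph.time_lt_of_hbRA (g : TimestampedGraph upd G tm ts V)
    {a b : Event Tid Loc (ELab Loc Val)} (h : G.hbRA a b) : tm a < tm b :=
  have : IsTrans _ fun a b => tm a < tm b := ⟨fun _ _ _ => lt_trans⟩
  Relation.transGen_minimal (fun _ _ h => h.elim (g.time_lt_of_po _ _) (g.time_lt_of_rf _ _)) a b h

theorem TimestampedGraph.irrefl_hbRA (g : TimestampedGraph upd G tm ts V) : Irrefl G.hbRA :=
  fun _ h => lt_irrefl _ (g.time_lt_of_hbRA h)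

theorem TimestampedGraph.acyclic (g : TimestampedGraph upd G tm ts V)
    {R : Event Tid Loc (ELab Loc Val) → Event Tid Loc (ELab Loc Val) → Prop}
    (hR : ∀ a b, R a b → G.hbRA a b ∧ V a ≤ V b) :
    Acyclic fun a b => (R a b ∧ a.SameLoc b) ∨ G.rf a b ∨ G.mo a b ∨ G.fr a b := by
  refine acyclic_of_lex ts tm ?_
  rintro a b (⟨h, x, hx, hx'⟩ | h | h | h)
  · obtain ⟨hhb, hV⟩ := hR a b h
    rw [← g.view_loc a x hx, ← g.view_loc b x hx']
    exact Or.inr ⟨hV x, g.time_lt_of_hbRA hhb⟩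
  · exact Or.inr ⟨g.ts_le_of_rf a b h, g.time_lt_of_rf a b h⟩
  · exact Or.inl (g.ts_lt_of_mo a b h)
  · exact Or.inl (g.ts_lt_of_fr a b h)

theorem exists_fair_mem_GRA_of_mem_BehMF_MRA [Finite Tid] {β : Behavior Tid (ELab Loc Val)}
    (hβ : β ∈ (MRA Tid Loc Val).BehMF) :
    ∃ G ∈ GRA Tid (ELab Loc Val), G.Fair ∧ eventsOf Loc β = G.E ∧ Irrefl G.hbRA := by
  obtain ⟨G, tm, ts, V, g, fair, hE⟩ := exists_timestampedGraph_of_mem_BehMF isViewUpdate_sup hβ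
  have view_le_of_rf : ∀ a b, G.rf a b → V a ≤ V b := fun a b hab => by
    obtain ⟨V₀, m, hm, hle⟩ := g.upd_le_of_rf a b hab
    exact hm ▸ le_sup_right.trans hle
  have : IsTrans _ fun a b => V a ≤ V b := ⟨fun _ _ _ => le_trans⟩
  have view_le_of_hbRA : ∀ a b, G.hbRA a b → V a ≤ V b :=
    Relation.transGen_minimal fun _ _ h => h.elim (g.view_le_of_po _ _) (view_le_of_rf _ _)
  exact ⟨G, g.acyclic fun a b h => ⟨h, view_le_of_hbRA a b h⟩, fair, hE, g.irrefl_hbRA⟩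

theorem exists_fair_mem_GStrongCOH_of_mem_BehMF_MStrongCOH [Finite Tid]
    {β : Behavior Tid (ELab Loc Val)} (hβ : β ∈ (MStrongCOH Tid Loc Val).BehMF) :
    ∃ G ∈ GStrongCOH Tid (ELab Loc Val), G.Fair ∧ eventsOf Loc β = G.E ∧ Irrefl G.hbRA := by
  obtain ⟨G, tm, ts, V, g, fair, hE⟩ := exists_timestampedGraph_of_mem_BehMF isViewUpdate_update hβ
  exact ⟨G, ⟨g.irrefl_hbRA, g.acyclic fun a b h => ⟨.single (Or.inl h), g.view_le_of_po a b h⟩⟩,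
    fair, hE, g.irrefl_hbRA⟩

end ViewGraphs

/-! ### Store buffering -/

section CommitGraphs

variable {Tid Loc Val : Type*}

theorem Event.Sb.trans {L : Type*} {a b c : Event Tid Loc L} (h : a.Sb b) (h' : b.Sb c) :
    a.Sb c := by
  rcases a with x | ⟨k, τ, a⟩ <;> rcases b with y | ⟨k', τ', b⟩ <;>
    rcases c with z | ⟨k'', τ'', c⟩ <;> first | exact trivial | exact h.elim | exact h'.elim | skip
  exact ⟨h.1.trans h'.1, h.2.trans h'.2⟩

variable [Zero Val]

theorem Event.isR_or_isW (e : Event Tid Loc (ELab Loc Val)) : e.IsR ∨ e.IsW := by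
  rcases e with x | ⟨k, τ, x | x | x⟩
  exacts [Or.inr rfl, Or.inl rfl, Or.inr rfl, Or.inr rfl]

/-- Issue times `tm` and commit times `ct` of events, as in a run of the store buffering memory
system: a write commits when it reaches the memory, all other events when they are issued. A write
is visible to a read if it has committed before the read, or if the read follows it in its
thread; the read reads from the visible write to its location that commits last. -/
structure CommitData (E : Set (Event Tid Loc (ELab Loc Val)))
    (src : Event Tid Loc (ELab Loc Val) → Event Tid Loc (ELab Loc Val))
    (tm ct : Event Tid Loc (ELab Loc Val) → ℕ) : Prop extends SourceData E src ct where
  time_lt_of_sb : ∀ a ∈ E, ∀ b ∈ E, a.Sb b → tm a < tm b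
  time_le_commit : ∀ e ∈ E, tm e ≤ ct e
  commit_eq_time : ∀ r ∈ E, r.IsR → ct r = tm r
  commit_inj : ∀ r ∈ E, ∀ e ∈ E, r.IsR → ct r = ct e → r = e
  commit_lt_of_sb : ∀ a ∈ E, ∀ b ∈ E, a.IsW → b.IsW → a.Sb b → ct a < ct b
  src_visible : ∀ r ∈ E, r.IsR → ct (src r) < ct r ∨ (src r).Sb r
  commit_le_of_visible : ∀ r ∈ E, r.IsR → ∀ w ∈ E, w.IsW → w.SameLoc r →
    (ct w < ct r ∨ w.Sb r) → ct w ≤ ct (src r)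

namespace CommitData

variable {E : Set (Event Tid Loc (ELab Loc Val))}
  {src : Event Tid Loc (ELab Loc Val) → Event Tid Loc (ELab Loc Val)}
  {tm ct : Event Tid Loc (ELab Loc Val) → ℕ} (d : CommitData E src tm ct)
  {a b : Event Tid Loc (ELab Loc Val)}
include d

theorem commit_lt_of_isR_of_sb (ha : a ∈ E) (hb : b ∈ E) (hR : a.IsR) (h : a.Sb b) :
    ct a < ct b :=
  d.commit_eq_time a ha hR ▸ (d.time_lt_of_sb a ha b hb h).trans_le (d.time_le_commit b hb)

theorem commit_lt_of_fr (h : d.graph.fr a b) : ct a < ct b := by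
  have hl := EGraph.sameLoc_of_fr h
  obtain ⟨⟨_, ⟨ha, hR, rfl⟩, -, hb, -, hbW, -, hlt⟩, hne⟩ := h
  have not_visible := mt (d.commit_le_of_visible a ha hR b hb hbW hl.symm) hlt.not_ge
  rcases lt_trichotomy (ct a) (ct b) with h | h | h
  · exact h
  · exact absurd (d.commit_inj a ha b hb hR h) hne
  · exact absurd (Or.inl h) not_visible

theorem time_src_lt (hb : b ∈ E) (hR : b.IsR) : tm (src b) < tm b := by
  have hw := d.src_mem b hb hR
  rcases d.src_visible b hb hR with h | h
  · exact (d.time_le_commit _ hw).trans_lt (d.commit_eq_time b hb hR ▸ h)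
  · exact d.time_lt_of_sb _ hw b hb h

theorem irrefl_hbRA : Irrefl d.graph.hbRA := by
  refine acyclic_of_measure tm ?_
  rintro a b (⟨ha, hb, h⟩ | ⟨hb, hR, rfl⟩)
  · exact d.time_lt_of_sb a ha b hb h
  · exact d.time_src_lt hb hR

theorem irrefl_hbTSO : Irrefl d.graph.hbTSO := by
  refine acyclic_of_measure ct ?_
  rintro a b (⟨⟨ha, hb, h⟩, hppo⟩ | ⟨⟨hb, hR, rfl⟩, hpo⟩ | ⟨-, -, -, -, -, h⟩ | h)
  · by_cases haR : a.IsR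
    · exact d.commit_lt_of_isR_of_sb ha hb haR h
    · have haW := a.isR_or_isW.resolve_left haR
      have hbW : b.IsW := by
        by_contra hbW
        exact hppo ⟨⟨haW, fun h => haR h.1⟩, b.isR_or_isW.resolve_right hbW, fun h => hbW h.2⟩
      exact d.commit_lt_of_sb a ha b hb haW hbW h
  · exact (d.src_visible b hb hR).resolve_right fun h => hpo ⟨d.src_mem b hb hR, hb, h⟩
  · exact h
  · exact d.commit_lt_of_fr h

end CommitData

open Classical in
/-- The commit time of the write that an event observes: itself if it is a write, and the write it
reads from otherwise. -/
noncomputable def observedCommit (src : Event Tid Loc (ELab Loc Val) → Event Tid Loc (ELab Loc Val))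
    (ct : Event Tid Loc (ELab Loc Val) → ℕ) (e : Event Tid Loc (ELab Loc Val)) : ℕ :=
  if e.IsW then ct e else ct (src e)

namespace CommitData

variable {E : Set (Event Tid Loc (ELab Loc Val))}
  {src : Event Tid Loc (ELab Loc Val) → Event Tid Loc (ELab Loc Val)}
  {tm ct : Event Tid Loc (ELab Loc Val) → ℕ} (d : CommitData E src tm ct)
  {a b w : Event Tid Loc (ELab Loc Val)}
include d

theorem commit_le_observedCommit (hb : b ∈ E) (hw : w ∈ E) (hW : w.IsW) (hl : w.SameLoc b)
    (h : ct w < ct b ∨ w.Sb b) : ct w ≤ observedCommit src ct b := by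
  by_cases hbW : b.IsW
  · rw [observedCommit, if_pos hbW]
    exact h.elim le_of_lt fun h => (d.commit_lt_of_sb w hw b hb hW hbW h).le
  · rw [observedCommit, if_neg hbW]
    exact d.commit_le_of_visible b hb (b.isR_or_isW.resolve_right hbW) w hw hW hl h

theorem observedCommit_le_of_sb (ha : a ∈ E) (hb : b ∈ E) (hl : a.SameLoc b) (h : a.Sb b) :
    observedCommit src ct a ≤ observedCommit src ct b := by
  by_cases haW : a.IsW
  · rw [observedCommit, if_pos haW]
    exact d.commit_le_observedCommit hb ha haW hl (Or.inr h)
  · have haR := a.isR_or_isW.resolve_right haW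
    rw [observedCommit, if_neg haW]
    refine d.commit_le_observedCommit hb (d.src_mem a ha haR) (d.src_isW a ha haR) ?_ ?_
    · obtain ⟨x, hx, hx'⟩ := hl
      exact ⟨x, (d.src_loc a ha haR).trans hx, hx'⟩
    · exact (d.src_visible a ha haR).imp
        (fun h' => h'.trans (d.commit_lt_of_isR_of_sb ha hb haR h)) fun h' => h'.trans h

theorem irrefl_scLoc : Irrefl d.graph.scLoc := by
  refine acyclic_of_lex (observedCommit src ct) tm ?_
  rintro a b (⟨⟨ha, hb, h⟩, hl⟩ | hab | ⟨-, -, haW, hbW, -, h⟩ | h)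
  · exact Or.inr ⟨d.observedCommit_le_of_sb ha hb hl h, d.time_lt_of_sb a ha b hb h⟩
  · have hl := EGraph.sameLoc_of_rf hab
    obtain ⟨hb, hR, rfl⟩ := hab
    have hW := d.src_isW b hb hR
    have le := d.commit_le_observedCommit hb (d.src_mem b hb hR) hW hl (d.src_visible b hb hR)
    exact Or.inr ⟨(if_pos hW).trans_le le, d.time_src_lt hb hR⟩
  · exact Or.inl (by simpa only [observedCommit, if_pos haW, if_pos hbW] using h)
  · have hbW := (EGraph.mo_type _ _ _ h.1.choose_spec.2).2.1
    have lt := d.commit_lt_of_fr h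
    obtain ⟨⟨_, ⟨-, -, rfl⟩, -, -, -, -, -, hlt⟩, -⟩ := h
    simp only [observedCommit, if_pos hbW]
    split_ifs
    exacts [Or.inl lt, Or.inl hlt]

theorem fair : d.graph.Fair := by
  refine ⟨d.mo_prefixFinite, fun b => ?_⟩
  refine Set.Finite.of_injOn (f := ct) (t := Set.Iio (ct b)) (fun _ => d.commit_lt_of_fr) ?_
    (Set.finite_Iio _)
  rintro a ⟨⟨_, ⟨ha, hR, -⟩, -⟩, -⟩ a' ⟨⟨_, ⟨ha', -⟩, -⟩, -⟩ heq
  exact d.commit_inj a ha a' ha' hR heq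

end CommitData

end CommitGraphs

section FlushTimes

variable {Tid Loc Val : Type*} {l : ℕ → Option ((Tid × ELab Loc Val) ⊕ Tid)} {τ : Tid} {n m : ℕ}
  {x : Loc} {v : Val} {a b : ELab Loc Val}

/-- The thread `τ` puts a write into its store buffer at time `n`. -/
def StoresAt (l : ℕ → Option ((Tid × ELab Loc Val) ⊕ Tid)) (τ : Tid) (n : ℕ) : Prop :=
  ∃ x v, l n = some (Sum.inl (τ, .write x v))

/-- The oldest entry of the store buffer of `τ` reaches the memory at time `n`. -/
def FlushesAt (l : ℕ → Option ((Tid × ELab Loc Val) ⊕ Tid)) (τ : Tid) (n : ℕ) : Prop :=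
  l n = some (Sum.inr τ)

open Classical in
/-- The time when an access issued at time `n` reaches the memory. As store buffers are first-in
first-out, the `k`-th write of a thread does so with the `k`-th flush of its buffer. All other
accesses act at the time when they are issued. -/
noncomputable def flushTime (l : ℕ → Option ((Tid × ELab Loc Val) ⊕ Tid)) (n : ℕ) : ℕ :=
  match l n with
  | some (Sum.inl (τ, .write _ _)) =>
    Nat.nth (FlushesAt l τ) (Nat.count (StoresAt l τ) n)
  | _ => n

open Classical in
theorem flushTime_of_storesAt (h : StoresAt l τ n) :
    flushTime l n = Nat.nth (FlushesAt l τ) (Nat.count (StoresAt l τ) n) := by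
  obtain ⟨x, v, h⟩ := h
  simp only [flushTime, h]

theorem flushTime_of_isSome_valR (h : l n = some (Sum.inl (τ, a))) (ha : a.valR.isSome) :
    flushTime l n = n := by
  rcases a with _ | _ | _
  · simp only [flushTime, h]
  · cases ha
  · simp only [flushTime, h]

theorem storesAt_or_isSome_valR (h : l n = some (Sum.inl (τ, a))) :
    StoresAt l τ n ∨ a.valR.isSome := by
  rcases a with _ | ⟨x, v⟩ | _
  exacts [Or.inr rfl, Or.inl ⟨x, v, h⟩, Or.inr rfl]

theorem StoresAt.not_flushesAt {τ' : Tid} (h : StoresAt l τ n) : ¬ FlushesAt l τ' n := by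
  obtain ⟨x, v, h⟩ := h
  simp [FlushesAt, h]

variable [Zero Val] {q : ℕ → (Loc → Val) × (Tid → List (Loc × Val))}
  (run : StutterRun (MTSO Tid Loc Val) q l)
include run

theorem StutterRun.buffer_cases (τ : Tid) (n : ℕ) :
    (∃ x v, l n = some (Sum.inl (τ, .write x v)) ∧ (q (n + 1)).2 τ = (x, v) :: (q n).2 τ) ∨
    (FlushesAt l τ n ∧ ∃ p, (q n).2 τ = (q (n + 1)).2 τ ++ [p]) ∨
    (¬ StoresAt l τ n ∧ ¬ FlushesAt l τ n ∧ (q (n + 1)).2 τ = (q n).2 τ) := by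
  rcases hl : l n with _ | ⟨τ', ⟨x, v⟩ | ⟨x, v⟩ | ⟨x, v, v'⟩⟩ | τ'
  · simp [StoresAt, FlushesAt, hl, run.idle n hl]
  · obtain ⟨-, hq⟩ := run.step n _ hl
    simp [StoresAt, FlushesAt, hl, hq]
  · have hq : q (n + 1) = _ := run.step n _ hl
    by_cases h : τ = τ' <;> simp_all [StoresAt, FlushesAt, eq_comm]
  · obtain ⟨-, -, hq⟩ := run.step n _ hl
    simp [StoresAt, FlushesAt, hl, hq]
  · obtain ⟨b, x, v, hb, hq⟩ := run.step n _ hl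
    by_cases h : τ = τ'
    · subst h
      exact Or.inr (Or.inl ⟨hl, (x, v), by simp [hq, hb]⟩)
    · simp [StoresAt, FlushesAt, hl, hq, h, Ne.symm h]

open Classical in
theorem StutterRun.length_buffer_add_count (τ : Tid) (n : ℕ) :
    ((q n).2 τ).length + Nat.count (FlushesAt l τ) n = Nat.count (StoresAt l τ) n := by
  induction n with
  | zero => simp [run.init, MTSO]
  | succ n ih =>
    rw [Nat.count_succ, Nat.count_succ]
    rcases run.buffer_cases τ n with ⟨x, v, hs, hq⟩ | ⟨hf, p, hq⟩ | ⟨hs, hf, hq⟩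
    · have hs : StoresAt l τ n := ⟨x, v, hs⟩
      rw [if_pos hs, if_neg hs.not_flushesAt, hq, List.length_cons]
      omega
    · rw [if_pos hf, if_neg fun h : StoresAt l τ n => h.not_flushesAt hf]
      rw [hq, List.length_append, List.length_singleton] at ih
      omega
    · rw [if_neg hs, if_neg hf, hq]
      omega

theorem FlushesAt.exists_storesAt (h : FlushesAt l τ n) :
    ∃ j, StoresAt l τ j ∧ flushTime l j = n := by
  classical
  have hlt : Nat.count (FlushesAt l τ) n < Nat.count (StoresAt l τ) n := by
    rcases run.buffer_cases τ n with ⟨x, v, hs, -⟩ | ⟨-, p, hq⟩ | ⟨-, hf, -⟩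
    · exact absurd h (StoresAt.not_flushesAt ⟨x, v, hs⟩)
    · have := run.length_buffer_add_count τ n
      rw [hq, List.length_append, List.length_singleton] at this
      omega
    · exact absurd h hf
  have hs : StoresAt l τ (Nat.nth (StoresAt l τ) (Nat.count (FlushesAt l τ) n)) :=
    Nat.nth_mem _ fun hf => hlt.trans_le (Nat.count_le_card hf n)
  refine ⟨_, hs, ?_⟩
  rw [flushTime_of_storesAt hs, Nat.count_nth fun hf => hlt.trans_le (Nat.count_le_card hf n),
    Nat.nth_count h]

variable (fair : StutterFair (MTSO Tid Loc Val) q l)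
include fair

open Classical in
theorem StutterFair.exists_lt_count_flushesAt {k : ℕ} (hk : k < Nat.count (StoresAt l τ) n) :
    ∃ m, k < Nat.count (FlushesAt l τ) m := by
  by_contra! hle
  have enabled : ∀ j ≥ n, (MTSO Tid Loc Val).Enabled (Sum.inr τ) (q j) := fun j hj => by
    have hne : (q j).2 τ ≠ [] := by
      have := run.length_buffer_add_count τ j
      have := hle j
      have := Nat.count_monotone (StoresAt l τ) hj
      rw [← List.length_pos_iff]
      omega
    exact ⟨_, _, _, _, ((q j).2 τ).dropLast_append_getLast hne |>.symm, rfl⟩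
  have infinite : (Set.ofPred (FlushesAt l τ)).Infinite := by
    refine Set.infinite_of_not_bddAbove fun ⟨N, hN⟩ => ?_
    obtain ⟨j, hj, hf⟩ := fair τ (max n (N + 1)) fun j hj => enabled j (le_of_max_le_left hj)
    have := hN hf
    omega
  have := hle (Nat.nth (FlushesAt l τ) (k + 1))
  rw [Nat.count_nth_of_infinite infinite] at this
  omega

open Classical in
theorem StutterFair.lt_card_flushesAt {k : ℕ} (hk : k < Nat.count (StoresAt l τ) n)
    (hf : (Set.ofPred (FlushesAt l τ)).Finite) : k < hf.toFinset.card := by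
  obtain ⟨m, hm⟩ := fair.exists_lt_count_flushesAt run hk
  exact hm.trans_le (Nat.count_le_card hf m)

open Classical in
theorem StoresAt.lt_card_flushesAt (h : StoresAt l τ n)
    (hf : (Set.ofPred (FlushesAt l τ)).Finite) :
    Nat.count (StoresAt l τ) n < hf.toFinset.card :=
  fair.lt_card_flushesAt run (Nat.count_strict_mono h n.lt_succ_self) hf

theorem StoresAt.flushesAt_flushTime (h : StoresAt l τ n) : FlushesAt l τ (flushTime l n) := by
  classical
  rw [flushTime_of_storesAt h]
  exact Nat.nth_mem _ (h.lt_card_flushesAt run fair)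

open Classical in
theorem StoresAt.count_flushTime (h : StoresAt l τ n) :
    Nat.count (FlushesAt l τ) (flushTime l n) = Nat.count (StoresAt l τ) n := by
  rw [flushTime_of_storesAt h, Nat.count_nth (h.lt_card_flushesAt run fair)]

theorem StoresAt.lt_flushTime (h : StoresAt l τ n) : n < flushTime l n := by
  classical
  by_contra! hle
  have flush := h.flushesAt_flushTime run fair
  have hlt : flushTime l n < n := hle.lt_of_ne fun heq => h.not_flushesAt (heq ▸ flush)
  have := Nat.count_strict_mono flush hlt
  have := run.length_buffer_add_count τ n
  rw [h.count_flushTime run fair] at *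
  omega

theorem le_flushTime (h : l n = some (Sum.inl (τ, a))) : n ≤ flushTime l n := by
  rcases storesAt_or_isSome_valR h with hs | ha
  · exact (hs.lt_flushTime run fair).le
  · exact (flushTime_of_isSome_valR h ha).ge

theorem StoresAt.flushTime_lt_of_buffer_eq_nil (h : StoresAt l τ n) (hnm : n < m)
    (hq : (q m).2 τ = []) : flushTime l n < m := by
  classical
  refine Nat.lt_of_count_lt_count (p := FlushesAt l τ) ?_
  have := run.length_buffer_add_count τ m
  rw [hq, List.length_nil, Nat.zero_add] at this
  rw [h.count_flushTime run fair, this]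
  exact Nat.count_strict_mono h hnm

theorem flushTime_lt_flushTime (hn : l n = some (Sum.inl (τ, a))) (hm : l m = some (Sum.inl (τ, b)))
    (hb : b.valW.isSome) (hnm : n < m) : flushTime l n < flushTime l m := by
  classical
  rcases storesAt_or_isSome_valR hn with hs | ha
  · rcases b with ⟨x, v⟩ | ⟨x, v⟩ | ⟨x, v, v'⟩
    · cases hb
    · have hs' : StoresAt l τ m := ⟨x, v, hm⟩
      rw [flushTime_of_storesAt hs, flushTime_of_storesAt hs']
      exact Nat.nth_lt_nth' (Nat.count_strict_mono hs hnm) (hs'.lt_card_flushesAt run fair)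
    · rw [flushTime_of_isSome_valR hm rfl]
      exact hs.flushTime_lt_of_buffer_eq_nil run fair hnm (run.step m _ hm).1
  · rw [flushTime_of_isSome_valR hn ha]
    exact hnm.trans_le (le_flushTime run fair hm)

theorem flushTime_inj {τ' : Tid} (hn : l n = some (Sum.inl (τ, a)))
    (hm : l m = some (Sum.inl (τ', b))) (heq : flushTime l n = flushTime l m) : n = m := by
  classical
  rcases storesAt_or_isSome_valR hn with hs | ha <;> rcases storesAt_or_isSome_valR hm with hs' | hb
  · have flush := heq ▸ hs.flushesAt_flushTime run fair
    cases flush.symm.trans (hs'.flushesAt_flushTime run fair)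
    refine Nat.count_injective hs hs' ?_
    rw [← hs.count_flushTime run fair, heq, hs'.count_flushTime run fair]
  · have flush := hs.flushesAt_flushTime run fair
    rw [heq, flushTime_of_isSome_valR hm hb, FlushesAt, hm] at flush
    cases flush
  · have flush := hs'.flushesAt_flushTime run fair
    rw [← heq, flushTime_of_isSome_valR hn ha, FlushesAt, hn] at flush
    cases flush
  · rwa [flushTime_of_isSome_valR hn ha, flushTime_of_isSome_valR hm hb] at heq

end FlushTimes

section BufferContents

variable {Tid Loc Val : Type*}

open Classical in
/-- The memory as seen through a store buffer: the buffered writes, newest first, override it. -/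
noncomputable def overlay (M : Loc → Val) (B : List (Loc × Val)) : Loc → Val :=
  B.foldr (fun p M => Function.update M p.1 p.2) M

/-- `ts` lists the issue times, newest first, of the entries of the store buffer `B` of `τ`. -/
def IssueTimes (l : ℕ → Option ((Tid × ELab Loc Val) ⊕ Tid)) (τ : Tid) :
    List ℕ → List (Loc × Val) → Prop :=
  List.Forall₂ fun j p => l j = some (Sum.inl (τ, .write p.1 p.2))

variable {l : ℕ → Option ((Tid × ELab Loc Val) ⊕ Tid)} {τ : Tid} {n j : ℕ}
  {x : Loc} {v : Val} {a : ELab Loc Val}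

theorem IssueTimes.overlay_cases {ts : List ℕ} {B : List (Loc × Val)} (h : IssueTimes l τ ts B)
    (hts : ts.Pairwise (· > ·)) (M : Loc → Val) (x : Loc) :
    (∃ j ∈ ts, l j = some (Sum.inl (τ, .write x (overlay M B x))) ∧
      ∀ i ∈ ts, ∀ v, l i = some (Sum.inl (τ, .write x v)) → i ≤ j) ∨
    overlay M B x = M x ∧ ∀ i ∈ ts, ∀ v, l i ≠ some (Sum.inl (τ, .write x v)) := by
  classical
  induction h with
  | nil => exact Or.inr ⟨rfl, by simp⟩
  | @cons j p ts B hj _ ih =>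
    obtain ⟨hlt, hts⟩ := List.pairwise_cons.1 hts
    rw [show overlay M (p :: B) = Function.update (overlay M B) p.1 p.2 from rfl]
    by_cases hx : x = p.1
    · subst hx
      rw [Function.update_self]
      refine Or.inl ⟨j, List.mem_cons_self, hj, fun i hi _ _ => ?_⟩
      rcases List.mem_cons.1 hi with rfl | hi
      exacts [le_rfl, (hlt i hi).le]
    · rw [Function.update_of_ne hx]
      have ne : ∀ v, l j ≠ some (Sum.inl (τ, .write x v)) := by
        rintro v hv
        cases hj.symm.trans hv
        exact hx rfl
      refine (ih hts).imp ?_ ?_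
      · rintro ⟨k, hk, hkx, hmax⟩
        exact ⟨k, List.mem_cons_of_mem _ hk, hkx, List.forall_mem_cons.2
          ⟨fun v hv => absurd hv (ne v), hmax⟩⟩
      · rintro ⟨heq, hnone⟩
        exact ⟨heq, List.forall_mem_cons.2 ⟨ne, hnone⟩⟩

theorem issueTimes_append_singleton {ts : List ℕ} {B : List (Loc × Val)} {p : Loc × Val} :
    IssueTimes l τ (ts ++ [j]) (B ++ [p]) ↔
      l j = some (Sum.inl (τ, .write p.1 p.2)) ∧ IssueTimes l τ ts B := by
  unfold IssueTimes
  rw [← List.forall₂_reverse_iff, List.reverse_concat, List.reverse_concat, List.forall₂_cons,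
    List.forall₂_reverse_iff]

/-- `ts` lists, in decreasing order, the times before `n` when `τ` issued the writes that have not
yet reached the memory. -/
structure IsPending (l : ℕ → Option ((Tid × ELab Loc Val) ⊕ Tid)) (τ : Tid) (n : ℕ)
    (ts : List ℕ) : Prop where
  pairwise : ts.Pairwise (· > ·)
  mem_iff : ∀ j, j ∈ ts ↔ StoresAt l τ j ∧ j < n ∧ n ≤ flushTime l j

variable [Zero Val] {q : ℕ → (Loc → Val) × (Tid → List (Loc × Val))}
  (run : StutterRun (MTSO Tid Loc Val) q l) (fair : StutterFair (MTSO Tid Loc Val) q l)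
include run fair

theorem IsPending.exists_eq_append {ts : List ℕ} (h : IsPending l τ n ts) (hj : StoresAt l τ j)
    (hn : flushTime l j = n) : ∃ ts', ts = ts' ++ [j] := by
  have hmem := (h.mem_iff j).2 ⟨hj, hn ▸ hj.lt_flushTime run fair, hn.ge⟩
  obtain ⟨ts', k, rfl⟩ := List.eq_nil_or_concat ts |>.resolve_left (List.ne_nil_of_mem hmem)
  refine ⟨ts', ?_⟩
  rw [List.concat_eq_append] at *
  obtain ⟨⟨y, w, hk⟩, -, hkn⟩ := (h.mem_iff k).1 (by simp)
  rcases List.mem_append.1 hmem with hj' | hj'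
  · have hkj : j > k := (List.pairwise_append.1 h.pairwise).2.2 j hj' k (by simp)
    obtain ⟨x, v, hj⟩ := hj
    have := flushTime_lt_flushTime run fair hk hj rfl hkj
    omega
  · rw [List.mem_singleton.1 hj']

theorem IsPending.store {ts : List ℕ} (h : IsPending l τ n ts) (hn : StoresAt l τ n) :
    IsPending l τ (n + 1) (n :: ts) where
  pairwise := List.pairwise_cons.2 ⟨fun j hj => ((h.mem_iff j).1 hj).2.1, h.pairwise⟩
  mem_iff j := by
    have flush_ne : StoresAt l τ j → flushTime l j ≠ n := fun hj heq =>
      hn.not_flushesAt (heq ▸ hj.flushesAt_flushTime run fair)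
    have lt : StoresAt l τ j → j < flushTime l j := fun hj => hj.lt_flushTime run fair
    grind [h.mem_iff j]

theorem IsPending.flush {ts : List ℕ} (h : IsPending l τ n (ts ++ [j])) (hj : StoresAt l τ j)
    (hjn : flushTime l j = n) : IsPending l τ (n + 1) ts where
  pairwise := (List.pairwise_append.1 h.pairwise).1
  mem_iff i := by
    have hn : FlushesAt l τ n := hjn ▸ hj.flushesAt_flushTime run fair
    have ne_of_store : StoresAt l τ i → i ≠ n := fun hi heq => (heq ▸ hi).not_flushesAt hn
    have flush_ne : StoresAt l τ i → i ≠ j → flushTime l i ≠ n := fun hi hne heq => by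
      obtain ⟨_, _, hi⟩ := hi
      obtain ⟨_, _, hj⟩ := hj
      exact hne (flushTime_inj run fair hi hj (heq.trans hjn.symm))
    have gt : i ∈ ts → i > j := fun hi =>
      (List.pairwise_append.1 h.pairwise).2.2 i hi j (List.mem_singleton_self j)
    grind [h.mem_iff i]

theorem IsPending.idle {ts : List ℕ} (h : IsPending l τ n ts) (hs : ¬ StoresAt l τ n)
    (hf : ¬ FlushesAt l τ n) : IsPending l τ (n + 1) ts where
  pairwise := h.pairwise
  mem_iff j := by
    have flush_ne : StoresAt l τ j → flushTime l j ≠ n := fun hj heq =>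
      hf (heq ▸ hj.flushesAt_flushTime run fair)
    grind [h.mem_iff j]

theorem exists_isPending (τ : Tid) (n : ℕ) :
    ∃ ts, IsPending l τ n ts ∧ IssueTimes l τ ts ((q n).2 τ) := by
  induction n with
  | zero =>
    rw [run.init]
    exact ⟨[], ⟨List.Pairwise.nil, by simp⟩, List.Forall₂.nil⟩
  | succ n ih =>
    obtain ⟨ts, pending, issue⟩ := ih
    rcases run.buffer_cases τ n with ⟨x, v, hs, hq⟩ | ⟨hf, p, hq⟩ | ⟨hs, hf, hq⟩
    · exact ⟨n :: ts, pending.store run fair ⟨x, v, hs⟩, hq ▸ List.Forall₂.cons hs issue⟩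
    · obtain ⟨j, hj, hjn⟩ := hf.exists_storesAt run
      obtain ⟨ts, rfl⟩ := pending.exists_eq_append run fair hj hjn
      exact ⟨ts, pending.flush run fair hj hjn, (issueTimes_append_singleton.1 (hq ▸ issue)).2⟩
    · exact ⟨ts, pending.idle run fair hs hf, hq ▸ issue⟩

end BufferContents

section Memory

variable {Tid Loc Val : Type*} [Zero Val] {l : ℕ → Option ((Tid × ELab Loc Val) ⊕ Tid)} {τ : Tid}
  {n j : ℕ} {x : Loc} {v : Val} {a : ELab Loc Val}
  {q : ℕ → (Loc → Val) × (Tid → List (Loc × Val))}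
  (run : StutterRun (MTSO Tid Loc Val) q l)
include run

theorem StutterRun.overlay_buffer_eq (hn : l n = some (Sum.inl (τ, a))) (ha : a.valR = some v) :
    overlay (q n).1 ((q n).2 τ) a.loc = v := by
  rcases a with ⟨x, w⟩ | ⟨x, w⟩ | ⟨x, w, w'⟩ <;> cases ha
  · exact (run.step n _ hn).1
  · obtain ⟨hq, hx, -⟩ := run.step n _ hn
    rw [hq]
    exact hx

theorem StutterRun.memory_eq_of_forall_flushTime_ne
    (h : ∀ j τ a, l j = some (Sum.inl (τ, a)) → a.valW.isSome → flushTime l j ≠ n) :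
    (q (n + 1)).1 = (q n).1 := by
  rcases hl : l n with _ | ⟨τ, ⟨x, v⟩ | ⟨x, v⟩ | ⟨x, v, v'⟩⟩ | τ
  · rw [run.idle n hl]
  · rw [(run.step n _ hl).2]
  · have hq : q (n + 1) = _ := run.step n _ hl
    rw [hq]
  · exact absurd (flushTime_of_isSome_valR hl rfl) (h n τ _ hl rfl)
  · obtain ⟨j, ⟨x, v, hj⟩, hjn⟩ := FlushesAt.exists_storesAt run hl
    exact absurd hjn (h j τ _ hj rfl)

variable (fair : StutterFair (MTSO Tid Loc Val) q l)
include fair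

open Classical in
theorem memory_eq_update_of_flushTime_eq (hj : l j = some (Sum.inl (τ, a))) (ha : a.valW = some v)
    (hn : flushTime l j = n) : (q (n + 1)).1 = Function.update (q n).1 a.loc v := by
  rcases a with ⟨x, w⟩ | ⟨x, w⟩ | ⟨x, w, w'⟩ <;> cases ha
  · have hs : StoresAt l τ j := ⟨x, v, hj⟩
    have flush : FlushesAt l τ n := hn ▸ hs.flushesAt_flushTime run fair
    obtain ⟨b, y, w, hb, hq⟩ := run.step n _ flush
    obtain ⟨ts, pending, issue⟩ := exists_isPending run fair τ n
    obtain ⟨ts, rfl⟩ := pending.exists_eq_append run fair hs hn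
    cases hj.symm.trans (issueTimes_append_singleton.1 (hb ▸ issue)).1
    rw [hq]
    rfl
  · rw [flushTime_of_isSome_valR hj rfl] at hn
    subst hn
    rw [(run.step j _ hj).2.2]
    rfl

end Memory

section CommitTimes

variable {Tid Loc Val : Type*} {l : ℕ → Option ((Tid × ELab Loc Val) ⊕ Tid)} {τ : Tid}
  {n : ℕ} {a : ELab Loc Val} {e e' : Event Tid Loc (ELab Loc Val)}

/-- The commit times of the events of a run of the store buffering memory system. Like issue times,
they are positive except for initialization events. -/
noncomputable def commitTime (l : ℕ → Option ((Tid × ELab Loc Val) ⊕ Tid))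
    (e : Event Tid Loc (ELab Loc Val)) : ℕ :=
  match time (obsHist l) e with
  | 0 => 0
  | n + 1 => flushTime l n + 1

theorem commitTime_init (x : Loc) :
    commitTime l (.init x : Event Tid Loc (ELab Loc Val)) = 0 := by
  rw [commitTime, time_init]

theorem OccursAt.commitTime_eq (he : OccursAt (obsHist l) n e) :
    commitTime l e = flushTime l n + 1 := by
  rw [commitTime, he.time_eq]

theorem commitTime_le_or_flushTime_eq (he : e ∈ eventsOf Loc (histBeh (obsHist l)))
    (h : commitTime l e ≤ n + 1) :
    commitTime l e ≤ n ∨ ∃ j, OccursAt (obsHist l) j e ∧ flushTime l j = n := by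
  rcases mem_eventsOf_histBeh.1 he with ⟨x, rfl⟩ | ⟨j, hj⟩
  · exact Or.inl ((commitTime_init x).trans_le n.zero_le)
  · rw [hj.commitTime_eq] at h ⊢
    exact (Nat.le_succ_iff.1 h).imp_right fun h => ⟨j, hj, Nat.succ.inj h⟩

variable [Zero Val]

/-- Among the writes in `S` with location `x`, the write `w`, which writes `v`, commits last. -/
structure LatestWrite (ct : Event Tid Loc (ELab Loc Val) → ℕ)
    (S : Set (Event Tid Loc (ELab Loc Val))) (x : Option Loc) (v : Option Val)
    (w : Event Tid Loc (ELab Loc Val)) : Prop where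
  mem : w ∈ S
  isW : w.IsW
  loc_eq : w.loc = x
  val_eq : w.valW = v
  commit_le : ∀ w' ∈ S, w'.IsW → w'.loc = x → ct w' ≤ ct w

theorem LatestWrite.of_subset {ct : Event Tid Loc (ELab Loc Val) → ℕ}
    {S S' : Set (Event Tid Loc (ELab Loc Val))} {x : Option Loc} {v : Option Val}
    (h : LatestWrite ct S x v e) (hS : S ⊆ S') (h' : ∀ w ∈ S', w.IsW → w.loc = x → w ∈ S) :
    LatestWrite ct S' x v e where
  mem := hS h.mem
  isW := h.isW
  loc_eq := h.loc_eq
  val_eq := h.val_eq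
  commit_le w hw hW hx := h.commit_le w (h' w hw hW hx) hW hx

variable {q : ℕ → (Loc → Val) × (Tid → List (Loc × Val))}
  (run : StutterRun (MTSO Tid Loc Val) q l) (fair : StutterFair (MTSO Tid Loc Val) q l)
include run fair

theorem time_eq_of_commitTime_eq (he : e ∈ eventsOf Loc (histBeh (obsHist l)))
    (he' : e' ∈ eventsOf Loc (histBeh (obsHist l))) (heq : commitTime l e = commitTime l e') :
    time (obsHist l) e = time (obsHist l) e' := by
  rcases mem_eventsOf_histBeh.1 he with ⟨x, rfl⟩ | ⟨n, hn⟩ <;>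
    rcases mem_eventsOf_histBeh.1 he' with ⟨y, rfl⟩ | ⟨m, hm⟩
  · rw [time_init, time_init]
  · rw [commitTime_init, hm.commitTime_eq] at heq
    cases heq
  · rw [commitTime_init, hn.commitTime_eq] at heq
    cases heq
  · rw [hn.commitTime_eq, hm.commitTime_eq] at heq
    rw [hn.time_eq, hm.time_eq]
    obtain ⟨τ, a, hn, -⟩ := hn
    obtain ⟨τ', b, hm, -⟩ := hm
    rw [flushTime_inj run fair (obsHist_eq_some.1 hn) (obsHist_eq_some.1 hm) (Nat.succ.inj heq)]

theorem time_le_commitTime (he : e ∈ eventsOf Loc (histBeh (obsHist l))) :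
    time (obsHist l) e ≤ commitTime l e := by
  rcases mem_eventsOf_histBeh.1 he with ⟨x, rfl⟩ | ⟨n, hn⟩
  · exact (time_init x).trans_le (Nat.zero_le _)
  · rw [hn.time_eq, hn.commitTime_eq]
    obtain ⟨τ, a, hn, -⟩ := hn
    exact Nat.succ_le_succ (le_flushTime run fair (obsHist_eq_some.1 hn))

theorem commitTime_lt_of_sb (he : e ∈ eventsOf Loc (histBeh (obsHist l)))
    (he' : e' ∈ eventsOf Loc (histBeh (obsHist l))) (hW : e'.IsW) (h : e.Sb e') :
    commitTime l e < commitTime l e' := by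
  rcases sb_cases he he' h with ⟨⟨x, rfl⟩, n, hn⟩ | ⟨n, m, τ, a, b, hlt, hn, hm, rfl, rfl⟩
  · rw [commitTime_init, hn.commitTime_eq]
    exact Nat.succ_pos _
  · rw [OccursAt.commitTime_eq ⟨τ, a, hn, rfl⟩, OccursAt.commitTime_eq ⟨τ, b, hm, rfl⟩]
    exact Nat.succ_lt_succ (flushTime_lt_flushTime run fair (obsHist_eq_some.1 hn)
      (obsHist_eq_some.1 hm) hW hlt)

theorem exists_latestWrite_of_memory (n : ℕ) (x : Loc) :
    ∃ w, LatestWrite (commitTime l) {e ∈ eventsOf Loc (histBeh (obsHist l)) | commitTime l e ≤ n}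
      (some x) (some ((q n).1 x)) w := by
  classical
  induction n with
  | zero =>
    refine ⟨.init x, ⟨init_mem_eventsOf _ x, (commitTime_init x).le⟩, Event.isW_init x, rfl, ?_, ?_⟩
    · rw [run.init]
      rfl
    · exact fun w' hw' _ _ => hw'.2.trans (Nat.zero_le _)
  | succ n ih =>
    by_cases hc : ∃ j τ a, l j = some (Sum.inl (τ, a)) ∧ a.valW.isSome ∧ flushTime l j = n
    · obtain ⟨j, τ, a, hj, ha, hjn⟩ := hc
      obtain ⟨v, hv⟩ := Option.isSome_iff_exists.1 ha
      rw [memory_eq_update_of_flushTime_eq run fair hj hv hjn]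
      rcases eq_or_ne x a.loc with rfl | hx
      · have occurs : OccursAt (Loc := Loc) (obsHist l) j _ := ⟨τ, a, obsHist_eq_some.2 hj, rfl⟩
        have commit := occurs.commitTime_eq.trans (congrArg Nat.succ hjn)
        rw [Function.update_self]
        exact ⟨_, ⟨occurs.mem, commit.le⟩, ha, rfl, hv, fun w' hw' _ _ => hw'.2.trans commit.ge⟩
      · rw [Function.update_of_ne hx]
        refine ih.imp fun w hw => hw.of_subset (fun _ h => ⟨h.1, h.2.trans n.le_succ⟩) ?_
        rintro w' ⟨hw', hle⟩ - hloc
        refine ⟨hw', (commitTime_le_or_flushTime_eq hw' hle).resolve_right ?_⟩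
        rintro ⟨j', ⟨τ', a', hj', rfl⟩, hjn'⟩
        rw [obsHist_eq_some] at hj'
        cases flushTime_inj run fair hj hj' (hjn.trans hjn'.symm)
        cases hj.symm.trans hj'
        exact hx (Option.some.inj hloc).symm
    · rw [run.memory_eq_of_forall_flushTime_ne fun j τ a hj ha hjn => hc ⟨j, τ, a, hj, ha, hjn⟩]
      refine ih.imp fun w hw => hw.of_subset (fun _ h => ⟨h.1, h.2.trans n.le_succ⟩) ?_
      rintro w' ⟨hw', hle⟩ hW -
      refine ⟨hw', (commitTime_le_or_flushTime_eq hw' hle).resolve_right ?_⟩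
      rintro ⟨j, ⟨τ, a, hj, rfl⟩, hjn⟩
      exact hc ⟨j, τ, a, obsHist_eq_some.1 hj, hW, hjn⟩

end CommitTimes

section BufferedReads

variable {Tid Loc Val : Type*} {l : ℕ → Option ((Tid × ELab Loc Val) ⊕ Tid)} {τ : Tid}
  {n : ℕ} {v : Val} {a : ELab Loc Val} {e r : Event Tid Loc (ELab Loc Val)}

theorem IsPending.commitTime_le_or_occursAt {ts : List ℕ} (h : IsPending l τ n ts)
    (he : e ∈ eventsOf Loc (histBeh (obsHist l))) (hn : l n = some (Sum.inl (τ, a)))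
    (hsb : e.Sb (.ev (countSome (threadHist (obsHist l) τ) n) τ a)) :
    commitTime l e ≤ n ∨ ∃ i ∈ ts, StoresAt l τ i ∧ OccursAt (obsHist l) i e := by
  rcases mem_eventsOf_histBeh.1 he with ⟨x, rfl⟩ | ⟨i, τ', b, hi, rfl⟩
  · exact Or.inl ((commitTime_init x).trans_le n.zero_le)
  · obtain ⟨rfl, hlt⟩ := (sb_iff_of_occursAt hi (obsHist_eq_some.2 hn)).1 hsb
    have occurs : OccursAt (Loc := Loc) (obsHist l) i _ := ⟨τ', b, hi, rfl⟩
    rw [occurs.commitTime_eq, Nat.succ_le_iff]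
    rcases storesAt_or_isSome_valR (obsHist_eq_some.1 hi) with hs | hb
    · exact (lt_or_ge _ _).imp_right fun hge => ⟨i, (h.mem_iff i).2 ⟨hs, hlt, hge⟩, hs, occurs⟩
    · exact Or.inl ((flushTime_of_isSome_valR (obsHist_eq_some.1 hi) hb).trans_lt hlt)

theorem commitTime_eq_time [Zero Val] (hr : r ∈ eventsOf Loc (histBeh (obsHist l))) (hR : r.IsR) :
    commitTime l r = time (obsHist l) r := by
  obtain ⟨n, hn⟩ := exists_occursAt_of_isR hr hR
  rw [hn.commitTime_eq, hn.time_eq]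
  obtain ⟨τ, a, hn, rfl⟩ := hn
  rw [flushTime_of_isSome_valR (obsHist_eq_some.1 hn) hR]

variable [Zero Val] {q : ℕ → (Loc → Val) × (Tid → List (Loc × Val))}
  (run : StutterRun (MTSO Tid Loc Val) q l) (fair : StutterFair (MTSO Tid Loc Val) q l)
include run fair

theorem exists_latestWrite_of_read (hn : l n = some (Sum.inl (τ, a))) (ha : a.valR = some v)
    (hr : r = .ev (countSome (threadHist (obsHist l) τ) n) τ a) :
    ∃ w, LatestWrite (commitTime l)
      {e ∈ eventsOf Loc (histBeh (obsHist l)) | commitTime l e < commitTime l r ∨ e.Sb r}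
      (some a.loc) (some v) w := by
  have commit_r : commitTime l r = n + 1 := by
    rw [OccursAt.commitTime_eq ⟨τ, a, obsHist_eq_some.2 hn, hr⟩,
      flushTime_of_isSome_valR hn (Option.isSome_of_eq_some ha)]
  subst hr
  obtain ⟨ts, pending, issue⟩ := exists_isPending run fair τ n
  simp only [commit_r, Nat.lt_succ_iff]
  have visible : ∀ w ∈ eventsOf Loc (histBeh (obsHist l)), (commitTime l w ≤ n ∨ w.Sb _) →
      commitTime l w ≤ n ∨ ∃ i ∈ ts, StoresAt l τ i ∧ OccursAt (obsHist l) i w :=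
    fun w hw h => h.elim Or.inl (pending.commitTime_le_or_occursAt hw hn)
  rw [← run.overlay_buffer_eq hn ha]
  rcases issue.overlay_cases pending.pairwise (q n).1 a.loc with ⟨j, hj, hlj, newest⟩ | ⟨hM, none⟩
  · have occurs : OccursAt (Loc := Loc) (obsHist l) j _ := ⟨τ, _, obsHist_eq_some.2 hlj, rfl⟩
    obtain ⟨-, hlt, hflush⟩ := (pending.mem_iff j).1 hj
    refine ⟨_, ⟨occurs.mem, Or.inr ?_⟩, rfl, rfl, rfl, ?_⟩
    · exact (sb_iff_of_occursAt (obsHist_eq_some.2 hlj) (obsHist_eq_some.2 hn)).2 ⟨rfl, hlt⟩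
    rintro w ⟨hw, hvis⟩ - hloc
    rw [occurs.commitTime_eq]
    rcases visible w hw hvis with hle | ⟨i, hi, ⟨y, u, hli⟩, hoccurs⟩
    · exact hle.trans (hflush.trans (Nat.le_succ _))
    · rw [hoccurs.commitTime_eq]
      obtain ⟨τ', b, hli', rfl⟩ := hoccurs
      cases (obsHist_eq_some.2 hli).symm.trans hli'
      cases hloc
      rcases (newest i hi u hli).eq_or_lt with rfl | hij
      · exact le_rfl
      · exact Nat.succ_le_succ (flushTime_lt_flushTime run fair hli hlj rfl hij).le
  · rw [hM]
    obtain ⟨w, hw⟩ := exists_latestWrite_of_memory run fair n a.loc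
    refine ⟨w, hw.of_subset (fun _ h => ⟨h.1, Or.inl h.2⟩) ?_⟩
    rintro w ⟨hw, hvis⟩ - hloc
    refine ⟨hw, (visible w hw hvis).resolve_right ?_⟩
    rintro ⟨i, hi, ⟨y, u, hli⟩, τ', b, hli', rfl⟩
    cases (obsHist_eq_some.2 hli).symm.trans hli'
    cases hloc
    exact none i hi u hli

theorem exists_latestWrite_of_isR (hr : r ∈ eventsOf Loc (histBeh (obsHist l))) (hR : r.IsR) :
    ∃ w, LatestWrite (commitTime l)
      {e ∈ eventsOf Loc (histBeh (obsHist l)) | commitTime l e < commitTime l r ∨ e.Sb r}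
      r.loc r.valR w := by
  obtain ⟨n, τ, a, hn, rfl⟩ := exists_occursAt_of_isR hr hR
  obtain ⟨v, hv⟩ := Option.isSome_iff_exists.1 hR
  rw [hv]
  exact exists_latestWrite_of_read run fair (obsHist_eq_some.1 hn) hv rfl

theorem eq_of_commitTime_eq (hr : r ∈ eventsOf Loc (histBeh (obsHist l)))
    (he : e ∈ eventsOf Loc (histBeh (obsHist l))) (hR : r.IsR)
    (heq : commitTime l r = commitTime l e) : r = e := by
  obtain ⟨n, hn⟩ := exists_occursAt_of_isR hr hR
  have htime := time_eq_of_commitTime_eq run fair hr he heq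
  rcases mem_eventsOf_histBeh.1 he with ⟨x, rfl⟩ | ⟨m, hm⟩
  · rw [hn.time_eq, time_init] at htime
    cases htime
  · rw [hn.time_eq, hm.time_eq] at htime
    cases htime
    exact hn.event_unique hm

theorem exists_commitData : ∃ src, CommitData (eventsOf Loc (histBeh (obsHist l))) src
    (time (obsHist l)) (commitTime l) := by
  choose! src latest using fun r hr hR => exists_latestWrite_of_isR (r := r) run fair hr hR
  exact ⟨src, {
    wf := wellFormed_eventsOf _
    src_mem := fun r hr hR => (latest r hr hR).mem.1
    src_isW := fun r hr hR => (latest r hr hR).isW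
    src_loc := fun r hr hR => (latest r hr hR).loc_eq
    src_val := fun r hr hR => (latest r hr hR).val_eq
    ts_inj := fun a ha b hb _ _ hl heq =>
      eq_of_time_eq ha hb hl (time_eq_of_commitTime_eq run fair ha hb heq)
    time_lt_of_sb := fun _ ha _ hb => time_lt_of_sb ha hb
    time_le_commit := fun _ => time_le_commitTime run fair
    commit_eq_time := fun _ => commitTime_eq_time
    commit_inj := fun _ hr _ he => eq_of_commitTime_eq run fair hr he
    commit_lt_of_sb := fun _ ha _ hb _ hW => commitTime_lt_of_sb run fair ha hb hW
    src_visible := fun r hr hR => (latest r hr hR).mem.2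
    commit_le_of_visible := fun r hr hR w hw hW ⟨x, hx, hx'⟩ hvis =>
      (latest r hr hR).commit_le w ⟨hw, hvis⟩ hW (hx.trans hx'.symm) }⟩

end BufferedReads

theorem exists_fair_mem_GTSO_of_mem_BehMF_MTSO {Tid Loc Val : Type*} [Zero Val] [Countable Tid]
    {β : Behavior Tid (ELab Loc Val)} (hβ : β ∈ (MTSO Tid Loc Val).BehMF) :
    ∃ G ∈ GTSO Tid (ELab Loc Val), G.Fair ∧ eventsOf Loc β = G.E ∧ Irrefl G.hbRA := by
  obtain ⟨q, l, run, fair, rfl⟩ := LTS.exists_stutterFair_of_mem_BehMF hβ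
  obtain ⟨src, d⟩ := exists_commitData run fair
  exact ⟨d.graph, ⟨d.irrefl_hbTSO, d.irrefl_scLoc⟩, d.fair, rfl, d.irrefl_hbRA⟩

/-! ### Robust programs -/

section Robust

variable {Tid Loc Val : Type*} [Zero Val]

theorem Program.BehTF_subset_Beh {L : Type*} (P : Program Tid L) : P.BehTF ⊆ P.Beh := by
  rintro _ ⟨μ, hμ, rfl⟩
  exact ⟨_, ⟨μ, hμ.1, rfl⟩, rfl⟩

theorem FinitelyRobust.inter_eq_inter_BehMF_MSC {L : Type*} [MemLabel L Loc Val] [Finite Tid]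
    {P : Program Tid L} {𝒢 : DeclMem Tid L} (hP : FinitelyRobust P 𝒢) (h𝒢 : PrefixClosed 𝒢)
    {B : Set (Behavior Tid L)} (hsub : (MSC Tid Loc Val L).BehMF ⊆ B)
    (hB : ∀ β ∈ B, ∃ G ∈ 𝒢, G.Fair ∧ eventsOf Loc β = G.E ∧ Irrefl G.hbRA) :
    P.Beh ∩ B = P.Beh ∩ (MSC Tid Loc Val L).BehMF ∧
      P.BehTF ∩ B = P.BehTF ∩ (MSC Tid Loc Val L).BehMF := by
  have hsup : P.Beh ∩ B ⊆ (MSC Tid Loc Val L).BehMF := by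
    rintro β ⟨hβ, hβB⟩
    obtain ⟨G, hG, hf, hE, hac⟩ := hB β hβB
    exact mem_BehMF_MSC_of_mem_GSC (hP.mem_GSC h𝒢 hβ hG hE hac) hf hE
  have inter_eq : ∀ S ⊆ P.Beh, S ∩ B = S ∩ (MSC Tid Loc Val L).BehMF := fun S hS =>
    (Set.inter_subset_inter_right S hsub).antisymm'
      (Set.subset_inter Set.inter_subset_left fun β hβ => hsup ⟨hS hβ.1, hβ.2⟩)
  exact ⟨inter_eq _ subset_rfl, inter_eq _ P.BehTF_subset_Beh⟩

theorem BehMF_MSC_subset_Beh_GRC11 :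
    (MSC Tid Loc Val (CLab Loc Val)).BehMF ⊆
      DeclMem.Beh (GRC11 Tid Loc Val ∩ GFair Tid (CLab Loc Val)) := by
  intro β hβ
  obtain ⟨G, ⟨hG, hf⟩, hE⟩ := BehMF_MSC_subset_Beh_GSC hβ
  exact ⟨G, ⟨GSC_subset_GRC11 hG, hf⟩, hE⟩

end Robust

end WeakMem

open WeakMem in
theorem corollary4p12 {Tid Loc Val : Type*} [Finite Tid] [Zero Val] :
    (∀ P : Program Tid (ELab Loc Val), FinitelyRobust P (GTSO Tid (ELab Loc Val)) →
      P.MemFairBehUnder (MTSO Tid Loc Val) =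
          P.MemFairBehUnder (MSC Tid Loc Val (ELab Loc Val)) ∧
      P.ThreadMemFairBehUnder (MTSO Tid Loc Val) =
          P.ThreadMemFairBehUnder (MSC Tid Loc Val (ELab Loc Val))) ∧
    (∀ P : Program Tid (ELab Loc Val), FinitelyRobust P (GRA Tid (ELab Loc Val)) →
      P.MemFairBehUnder (MRA Tid Loc Val) =
          P.MemFairBehUnder (MSC Tid Loc Val (ELab Loc Val)) ∧
      P.ThreadMemFairBehUnder (MRA Tid Loc Val) =
          P.ThreadMemFairBehUnder (MSC Tid Loc Val (ELab Loc Val))) ∧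
    (∀ P : Program Tid (ELab Loc Val), FinitelyRobust P (GStrongCOH Tid (ELab Loc Val)) →
      P.MemFairBehUnder (MStrongCOH Tid Loc Val) =
          P.MemFairBehUnder (MSC Tid Loc Val (ELab Loc Val)) ∧
      P.ThreadMemFairBehUnder (MStrongCOH Tid Loc Val) =
          P.ThreadMemFairBehUnder (MSC Tid Loc Val (ELab Loc Val))) ∧
    (∀ P : Program Tid (CLab Loc Val), FinitelyRobust P (GRC11 Tid Loc Val) →
      P.DeclFairBehUnder (GRC11 Tid Loc Val) =
          P.MemFairBehUnder (MSC Tid Loc Val (CLab Loc Val)) ∧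
      P.DeclThreadFairBehUnder (GRC11 Tid Loc Val) =
          P.ThreadMemFairBehUnder (MSC Tid Loc Val (CLab Loc Val))) := by
  refine ⟨fun P hP => ?_, fun P hP => ?_, fun P hP => ?_, fun P hP => ?_⟩
  · exact hP.inter_eq_inter_BehMF_MSC prefixClosed_GTSO BehMF_MSC_subset_MTSO
      fun _ => exists_fair_mem_GTSO_of_mem_BehMF_MTSO
  · exact hP.inter_eq_inter_BehMF_MSC prefixClosed_GRA BehMF_MSC_subset_MRA
      fun _ => exists_fair_mem_GRA_of_mem_BehMF_MRA
  · exact hP.inter_eq_inter_BehMF_MSC prefixClosed_GStrongCOH BehMF_MSC_subset_MStrongCOH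
      fun _ => exists_fair_mem_GStrongCOH_of_mem_BehMF_MStrongCOH
  · exact hP.inter_eq_inter_BehMF_MSC prefixClosed_GRC11 BehMF_MSC_subset_Beh_GRC11
      fun β ⟨G, ⟨hG, hf⟩, hE⟩ => ⟨G, hG, hf, hE, hG.2.2.2.2⟩
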